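/- **Definitions.** A function $\varphi$ on the upper half-plane $\mathbb H$ has the asymptotic expansion $\frac{p}{y}+\ell\log(-2\pi i y)+c+\sum_{n\ge 0}a_n y^{n+1}$ at $0$ if, for every $M\ge 0$ and $\delta>0$, the difference of $\varphi(y)$ and the expansion truncated after $a_{M-1}y^{M}$ is $O(|y|^{M+1})$ as $y\to 0$ with $\delta\le\arg y\le\pi-\delta$. An *L-function* is a function $L$, meromorphic on $\mathbb C$, that in some right half-plane is given by an absolutely convergent Dirichlet series $\sum_{m\ge1}A_m m^{-s}$ with an Euler product $\prod_p\sum_{k\ge 0}A_{p^k}p^{-ks}$; non-zero constant multiples of these are also called L-functions. Such an expansion is *modular resurgent*, with Stokes constants $S_m$ ($m\in\mathbb Z_{\neq0}$) at the points $m\mathcal A$, where $\mathcal A\in\mathbb C^\times$, if its power series part is Gevrey-1 (i.e. $|a_n|\le C r^{-n}n!$ for some $C,r>0$), its Borel transform $\sum_n a_n\zeta^n/n!$ extends to a meromorphic function on $\mathbb C$ whose singularities are exactly simple poles at the points $m\mathcal A$, $m\in\mathbb Z_{\ne0}$, equal to $-\frac{S_m}{2\pi i(\zeta-m\mathcal A)}$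 plus a regular function near $m\mathcal A$, with $S_m\ne 0$, and if $L_+(s)=\sum_{m>0}S_m m^{-s}$ and $L_-(s)=-\sum_{m>0}S_{-m}m^{-s}$ are L-functions. Functions $f,g$ on $\mathbb H$ *satisfy the modular resurgence paradigm* if: 1. $g$ and $f$ have modular resurgent asymptotic expansions at $0$, with Stokes constants $S_m$ and $R_m$ and L-functions $L_\pm$ and $L'_\pm$, respectively; 2. for some constants $f_0,g_0\in\mathbb C$ and $c,c'\in\mathbb C^\times$, and with $q=e^{2\pi i y}$, one has $f(y)=f_0+c\sum_{m>0}S_mq^m$ and $g(y)=g_0+c'\sum_{m>0}R_mq^m$ on $\mathbb H$; 3. $f$ and $g$ are inverse Mellin transforms of $L_+$ and $L'_+$: for $\Re s$ large, the Mellin transforms of $t\mapsto f(it)-f_0$ and $t\mapsto g(it)-g_0$ on $(0,\infty)$ converge and equal $c(2\pi)^{-s}\Gamma(s)L_+(s)$ and $c'(2\pi)^{-s}\Gamma(s)L'_+(s)$; 4. for each sign, $L_\pm$ and $L'_\pm$ are linked by a functional equation $\gamma(s)L_\pm(s)=\varepsilon\,\gamma'(-s)L'_\pm(-s)$ of meromorphic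 functions, with $\varepsilon\ne0$ and with $\gamma,\gamma'$ of the form $Q^s\prod_j\pi^{-(s+\mu_j)/2}\Gamma\big(\frac{s+\mu_j}2\big)$, where $Q>0$, the product is finite and $\mu_j\in\mathbb C$. **Theorem.** Let $N\ge2$, let $\chi_N$ be a primitive Dirichlet character of modulus $N$, $\zeta_N=e^{2\pi i/N}$, $q=e^{2\pi i y}$, and for $y\in\mathbb H$ put $$\mathfrak f(y)=\sum_{k=1}^{N}\chi_N(k)\log(\zeta_N^k;q)_\infty,\qquad \mathfrak g(y)=\sum_{k=1}^{N}\chi_N(k)\log(q^k;q^N)_\infty,$$ where $\log(x;q)_\infty=\sum_{n\ge0}\log(1-xq^n)$ with principal logarithms (the terms with $\chi_N(k)=0$ are omitted). Then $\mathfrak f$ and $\mathfrak g$ satisfy the modular resurgence paradigm if and only if $\chi_N$ is odd. If $\chi_N$ is odd, then, with $G(\chi_N)=\sum_{j=1}^{N-1}\chi_N(j)\zeta_N^j$, $L(s)=L(s+1,\overline{\chi_N})\zeta(s)$ and $L'(s)=L(s,\chi_N)\zeta(s+1)$, more precisely: * the expansion of $\mathfrak g$ at $0$ is modular resurgent, with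 Stokes constants $S_m=-2G(\chi_N)\sum_{d\mid m,\,d>0}\frac{\overline{\chi_N}(d)}{d}$ at $\frac{2\pi i m}{N}$ and L-functions $L_\pm=\mp2G(\chi_N)L$; * the expansion of $\mathfrak f$ at $0$ is modular resurgent, with Stokes constants $R_m=2\sum_{d\mid m,\,d>0}\frac dm\chi_N(d)$ at $\frac{2\pi i m}{N}$ and L-functions $L'_\pm=2L'$; * each function generates the Stokes constants of the other's asymptotic series: for $y\in\mathbb H$, $$\mathfrak f(y)=\sum_{k=1}^{N-1}\chi_N(k)\log(1-\zeta_N^k)+\frac12\sum_{m\ge1}S_mq^m,\qquad \mathfrak g(y)=-\frac12\sum_{m\ge1}R_mq^m;$$ * the completed functions $\Lambda(s)=\Lambda(s+1,\overline{\chi_N})\Lambda_\zeta(s)$ and $\Lambda'(s)=\Lambda(s,\chi_N)\Lambda_\zeta(s+1)$, where $\Lambda(s,\chi)=N^{s/2}\pi^{-(s+1)/2}\Gamma\big(\frac{s+1}2\big)L(s,\chi)$ and $\Lambda_\zeta(s)=\pi^{-s/2}\Gamma\big(\frac s2\big)\zeta(s)$ (meromorphically continued), satisfy $$\Lambda(s)=\frac{i\sqrt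 N}{G(\chi_N)}\,\Lambda'(-s),\qquad s\in\mathbb C\setminus\{0,1\}.$$ -/

import Mathlib

open Complex Filter Topology Asymptotics

noncomputable section

namespace ModularResurgence

/-! ### Asymptotic expansions at the origin of the upper half-plane -/

/-- A formal expansion `p / y + ℓ * log (-2πi y) + c + ∑_{n ≥ 0} a_n y^(n+1)`: a formal power
series without constant term, together with finitely many elementary terms. -/
structure FormalExpansion where
  pole : ℂ
  logCoeff : ℂ
  const : ℂ
  coeff : ℕ → ℂ

/-- The truncation of a formal expansion after the term `a_{M-1} y^M`. On the upper half-plane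
`-2πi y` has positive real part, so the principal logarithm is the natural one. -/
def FormalExpansion.truncation (F : FormalExpansion) (M : ℕ) (y : ℂ) : ℂ :=
  F.pole / y + F.logCoeff * log (-2 * Real.pi * I * y) + F.const +
    ∑ n ∈ Finset.range M, F.coeff n * y ^ (n + 1)

/-- The closed sector `δ ≤ arg y ≤ π - δ` of the upper half-plane, without its vertex. -/
def sector (δ : ℝ) : Set ℂ := {y | y ≠ 0 ∧ δ ≤ arg y ∧ arg y ≤ Real.pi - δ}

/-- `F` is the (Poincaré) asymptotic expansion of `φ` as `y → 0` with `Im y > 0`, uniformly in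
every closed subsector of the upper half-plane. Only values of `φ` at `Im y > 0` matter. -/
def IsAsymptoticExpansion (φ : ℂ → ℂ) (F : FormalExpansion) : Prop :=
  ∀ δ : ℝ, 0 < δ → ∀ M : ℕ,
    (fun y => φ y - F.truncation M y) =O[𝓝[sector δ] 0] (fun y => y ^ (M + 1))

/-! ### L-functions and modular resurgent series -/

/-- `L` is the L-function with coefficients `A m`, `m ≥ 1`: in some right half-plane it is the sum
of the Dirichlet series `∑ A m / m ^ s` and has the Euler product `∏_p ∑_k A (p^k) / p^(k s)`, and
it is meromorphic on the whole complex plane. -/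
def IsLFunction (A : ℕ → ℂ) (L : ℂ → ℂ) : Prop :=
  MeromorphicOn L Set.univ ∧
  ∃ C : ℝ, 0 ≤ C ∧ ∀ s : ℂ, C < s.re →
    LSeriesSummable A s ∧ L s = LSeries A s ∧
    HasProd (fun p : Nat.Primes => ∑' k : ℕ, A ((p : ℕ) ^ k) / ((p : ℕ) : ℂ) ^ ((k : ℂ) * s)) (L s)

/-- The numbers `S m`, `m ≥ 1`, are the coefficients of the L-function `L`, where (as an Euler
product forces the first coefficient to be `1`) an overall non-zero constant factor is allowed. -/
def AreLFunctionCoefficients (S : ℕ → ℂ) (L : ℂ → ℂ) : Prop :=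
  ∃ c : ℂ, c ≠ 0 ∧ IsLFunction (fun m => S m / c) (fun s => L s / c)

/-- The formal power series `∑ a_n y^(n+1)` is Gevrey-1. -/
def IsGevreyOne (a : ℕ → ℂ) : Prop :=
  ∃ C r : ℝ, 0 < C ∧ 0 < r ∧ ∀ n : ℕ, ‖a n‖ ≤ C * r⁻¹ ^ n * n.factorial

/-- The Borel transform `∑ a_n ζ^n / n!` of `∑ a_n y^(n+1)` extends to a function on the plane
whose singularities are exactly simple poles at the points `m 𝒜`, `m ∈ ℤ`, `m ≠ 0`, and the
Stokes constant at `m 𝒜` is `S m`, i.e. near `m 𝒜` the function is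
`- S m / (2πi (ζ - m 𝒜))` plus a function regular at `m 𝒜`. -/
def HasStokesTower (a : ℕ → ℂ) (𝒜 : ℂ) (S : ℤ → ℂ) : Prop :=
  𝒜 ≠ 0 ∧ ∃ B : ℂ → ℂ,
    (∀ᶠ ζ in 𝓝 (0 : ℂ), HasSum (fun n : ℕ => a n / (n.factorial : ℂ) * ζ ^ n) (B ζ)) ∧
    DifferentiableOn ℂ B {ζ | ∀ m : ℤ, m ≠ 0 → ζ ≠ m * 𝒜} ∧
    ∀ m : ℤ, m ≠ 0 → S m ≠ 0 ∧ ∃ h : ℂ → ℂ, AnalyticAt ℂ h (m * 𝒜) ∧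
      ∀ᶠ ζ in 𝓝[≠] ((m : ℂ) * 𝒜), B ζ = -S m / (2 * Real.pi * I * (ζ - m * 𝒜)) + h ζ

/-- `∑ a_n y^(n+1)` is a modular resurgent series with singularities at `m 𝒜`, Stokes constants
`S m` and L-functions `L₊ = ∑_{m>0} S_m m^(-s)`, `L₋ = -∑_{m>0} S_{-m} m^(-s)`. -/
structure IsModularResurgentSeries (a : ℕ → ℂ) (𝒜 : ℂ) (S : ℤ → ℂ) (Lpos Lneg : ℂ → ℂ) :
    Prop where
  gevrey : IsGevreyOne a
  tower : HasStokesTower a 𝒜 S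
  lpos : AreLFunctionCoefficients (fun m => S m) Lpos
  lneg : AreLFunctionCoefficients (fun m => -S (-(m : ℤ))) Lneg

/-- The function `φ` has an asymptotic expansion as `y → 0`, `Im y > 0`, and the power series
governing it is modular resurgent with the indicated data. -/
def HasModularResurgentExpansion (φ : ℂ → ℂ) (𝒜 : ℂ) (S : ℤ → ℂ) (Lpos Lneg : ℂ → ℂ) : Prop :=
  ∃ F : FormalExpansion, IsAsymptoticExpansion φ F ∧
    IsModularResurgentSeries F.coeff 𝒜 S Lpos Lneg

/-! ### The modular resurgence paradigm -/

/-- On the upper half-plane `φ` is, up to the additive constant `c₀` and the factor `c ≠ 0`, the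
generating function `∑_{m>0} S_m q^m`, `q = e^(2πi y)`. -/
def IsGeneratingFunction (φ : ℂ → ℂ) (S : ℤ → ℂ) (c₀ c : ℂ) : Prop :=
  c ≠ 0 ∧ ∀ y : ℂ, 0 < y.im →
    HasSum (fun m : ℕ => c * (S (m + 1) * exp (2 * Real.pi * I * y) ^ (m + 1))) (φ y - c₀)

/-- `φ - c₀` on the positive imaginary axis is the inverse Mellin transform of
`c (2π)^(-s) Γ(s) L(s)`: this is its Mellin transform on some right half-plane. -/
def IsInverseMellin (φ : ℂ → ℂ) (L : ℂ → ℂ) (c₀ c : ℂ) : Prop :=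
  ∃ C : ℝ, ∀ s : ℂ, C < s.re →
    HasMellin (fun t : ℝ => φ (I * t) - c₀) s (c * (2 * Real.pi : ℂ) ^ (-s) * Gamma s * L s)

/-- A completion factor `Q^s ∏_j Γ_ℝ(s + μ_j)` with `Γ_ℝ(s) = π^(-s/2) Γ(s/2)`. -/
def completionFactor (Q : ℝ) (μ : Multiset ℂ) (s : ℂ) : ℂ :=
  (Q : ℂ) ^ s * (μ.map (fun m => Gammaℝ (s + m))).prod

/-- `L` and `L'` are analytic continuations of each other: after completion by archimedean
factors they satisfy `Λ(s) = ε Λ'(-s)`, as an identity of meromorphic functions (i.e. outside a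
closed discrete set). -/
def SatisfyFunctionalEquation (L L' : ℂ → ℂ) : Prop :=
  ∃ (Q Q' : ℝ) (μ μ' : Multiset ℂ) (ε : ℂ), 0 < Q ∧ 0 < Q' ∧ ε ≠ 0 ∧
    (fun s => completionFactor Q μ s * L s) =ᶠ[codiscrete ℂ]
      (fun s => ε * (completionFactor Q' μ' (-s) * L' (-s)))

/-- The modular resurgence paradigm for `f` and `g`: the expansions of `g` and `f` at `0` are
modular resurgent, the function generating the Stokes constants of either one is (up to
normalization) the other function, which is also obtained from the corresponding L-function by
inverse Mellin transform, and the two pairs of L-functions are linked by functional equations. -/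
def SatisfyParadigm (f g : ℂ → ℂ) : Prop :=
  ∃ (𝒜 ℬ : ℂ) (S R : ℤ → ℂ) (Lpos Lneg Lpos' Lneg' : ℂ → ℂ) (f₀ g₀ cf cg : ℂ),
    HasModularResurgentExpansion g 𝒜 S Lpos Lneg ∧
    IsGeneratingFunction f S f₀ cf ∧ IsInverseMellin f Lpos f₀ cf ∧
    HasModularResurgentExpansion f ℬ R Lpos' Lneg' ∧
    IsGeneratingFunction g R g₀ cg ∧ IsInverseMellin g Lpos' g₀ cg ∧
    SatisfyFunctionalEquation Lpos Lpos' ∧ SatisfyFunctionalEquation Lneg Lneg'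

/-! ### The weighted sums of `q`-Pochhammer symbols and their L-functions -/

/-- `log (x; q)_∞ = ∑_{n ≥ 0} log (1 - x q^n)`, with principal logarithms. -/
def logQPochhammer (x q : ℂ) : ℂ := ∑' n : ℕ, log (1 - x * q ^ n)

/-- `q = e^(2πi y)`. -/
def nome (y : ℂ) : ℂ := exp (2 * Real.pi * I * y)

/-- `ζ_N = e^(2πi/N)`. -/
def rootOfUnity (N : ℕ) : ℂ := exp (2 * Real.pi * I / N)

variable {N : ℕ} [NeZero N]

/-- `𝔣(y) = ∑_k χ(k) log (ζ_N^k; q)_∞`. -/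
def weightedF (χ : DirichletCharacter ℂ N) (y : ℂ) : ℂ :=
  ∑ k ∈ Finset.Icc 1 N, χ (k : ZMod N) * logQPochhammer (rootOfUnity N ^ k) (nome y)

/-- `𝔤(y) = ∑_k χ(k) log (q^k; q^N)_∞`. -/
def weightedG (χ : DirichletCharacter ℂ N) (y : ℂ) : ℂ :=
  ∑ k ∈ Finset.Icc 1 N, χ (k : ZMod N) * logQPochhammer (nome y ^ k) (nome y ^ N)

/-- The value of `𝔣` at `q = 0`: `∑_k χ(k) log (1 - ζ_N^k)`. -/
def constF (χ : DirichletCharacter ℂ N) : ℂ :=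
  ∑ k ∈ Finset.Icc 1 N, χ (k : ZMod N) * log (1 - rootOfUnity N ^ k)

/-- The Gauss sum `∑_j χ(j) e^(2πi j/N)`. -/
def gauss (χ : DirichletCharacter ℂ N) : ℂ := gaussSum χ (ZMod.stdAddChar (N := N))

/-- `S_m = -2 G(χ) ∑_{d ∣ m} χ̄(d) / d`, over positive divisors. -/
def stokesS (χ : DirichletCharacter ℂ N) (m : ℤ) : ℂ :=
  -2 * gauss χ * ∑ d ∈ m.natAbs.divisors, χ⁻¹ (d : ZMod N) / (d : ℂ)

/-- `R_m = 2 ∑_{d ∣ m} (d / m) χ(d)`, over positive divisors. -/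
def stokesR (χ : DirichletCharacter ℂ N) (m : ℤ) : ℂ :=
  2 * ∑ d ∈ m.natAbs.divisors, (d : ℂ) / (m : ℂ) * χ (d : ZMod N)

/-- `L(s) = L(s + 1, χ̄) ζ(s)`, with the meromorphically continued factors. -/
def lfun (χ : DirichletCharacter ℂ N) (s : ℂ) : ℂ := χ⁻¹.LFunction (s + 1) * riemannZeta s

/-- `L'(s) = L(s, χ) ζ(s + 1)`, with the meromorphically continued factors. -/
def lfun' (χ : DirichletCharacter ℂ N) (s : ℂ) : ℂ := χ.LFunction s * riemannZeta (s + 1)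

/-- `Λ(s, χ) = N^(s/2) π^(-(s+δ)/2) Γ((s+δ)/2) L(s, χ)`, where `χ(-1) = (-1)^δ`; the
last three factors are Mathlib's completed L-function. -/
def completedL (χ : DirichletCharacter ℂ N) (s : ℂ) : ℂ :=
  (N : ℂ) ^ (s / 2) * χ.completedLFunction s

/-- `Λ(s) = Λ(s + 1, χ̄) Λ_ζ(s)`. -/
def lam (χ : DirichletCharacter ℂ N) (s : ℂ) : ℂ :=
  completedL χ⁻¹ (s + 1) * completedRiemannZeta s

/-- `Λ'(s) = Λ(s, χ) Λ_ζ(s + 1)`. -/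
def lam' (χ : DirichletCharacter ℂ N) (s : ℂ) : ℂ :=
  completedL χ s * completedRiemannZeta (s + 1)

end ModularResurgence

end

open ModularResurgence

/-! Expanding the logarithms turns both functions into Lambert series: for primitive χ the sum over
roots of unity produces `gauss χ * χ⁻¹ e` (`sum_character_mul_root`), so that 𝔣 minus its constant
generates S_m and 𝔤 generates R_m, whatever the parity of χ. The L-functions are products L(s + 1,
χ̄) ζ(s) and L(s, χ) ζ(s + 1) because the Stokes constants are Dirichlet convolutions of
multiplicative functions.

The expansions at 0 come from the derivatives. Summing the Lambert series in the other order gives y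
𝔤'(y) = ∑ χ(k) H(ky) with H the Bernoulli generating function, and 𝔣' as ∑ χ̄(k) h(ky), up to a
double pole and a constant factor, with h the derivative of the regular part of π cot(πx).
Euler–Maclaurin summation for periodic weights of mean zero (`norm_tsum_sub_le`) expands such sums
in every cone, and integration (`exists_isAsymptoticExpansion_of_hasDerivAt`) gives the expansions
of 𝔣 and 𝔤.

Every coefficient beyond the first is a product of a Bernoulli average and a cotangent coefficient.
By the Fourier series of Bernoulli polynomials (`bernoulliWeight_eq`) the former is an L-value times
1 ± χ(-1); the latter is a zeta value times a parity factor. For odd χ the two parity conditions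
coincide, and the coefficients are the Taylor coefficients of a Mittag-Leffler sum with simple poles
at 2πim/N and residues given by S_m or R_m (`coeffF_div_factorial`, `coeffG_div_factorial`,
`hasStokesTower_of_tsum`). For even χ the conditions exclude each other: the Borel transform of 𝔣 is
constant and has no poles (`coeffF_eq_zero`, `not_hasStokesTower_of_eq_zero`). Uniqueness of
expansions (`IsAsymptoticExpansion.coeff_unique`) makes this decisive.

The functional equation is the product of those of L(s, χ) and ζ (`lam_eq`). -/

noncomputable section

namespace ModularResurgence

/-! ### Euler–Maclaurin summation -/

/-- The remainder of the Bernoulli expansion of `F 0` on `[0, 1]`, where `F m` is the `m`-th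
derivative of `F 0`. -/
def bernoulliRemainder (F : ℕ → ℝ → ℂ) (M : ℕ) (x : ℝ) : ℂ :=
  F 0 x - (∫ t in (0 : ℝ)..1, F 0 t) -
    ∑ m ∈ Finset.range M, ((bernoulliFun (m + 1) x / (m + 1).factorial : ℝ) : ℂ) * (F m 1 - F m 0)

/-- Differentiation lowers the index of B_{m+1}/(m+1)!, so the sum shifts by one; its term with B_0
= 1 becomes F 0 1 - F 0 0, which is the integral of F 1. This recursion drives the bound below. -/
theorem hasDerivAt_bernoulliRemainder {F : ℕ → ℝ → ℂ}
    (hF : ∀ i, ∀ x ∈ Set.Icc (0 : ℝ) 1, HasDerivAt (F i) (F (i + 1) x) x) (M : ℕ) {x : ℝ}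
    (hx : x ∈ Set.Icc (0 : ℝ) 1) :
    HasDerivAt (bernoulliRemainder F (M + 1)) (bernoulliRemainder (fun i => F (i + 1)) M x) x := by
  have hint : ∫ t in (0 : ℝ)..1, F 1 t = F 0 1 - F 0 0 := by
    apply intervalIntegral.integral_eq_sub_of_hasDerivAt
    · intro t ht
      rw [Set.uIcc_of_le zero_le_one] at ht
      exact hF 0 t ht
    · apply ContinuousOn.intervalIntegrable
      intro t ht
      rw [Set.uIcc_of_le zero_le_one] at ht
      exact (hF 1 t ht).continuousAt.continuousWithinAt
  have hB : ∀ m : ℕ, HasDerivAt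
      (fun x => ((bernoulliFun (m + 1) x / (m + 1).factorial : ℝ) : ℂ) * (F m 1 - F m 0))
      (((bernoulliFun m x / m.factorial : ℝ) : ℂ) * (F m 1 - F m 0)) x := by
    intro m
    have h1 : HasDerivAt (fun x => bernoulliFun (m + 1) x / (m + 1).factorial)
        (bernoulliFun m x / m.factorial) x := by
      have := (hasDerivAt_bernoulliFun (m + 1) x).div_const ((m + 1).factorial : ℝ)
      refine this.congr_deriv ?_
      rw [Nat.factorial_succ]
      have : ((m : ℝ) + 1) ≠ 0 := by positivity
      push_cast
      field_simp
    exact h1.ofReal_comp.mul_const _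
  have hsum := HasDerivAt.fun_sum (u := Finset.range (M + 1)) fun m _ => hB m
  have := ((hF 0 x hx).sub_const (∫ t in (0 : ℝ)..1, F 0 t)).fun_sub hsum
  refine this.congr_deriv ?_
  rw [Finset.sum_range_succ', bernoulliRemainder, hint]
  simp only [bernoulliFun_zero, Nat.factorial_zero]
  push_cast
  ring

theorem continuousOn_bernoulliRemainder {F : ℕ → ℝ → ℂ}
    (hF : ∀ i, ∀ x ∈ Set.Icc (0 : ℝ) 1, HasDerivAt (F i) (F (i + 1) x) x) (M : ℕ) :
    ContinuousOn (bernoulliRemainder F M) (Set.Icc 0 1) := by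
  have h0 : ContinuousOn (F 0) (Set.Icc 0 1) := fun x hx =>
    (hF 0 x hx).continuousAt.continuousWithinAt
  refine (h0.sub continuousOn_const).sub (continuousOn_finsetSum _ fun m _ => ?_)
  refine ContinuousOn.mul (Continuous.continuousOn ?_) continuousOn_const
  exact continuous_ofReal.comp ((continuous_bernoulliFun (m + 1)).div_const _)

theorem integral_bernoulliRemainder {F : ℕ → ℝ → ℂ}
    (hF : ∀ i, ∀ x ∈ Set.Icc (0 : ℝ) 1, HasDerivAt (F i) (F (i + 1) x) x) (M : ℕ) :
    ∫ t in (0 : ℝ)..1, bernoulliRemainder F M t = 0 := by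
  have h0 : IntervalIntegrable (F 0) MeasureTheory.volume 0 1 := by
    apply ContinuousOn.intervalIntegrable
    intro t ht
    rw [Set.uIcc_of_le zero_le_one] at ht
    exact (hF 0 t ht).continuousAt.continuousWithinAt
  have hb : ∀ m : ℕ, Continuous fun x =>
      ((bernoulliFun (m + 1) x / (m + 1).factorial : ℝ) : ℂ) * (F m 1 - F m 0) := fun m =>
    (continuous_ofReal.comp ((continuous_bernoulliFun (m + 1)).div_const _)).mul continuous_const
  unfold bernoulliRemainder
  rw [intervalIntegral.integral_sub (h0.sub intervalIntegrable_const)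
    ((continuous_finsetSum _ fun m _ => hb m).intervalIntegrable _ _),
    intervalIntegral.integral_sub h0 intervalIntegrable_const,
    intervalIntegral.integral_finsetSum fun m _ => (hb m).intervalIntegrable _ _]
  rw [Finset.sum_eq_zero]
  · simp
  · intro m _
    rw [intervalIntegral.integral_mul_const, intervalIntegral.integral_ofReal,
      intervalIntegral.integral_div, integral_bernoulliFun_eq_zero (Nat.succ_ne_zero m)]
    simp

/-- Induction on M: the derivative of the remainder is the remainder of lower order for the
derivative, hence bounded by 2A. As the remainder has mean zero on an interval of length 1, its
value is an average of its differences, and the same bound holds. The 2 comes from M = 0, function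
minus mean, and does not grow. -/
theorem norm_bernoulliRemainder_le (M : ℕ) {F : ℕ → ℝ → ℂ}
    (hF : ∀ i, ∀ x ∈ Set.Icc (0 : ℝ) 1, HasDerivAt (F i) (F (i + 1) x) x) {A : ℝ}
    (hA : ∀ x ∈ Set.Icc (0 : ℝ) 1, ‖F M x‖ ≤ A) {x : ℝ} (hx : x ∈ Set.Icc (0 : ℝ) 1) :
    ‖bernoulliRemainder F M x‖ ≤ 2 * A := by
  induction M generalizing F x with
  | zero =>
    have h1 : ‖∫ t in (0 : ℝ)..1, F 0 t‖ ≤ A * |1 - 0| :=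
      intervalIntegral.norm_integral_le_of_norm_le_const fun t ht => by
        rw [Set.uIoc_of_le zero_le_one] at ht
        exact hA t (Set.Ioc_subset_Icc_self ht)
    have h2 := norm_sub_le (F 0 x) (∫ t in (0 : ℝ)..1, F 0 t)
    have h3 := hA x hx
    simp only [bernoulliRemainder, Finset.range_zero, Finset.sum_empty, sub_zero]
    norm_num at h1
    linarith
  | succ M ih =>
    have hd : ∀ t ∈ Set.Icc (0 : ℝ) 1, ‖bernoulliRemainder (fun i => F (i + 1)) M t‖ ≤ 2 * A :=
      fun t ht => ih (fun i => hF (i + 1)) hA ht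
    have hA0 : 0 ≤ 2 * A := (norm_nonneg _).trans (hd x hx)
    have hlip : ∀ t ∈ Set.Icc (0 : ℝ) 1,
        ‖bernoulliRemainder F (M + 1) x - bernoulliRemainder F (M + 1) t‖ ≤ 2 * A := by
      intro t ht
      have := (convex_Icc (0 : ℝ) 1).norm_image_sub_le_of_norm_hasDerivWithin_le
        (fun u hu => (hasDerivAt_bernoulliRemainder hF M hu).hasDerivWithinAt) hd ht hx
      refine this.trans (mul_le_of_le_one_right hA0 ?_)
      rw [Real.norm_eq_abs, abs_le]
      constructor <;> linarith [hx.1, hx.2, ht.1, ht.2]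
    have hci : IntervalIntegrable (bernoulliRemainder F (M + 1)) MeasureTheory.volume 0 1 := by
      apply ContinuousOn.intervalIntegrable
      rw [Set.uIcc_of_le zero_le_one]
      exact continuousOn_bernoulliRemainder hF _
    have heq : bernoulliRemainder F (M + 1) x =
        ∫ t in (0 : ℝ)..1, (bernoulliRemainder F (M + 1) x - bernoulliRemainder F (M + 1) t) := by
      rw [intervalIntegral.integral_sub intervalIntegrable_const hci,
        integral_bernoulliRemainder hF]
      simp
    rw [heq]
    have h1 := intervalIntegral.norm_integral_le_of_norm_le_const (a := (0 : ℝ)) (b := 1)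
      (f := fun t => bernoulliRemainder F (M + 1) x - bernoulliRemainder F (M + 1) t)
      (C := 2 * A) fun t ht => by
        rw [Set.uIoc_of_le zero_le_one] at ht
        exact hlip t (Set.Ioc_subset_Icc_self ht)
    simpa using h1

/-- The closed convex cone `κ |z| ≤ Im z` in the upper half-plane. -/
def cone (κ : ℝ) : Set ℂ := {z | κ * ‖z‖ ≤ z.im}

theorem mem_cone {κ : ℝ} {z : ℂ} : z ∈ cone κ ↔ κ * ‖z‖ ≤ z.im := Iff.rfl

theorem zero_mem_cone (κ : ℝ) : (0 : ℂ) ∈ cone κ := by simp [mem_cone]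

theorem ofReal_mul_mem_cone {κ t : ℝ} {z : ℂ} (hz : z ∈ cone κ) (ht : 0 ≤ t) :
    (t : ℂ) * z ∈ cone κ := by
  rw [mem_cone] at *
  rw [norm_mul, norm_real, Real.norm_of_nonneg ht, im_ofReal_mul]
  nlinarith

theorem im_pos_of_mem_cone {κ : ℝ} (hκ : 0 < κ) {z : ℂ} (hz : z ∈ cone κ) (hz0 : z ≠ 0) :
    0 < z.im :=
  lt_of_lt_of_le (mul_pos hκ (norm_pos_iff.mpr hz0)) hz

theorem convex_cone (κ : ℝ) (hκ : 0 ≤ κ) : Convex ℝ (cone κ) := by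
  have h : ConvexOn ℝ Set.univ fun z : ℂ => κ * ‖z‖ - z.im :=
    (convexOn_univ_norm.smul hκ).sub (imLm.concaveOn convex_univ)
  have := h.convex_le 0
  convert! this using 1
  ext z
  simp [mem_cone]

/-- The coefficient `L(-m, ψ) (-1)^m / m!`, in terms of Bernoulli polynomials. -/
def bernoulliWeight (N : ℕ) (ψ : ℕ → ℂ) (m : ℕ) : ℂ :=
  -(N : ℂ) ^ m * ∑ a ∈ Finset.range N,
    ψ a * ((bernoulliFun (m + 1) (a / N) / (m + 1).factorial : ℝ) : ℂ)

/-- The terms after the first are dominated by the telescoping differences of 1 / (t (1 + n t)), a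
discrete form of the integral of (1 + x t)⁻² being 1 / t. -/
theorem sum_inv_one_add_mul_sq_le {t : ℝ} (ht : 0 < t) (n : ℕ) :
    ∑ i ∈ Finset.range n, 1 / (1 + i * t) ^ 2 ≤ 1 + 1 / t := by
  have key : ∀ n : ℕ, ∑ i ∈ Finset.range (n + 1), 1 / (1 + i * t) ^ 2 ≤
      1 + 1 / t - 1 / (t * (1 + n * t)) := by
    intro n
    induction n with
    | zero => simp
    | succ n ih =>
      rw [Finset.sum_range_succ]
      have h : 1 / (1 + ((n + 1 : ℕ) : ℝ) * t) ^ 2 ≤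
          1 / (t * (1 + n * t)) - 1 / (t * (1 + ((n + 1 : ℕ) : ℝ) * t)) := by
        push_cast
        have h1 : 0 < 1 + (n : ℝ) * t := by positivity
        have h2 : 0 < 1 + ((n : ℝ) + 1) * t := by positivity
        rw [div_sub_div _ _ (by positivity) (by positivity), div_le_div_iff₀ (by positivity)
          (by positivity)]
        have : 0 ≤ t ^ 3 * (1 + ((n : ℝ) + 1) * t) := by positivity
        nlinarith
      linarith
  cases n with
  | zero => simp; positivity
  | succ n =>
    have : 0 ≤ 1 / (t * (1 + n * t)) := by positivity
    linarith [key n]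

theorem sum_range_mul_eq {E : Type*} [AddCommMonoid E] (u : ℕ → E) (N n : ℕ) :
    ∑ k ∈ Finset.range (n * N), u k =
      ∑ i ∈ Finset.range n, ∑ a ∈ Finset.range N, u (i * N + a) := by
  induction n with
  | zero => simp
  | succ n ih => rw [Nat.succ_mul, Finset.sum_range_add, ih, Finset.sum_range_succ]

theorem hasDerivAt_iteratedDeriv_of_analyticAt {h : ℂ → ℂ} {z : ℂ} (hz : AnalyticAt ℂ h z)
    (i : ℕ) : HasDerivAt (iteratedDeriv i h) (iteratedDeriv (i + 1) h z) z := by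
  have : AnalyticAt ℂ (iteratedDeriv i h) z := by
    rw [iteratedDeriv_eq_iterate]
    exact hz.iterated_deriv i
  rw [iteratedDeriv_succ]
  exact this.differentiableAt.hasDerivAt

/-- One period of the Euler–Maclaurin formula. -/
theorem norm_block_sub_le {N : ℕ} (hN : 0 < N) {ψ : ℕ → ℂ}
    (hsum : ∑ a ∈ Finset.range N, ψ a = 0) {h : ℂ → ℂ} {κ : ℝ}
    (hana : ∀ z ∈ cone κ, AnalyticAt ℂ h z) {M : ℕ} {C : ℝ}
    (hC : ∀ z ∈ cone κ, ‖iteratedDeriv M h z‖ ≤ C / (1 + ‖z‖) ^ 2) {y : ℂ} (hy : y ∈ cone κ)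
    (n : ℕ) :
    ‖∑ a ∈ Finset.range N, ψ a * h (((n * N + a : ℕ) : ℂ) * y) +
      ∑ m ∈ Finset.range M, bernoulliWeight N ψ m * y ^ m *
        (iteratedDeriv m h (((n + 1 : ℕ) : ℂ) * (N * y)) - iteratedDeriv m h ((n : ℂ) * (N * y)))‖ ≤
      (∑ a ∈ Finset.range N, ‖ψ a‖) * (2 * ((N * ‖y‖) ^ M * C)) *
        (1 / (1 + n * (N * ‖y‖)) ^ 2) := by
  have hN' : (N : ℂ) ≠ 0 := by exact_mod_cast hN.ne'
  -- The block of N terms becomes the unit interval: `F i` is the i-th derivative of x ↦ h ((n + x)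
  -- N y), and the a-th term sits at x = a / N.
  set F : ℕ → ℝ → ℂ := fun i x =>
    (N * y) ^ i * iteratedDeriv i h (((n : ℂ) + x) * (N * y)) with hFdef
  have hcone : ∀ x ∈ Set.Icc (0 : ℝ) 1, ((n : ℂ) + x) * (N * y) ∈ cone κ := by
    intro x hx
    have := ofReal_mul_mem_cone hy (t := (n + x) * N)
      (mul_nonneg (add_nonneg n.cast_nonneg hx.1) N.cast_nonneg)
    convert! this using 1
    push_cast
    ring
  have hF : ∀ i, ∀ x ∈ Set.Icc (0 : ℝ) 1, HasDerivAt (F i) (F (i + 1) x) x := by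
    intro i x hx
    have h1 := hasDerivAt_iteratedDeriv_of_analyticAt (hana _ (hcone x hx)) i
    have h2 : HasDerivAt (fun x : ℝ => ((n : ℂ) + x) * (N * y)) (N * y) x := by
      have := ((hasDerivAt_id x).ofReal_comp.const_add (n : ℂ)).mul_const (N * y)
      simpa using this
    have h3 := (h1.comp x h2).const_mul ((N * y) ^ i)
    refine h3.congr_deriv ?_
    simp only [hFdef]
    ring
  have hA : ∀ x ∈ Set.Icc (0 : ℝ) 1,
      ‖F M x‖ ≤ (N * ‖y‖) ^ M * C * (1 / (1 + n * (N * ‖y‖)) ^ 2) := by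
    intro x hx
    have hC0 : 0 ≤ C := by
      have h0 := (norm_nonneg _).trans (hC 0 (zero_mem_cone κ))
      simpa using h0
    have h1 := hC _ (hcone x hx)
    have h2 : ‖((n : ℂ) + x) * (N * y)‖ = (n + x) * (N * ‖y‖) := by
      rw [norm_mul, norm_mul, norm_natCast]
      congr 1
      have : ((n : ℂ) + x) = ((n + x : ℝ) : ℂ) := by push_cast; ring
      rw [this, norm_real, Real.norm_of_nonneg (add_nonneg n.cast_nonneg hx.1)]
    rw [h2] at h1
    simp only [hFdef]
    rw [norm_mul, norm_pow, norm_mul, norm_natCast, mul_assoc ((N * ‖y‖) ^ M)]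
    gcongr
    refine h1.trans ?_
    rw [mul_one_div]
    have : 0 ≤ N * ‖y‖ := by positivity
    gcongr
    linarith [hx.1]
  have hx : ∀ a ∈ Finset.range N, ((a : ℝ) / N) ∈ Set.Icc (0 : ℝ) 1 := by
    intro a ha
    have : (a : ℝ) ≤ N := by exact_mod_cast (Finset.mem_range.mp ha).le
    exact ⟨by positivity, by rw [div_le_one (by positivity)]; exact this⟩
  -- The integral in the remainder does not depend on a, so it disappears because ψ has mean zero;
  -- the boundary terms collect into `bernoulliWeight`.
  have hkey : ∑ a ∈ Finset.range N, ψ a * h (((n * N + a : ℕ) : ℂ) * y) +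
      ∑ m ∈ Finset.range M, bernoulliWeight N ψ m * y ^ m *
        (iteratedDeriv m h (((n + 1 : ℕ) : ℂ) * (N * y)) - iteratedDeriv m h ((n : ℂ) * (N * y))) =
      ∑ a ∈ Finset.range N, ψ a * bernoulliRemainder F M (a / N) := by
    have hex : ∀ a : ℕ, ψ a * bernoulliRemainder F M (a / N) =
        ψ a * h (((n * N + a : ℕ) : ℂ) * y) - ψ a * (∫ t in (0 : ℝ)..1, F 0 t) -
        ∑ m ∈ Finset.range M, ψ a * (((bernoulliFun (m + 1) (a / N) / (m + 1).factorial : ℝ) : ℂ) *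
          (F m 1 - F m 0)) := by
      intro a
      rw [bernoulliRemainder, mul_sub, mul_sub, Finset.mul_sum]
      congr 3
      simp only [hFdef, pow_zero, one_mul, iteratedDeriv_zero]
      congr 1
      push_cast
      field_simp
    rw [Finset.sum_congr rfl fun a _ => hex a, Finset.sum_sub_distrib, Finset.sum_sub_distrib,
      ← Finset.sum_mul, hsum, zero_mul, sub_zero, sub_eq_add_neg, Finset.sum_comm,
      ← Finset.sum_neg_distrib]
    congr 1
    refine Finset.sum_congr rfl fun m _ => ?_
    simp only [hFdef, bernoulliWeight, ofReal_one, ofReal_zero, add_zero, mul_pow, Nat.cast_add,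
      Nat.cast_one]
    simp only [neg_mul, Finset.mul_sum, Finset.sum_mul, ← Finset.sum_neg_distrib]
    refine Finset.sum_congr rfl fun a _ => ?_
    ring
  rw [hkey]
  refine (norm_sum_le _ _).trans ?_
  rw [mul_assoc, Finset.sum_mul]
  refine Finset.sum_le_sum fun a ha => ?_
  rw [norm_mul]
  have := norm_bernoulliRemainder_le M hF hA (hx a ha)
  rw [mul_assoc 2]
  gcongr

theorem summable_mul_of_norm_le_inv_sq {N : ℕ} (hN : 0 < N) {ψ : ℕ → ℂ}
    (hper : ∀ k, ψ (k + N) = ψ k) {h : ℂ → ℂ} {κ C : ℝ}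
    (hC : ∀ z ∈ cone κ, ‖h z‖ ≤ C / (1 + ‖z‖) ^ 2) {y : ℂ} (hy : y ∈ cone κ) (hy0 : y ≠ 0) :
    Summable fun k : ℕ => ψ k * h (k * y) := by
  have hψ : ∀ k, ‖ψ k‖ ≤ ∑ a ∈ Finset.range N, ‖ψ a‖ := by
    intro k
    have : ψ k = ψ (k % N) := by
      rw [Function.Periodic.map_mod_nat (show Function.Periodic ψ N from hper)]
    rw [this]
    exact Finset.single_le_sum (f := fun a => ‖ψ a‖) (fun _ _ => norm_nonneg _)
      (Finset.mem_range.mpr (Nat.mod_lt _ hN))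
  have hC0 : 0 ≤ C := by
    have h0 := (norm_nonneg _).trans (hC 0 (zero_mem_cone κ))
    simpa using h0
  have hy1 : 0 < ‖y‖ := norm_pos_iff.mpr hy0
  rw [← summable_nat_add_iff 1]
  have hs : Summable fun k : ℕ =>
      (∑ a ∈ Finset.range N, ‖ψ a‖) * (C / ‖y‖ ^ 2) * (1 / ((k + 1 : ℕ) : ℝ) ^ 2) :=
    ((summable_nat_add_iff 1).mpr (Real.summable_one_div_nat_pow.mpr one_lt_two)).mul_left _
  refine Summable.of_norm_bounded hs fun k => ?_
  rw [norm_mul, mul_assoc]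
  have h2 := hC _ (ofReal_mul_mem_cone hy (Nat.cast_nonneg (k + 1)))
  rw [ofReal_natCast] at h2
  refine mul_le_mul (hψ _) (h2.trans ?_) (norm_nonneg _) (Finset.sum_nonneg fun _ _ => norm_nonneg _)
  rw [div_mul_div_comm, mul_one, norm_mul, norm_natCast, ← mul_pow, mul_comm ‖y‖]
  gcongr
  linarith

/-- The Euler–Maclaurin expansion of `∑ ψ(k) h(ky)` as `y → 0`, for a periodic `ψ` of mean zero. -/
theorem norm_tsum_sub_le {N : ℕ} (hN : 0 < N) {ψ : ℕ → ℂ}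
    (hper : ∀ k, ψ (k + N) = ψ k) (hsum : ∑ a ∈ Finset.range N, ψ a = 0) {h : ℂ → ℂ} {κ : ℝ}
    (hana : ∀ z ∈ cone κ, AnalyticAt ℂ h z)
    (hbd : ∀ m, ∃ C, ∀ z ∈ cone κ, ‖iteratedDeriv m h z‖ ≤ C / (1 + ‖z‖) ^ 2) (M : ℕ) :
    ∃ C, ∀ y ∈ cone κ, y ≠ 0 → ‖y‖ ≤ 1 →
      ‖∑' k : ℕ, ψ k * h (k * y) -
        ∑ m ∈ Finset.range M, bernoulliWeight N ψ m * iteratedDeriv m h 0 * y ^ m‖ ≤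
      C * ‖y‖ ^ M := by
  -- One order more than claimed: summation over the blocks costs a factor 1 / ‖y‖. The extra term
  -- of index M is split off at the end and accounts for the last summand of the constant.
  obtain ⟨C, hC⟩ := hbd (M + 1)
  have hC0 : 0 ≤ C := by
    have h0 := (norm_nonneg _).trans (hC 0 (zero_mem_cone κ))
    simpa using h0
  have hN1 : (0 : ℝ) < N := by exact_mod_cast hN
  set Ψ := ∑ a ∈ Finset.range N, ‖ψ a‖
  have hΨ : 0 ≤ Ψ := Finset.sum_nonneg fun _ _ => norm_nonneg _
  refine ⟨Ψ * (2 * (N ^ M * C)) * (N + 1) + ‖bernoulliWeight N ψ M * iteratedDeriv M h 0‖, ?_⟩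
  intro y hy hy0 hy1
  have hyp : 0 < ‖y‖ := norm_pos_iff.mpr hy0
  have hNy : 0 < N * ‖y‖ := mul_pos hN1 hyp
  set w : ℕ → ℂ := fun m => bernoulliWeight N ψ m * y ^ m
  -- Over n complete periods the boundary terms telescope; the bound is uniform in n.
  have hpart : ∀ n : ℕ, ‖∑ k ∈ Finset.range (n * N), ψ k * h (k * y) +
      ∑ m ∈ Finset.range (M + 1), w m *
        (iteratedDeriv m h ((n : ℂ) * (N * y)) - iteratedDeriv m h 0)‖ ≤
      Ψ * (2 * (N ^ M * C)) * (N + 1) * ‖y‖ ^ M := by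
    intro n
    have h1 : ∑ k ∈ Finset.range (n * N), ψ k * h (k * y) +
      ∑ m ∈ Finset.range (M + 1), w m *
        (iteratedDeriv m h ((n : ℂ) * (N * y)) - iteratedDeriv m h 0) =
      ∑ i ∈ Finset.range n, (∑ a ∈ Finset.range N, ψ a * h (((i * N + a : ℕ) : ℂ) * y) +
        ∑ m ∈ Finset.range (M + 1), w m *
        (iteratedDeriv m h (((i + 1 : ℕ) : ℂ) * (N * y)) -
          iteratedDeriv m h ((i : ℂ) * (N * y)))) := by
      rw [Finset.sum_add_distrib, sum_range_mul_eq]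
      congr 1
      · refine Finset.sum_congr rfl fun i _ => Finset.sum_congr rfl fun a _ => ?_
        congr 1
        rw [add_comm]
        exact (show Function.Periodic ψ N from hper).nat_mul i a
      · rw [Finset.sum_comm]
        refine Finset.sum_congr rfl fun m _ => ?_
        rw [← Finset.mul_sum]
        congr 1
        have := Finset.sum_range_sub (fun i : ℕ => iteratedDeriv m h ((i : ℂ) * (N * y))) n
        simp only [Nat.cast_zero, zero_mul] at this
        exact this.symm
    rw [h1]
    refine (norm_sum_le _ _).trans ((Finset.sum_le_sum fun i _ =>
      norm_block_sub_le hN hsum hana hC hy i).trans ?_)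
    rw [← Finset.mul_sum]
    calc _ ≤ Ψ * (2 * ((N * ‖y‖) ^ (M + 1) * C)) * (1 + 1 / (N * ‖y‖)) := by
          gcongr
          exact sum_inv_one_add_mul_sq_le hNy n
      _ = Ψ * (2 * (N ^ M * C)) * (N * ‖y‖ + 1) * ‖y‖ ^ M := by
          rw [pow_succ, mul_pow]
          field_simp
      _ ≤ _ := by
          gcongr
          nlinarith
  -- All derivatives of h vanish at infinity in the cone, so only the boundary terms at 0 survive.
  have hlim : Tendsto (fun n : ℕ => ∑ k ∈ Finset.range (n * N), ψ k * h (k * y) +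
      ∑ m ∈ Finset.range (M + 1), w m *
        (iteratedDeriv m h ((n : ℂ) * (N * y)) - iteratedDeriv m h 0)) atTop
      (𝓝 (∑' k : ℕ, ψ k * h (k * y) +
        ∑ m ∈ Finset.range (M + 1), w m * (0 - iteratedDeriv m h 0))) := by
    refine Tendsto.add ?_ (tendsto_finsetSum _ fun m _ => ?_)
    · obtain ⟨C', hC'⟩ := hbd 0
      have hs := summable_mul_of_norm_le_inv_sq hN hper (h := h) (by simpa using hC') hy hy0
      exact hs.hasSum.tendsto_sum_nat.comp (tendsto_id.atTop_mul_const' hN)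
    · refine (Tendsto.sub_const ?_ _).const_mul _
      obtain ⟨C', hC'⟩ := hbd m
      have hmem : ∀ n : ℕ, (n : ℂ) * (N * y) ∈ cone κ := by
        intro n
        have := ofReal_mul_mem_cone hy (t := n * N) (by positivity)
        convert! this using 1
        push_cast
        ring
      refine squeeze_zero_norm (fun n => hC' _ (hmem n)) ?_
      refine tendsto_const_nhds.div_atTop ?_
      refine (tendsto_pow_atTop two_ne_zero).comp (tendsto_atTop_add_const_left _ _ ?_)
      simp only [norm_mul, Complex.norm_natCast]
      exact tendsto_natCast_atTop_atTop.atTop_mul_const hNy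
  have hfin := le_of_tendsto hlim.norm (Eventually.of_forall hpart)
  have heq : ∑' k : ℕ, ψ k * h (k * y) -
        ∑ m ∈ Finset.range M, bernoulliWeight N ψ m * iteratedDeriv m h 0 * y ^ m =
      (∑' k : ℕ, ψ k * h (k * y) +
        ∑ m ∈ Finset.range (M + 1), w m * (0 - iteratedDeriv m h 0)) +
      bernoulliWeight N ψ M * iteratedDeriv M h 0 * y ^ M := by
    rw [Finset.sum_range_succ]
    simp only [w, zero_sub, mul_neg, Finset.sum_neg_distrib]
    have : ∀ m, bernoulliWeight N ψ m * y ^ m * iteratedDeriv m h 0 =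
      bernoulliWeight N ψ m * iteratedDeriv m h 0 * y ^ m := fun m => by ring
    simp only [this]
    ring
  rw [heq, add_mul]
  refine (norm_add_le _ _).trans (add_le_add hfin ?_)
  rw [norm_mul, norm_pow]

end ModularResurgence

namespace ModularResurgence

/-! ### The regular part of the cotangent -/

theorem analyticAt_and_iteratedDeriv_of_hasSum {F : ℂ → ℂ} {c : ℕ → ℂ}
    (h : ∀ᶠ x in 𝓝 (0 : ℂ), HasSum (fun m : ℕ => c m * x ^ m) (F x)) :
    AnalyticAt ℂ F 0 ∧ ∀ m, iteratedDeriv m F 0 = m.factorial * c m := by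
  have hp : HasFPowerSeriesAt F (FormalMultilinearSeries.ofScalars ℂ c) 0 := by
    rw [hasFPowerSeriesAt_iff]
    filter_upwards [h] with x hx
    simpa [FormalMultilinearSeries.coeff_ofScalars, mul_comm] using hx
  refine ⟨hp.analyticAt, fun m => ?_⟩
  have h2 := hp.eq_formalMultilinearSeries hp.analyticAt.hasFPowerSeriesAt
  have h3 := congrArg (fun p => p.coeff m) h2
  simp only [FormalMultilinearSeries.coeff_ofScalars] at h3
  rw [h3]
  have : (m.factorial : ℂ) ≠ 0 := by exact_mod_cast m.factorial_ne_zero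
  field_simp

/-- `π cot (π x) - 1 / x`, with its regular value `0` at `x = 0`. -/
def cotReg (x : ℂ) : ℂ := Real.pi * cot (Real.pi * x) - 1 / x

/-- The Taylor coefficients of `cotReg` at `0`. -/
def cotCoeff (m : ℕ) : ℂ := ((-1) ^ m - 1) * riemannZeta (m + 1)

theorem cotCoeff_of_even {m : ℕ} (hm : Even m) : cotCoeff m = 0 := by
  simp [cotCoeff, hm.neg_one_pow]

theorem hasSum_cotCoeff_term (m : ℕ) :
    HasSum (fun n : ℕ => ((-1 : ℂ) ^ m - 1) / ((n : ℂ) + 1) ^ (m + 1)) (cotCoeff m) := by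
  rcases Nat.eq_zero_or_pos m with rfl | hm
  -- For m = 0 the sign factor is zero, so the value assigned to ζ at its pole plays no role.
  · simp [cotCoeff]
  · have h1 : 1 < ((m : ℂ) + 1).re := by
      simp only [add_re, natCast_re, one_re]
      have : (0 : ℝ) < m := by exact_mod_cast hm
      linarith
    have hs : Summable fun n : ℕ => 1 / ((n : ℂ) + 1) ^ (m + 1) := by
      rw [← summable_norm_iff]
      have := (summable_nat_add_iff 1).mpr
        (Real.summable_one_div_nat_pow (p := m + 1) |>.mpr (by omega))
      refine this.congr fun n => ?_
      rw [norm_div, norm_pow, norm_one, ← Nat.cast_add_one, Complex.norm_natCast]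
    have h2 := zeta_eq_tsum_one_div_nat_add_one_cpow h1
    have h3 : ∀ n : ℕ, ((n : ℂ) + 1) ^ ((m : ℂ) + 1) = ((n : ℂ) + 1) ^ (m + 1) := by
      intro n
      rw [← Nat.cast_add_one m, cpow_natCast]
    simp only [h3] at h2
    have := hs.hasSum.mul_left ((-1 : ℂ) ^ m - 1)
    rw [← h2] at this
    simpa [cotCoeff, div_eq_mul_inv] using this

theorem hasSum_one_div_sub_add {x k : ℂ} (h : ‖x‖ < ‖k‖) :
    HasSum (fun m : ℕ => ((-1 : ℂ) ^ m - 1) / k ^ (m + 1) * x ^ m)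
      (1 / (x - k) + 1 / (x + k)) := by
  have hk : k ≠ 0 := norm_pos_iff.mp ((norm_nonneg x).trans_lt h)
  have hr : ‖x / k‖ < 1 := by
    rw [norm_div, div_lt_one (norm_pos_iff.mpr hk)]
    exact h
  have h1 := (hasSum_geometric_of_norm_lt_one hr).mul_left (-1 / k)
  have h2 := (hasSum_geometric_of_norm_lt_one (ξ := -(x / k)) (by rwa [norm_neg])).mul_left (1 / k)
  have hne1 : x - k ≠ 0 := by
    intro h0
    rw [sub_eq_zero.mp h0] at h
    exact lt_irrefl _ h
  have hne2 : x + k ≠ 0 := by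
    intro h0
    rw [eq_neg_of_add_eq_zero_left h0, norm_neg] at h
    exact lt_irrefl _ h
  have hne1' : k - x ≠ 0 := by rwa [← neg_ne_zero, neg_sub]
  have hne2' : k + x ≠ 0 := by rwa [add_comm]
  have h3 := h1.add h2
  have e1 : -1 / k * (1 - x / k)⁻¹ + 1 / k * (1 - -(x / k))⁻¹ = 1 / (x - k) + 1 / (x + k) := by
    rw [sub_neg_eq_add, one_sub_div hk, one_add_div hk, inv_div, inv_div, ← neg_sub k x,
      add_comm x k]
    field_simp
  rw [e1] at h3
  convert! h3 using 2 with m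
  rw [neg_pow (x / k), div_pow, pow_succ]
  field_simp
  ring

/-- Fubini for an absolutely convergent double series. It turns a sum of simple fractions into a
power series, once for the cotangent and once for the Borel transforms. -/
theorem hasSum_tsum_of_summable_prod {ι κ : Type*} {u : ι → κ → ℂ}
    (hu : Summable fun p : ι × κ => u p.1 p.2) {a : ι → ℂ} {b : κ → ℂ} (ha : ∀ m, HasSum (u m) (a m)) (hb : ∀ n, HasSum (fun m => u m n) (b n)) :
    HasSum a (∑' n, b n) := by
  have h2 : HasSum b (∑' p : ι × κ, u p.1 p.2) :=
    HasSum.prod_fiberwise (f := fun p : κ × ι => u p.2 p.1)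
      ((Equiv.prodComm κ ι).hasSum_iff.mpr hu.hasSum) hb
  rw [h2.tsum_eq]
  exact hu.hasSum.prod_fiberwise ha

/-- Each pair of fractions in the Mittag-Leffler expansion of the cotangent is a difference of
geometric series; interchanging the sums collects the zeta values. -/
theorem hasSum_cotReg {x : ℂ} (hx : ‖x‖ < 1) :
    HasSum (fun m : ℕ => cotCoeff m * x ^ m) (cotReg x) := by
  have hlt : ∀ n : ℕ, ‖x‖ < ‖((n : ℂ) + 1)‖ := by
    intro n
    have : ‖((n : ℂ) + 1)‖ = n + 1 := by
      rw [← Nat.cast_add_one, Complex.norm_natCast]; push_cast; rfl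
    rw [this]
    have : (0 : ℝ) ≤ n := n.cast_nonneg
    linarith
  have hu : Summable fun p : ℕ × ℕ =>
      ((-1 : ℂ) ^ p.1 - 1) / ((p.2 : ℂ) + 1) ^ (p.1 + 1) * x ^ p.1 := by
    have hs : Summable fun p : ℕ × ℕ => ‖x‖ ^ p.1 * (2 * (1 / ((p.2 : ℝ) + 1) ^ 2)) := by
      have h2 := (summable_nat_add_iff 1).mpr (Real.summable_one_div_nat_pow.mpr one_lt_two)
      push_cast at h2
      exact (summable_geometric_of_lt_one (norm_nonneg x) hx).mul_of_nonneg
        (h2.mul_left 2) (fun _ => by positivity) (fun _ => by positivity)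
    refine Summable.of_norm_bounded hs fun p => ?_
    obtain ⟨m, n⟩ := p
    have hn1 : ‖((n : ℂ) + 1)‖ = n + 1 := by
      rw [← Nat.cast_add_one, Complex.norm_natCast]; push_cast; rfl
    simp only [norm_mul, norm_div, norm_pow, hn1]
    rw [mul_comm]
    gcongr
    rcases Nat.eq_zero_or_pos m with rfl | hm
    · simp; positivity
    · rw [mul_one_div]
      have h1 : ‖(-1 : ℂ) ^ m - 1‖ ≤ 2 := by
        refine (norm_sub_le _ _).trans ?_
        norm_num
      gcongr
      · linarith [(n.cast_nonneg : (0 : ℝ) ≤ n)]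
      · omega
  have h1 := hasSum_tsum_of_summable_prod
    (u := fun (m n : ℕ) => ((-1 : ℂ) ^ m - 1) / ((n : ℂ) + 1) ^ (m + 1) * x ^ m) hu
    (fun m => (hasSum_cotCoeff_term m).mul_right (x ^ m))
    (fun n => hasSum_one_div_sub_add (hlt n))
  rcases eq_or_ne x 0 with rfl | hx0
  · have h2 : ∀ n : ℕ, 1 / (0 - ((n : ℂ) + 1)) + 1 / (0 + ((n : ℂ) + 1)) = 0 := fun n => by
      rw [zero_sub, zero_add, div_neg, neg_add_cancel]
    simp only [h2, tsum_zero] at h1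
    convert! h1 using 1
    simp [cotReg, Complex.cot]
  · have hxc : x ∈ integerComplement := by
      rintro ⟨n, rfl⟩
      have : n ≠ 0 := by rintro rfl; simp at hx0
      have h4 : (1 : ℝ) ≤ |(n : ℝ)| := by exact_mod_cast Int.one_le_abs this
      rw [norm_intCast] at hx
      linarith
    rw [cotReg, cot_series_rep' hxc]
    exact h1

theorem analyticAt_cotReg_zero : AnalyticAt ℂ cotReg 0 ∧
    ∀ m, iteratedDeriv m cotReg 0 = m.factorial * cotCoeff m := by
  apply analyticAt_and_iteratedDeriv_of_hasSum
  filter_upwards [Metric.ball_mem_nhds (0 : ℂ) one_pos] with x hx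
  exact hasSum_cotReg (by simpa using hx)

/-! ### Exponential forms in the upper half-plane and decay in cones. -/

theorem norm_exp_two_pi_I_mul (z : ℂ) :
    ‖exp (2 * Real.pi * I * z)‖ = Real.exp (-(2 * Real.pi * z.im)) := by
  rw [norm_exp]
  congr 1
  simp

theorem norm_exp_two_pi_I_mul_lt_one {z : ℂ} (hz : 0 < z.im) :
    ‖exp (2 * Real.pi * I * z)‖ < 1 := by
  rw [norm_exp_two_pi_I_mul, Real.exp_lt_one_iff]
  have := Real.pi_pos
  simp only [Left.neg_neg_iff]
  positivity

theorem exp_two_pi_I_mul_ne_one {z : ℂ} (hz : 0 < z.im) : exp (2 * Real.pi * I * z) ≠ 1 := by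
  intro h
  have := norm_exp_two_pi_I_mul_lt_one hz
  rw [h, norm_one] at this
  exact lt_irrefl _ this

theorem cotReg_eq {z : ℂ} (hz : 0 < z.im) : cotReg z =
    2 * Real.pi * I * (exp (2 * Real.pi * I * z) / (exp (2 * Real.pi * I * z) - 1)) -
      Real.pi * I - 1 / z := by
  have h := sub_ne_zero.mpr (exp_two_pi_I_mul_ne_one hz)
  have h' : 1 - exp (2 * Real.pi * I * z) ≠ 0 := by rwa [← neg_ne_zero, neg_sub]
  rw [cotReg, cot_pi_eq_exp_ratio]
  congr 1
  rw [← neg_sub 1 (exp _), div_neg]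
  generalize exp (2 * Real.pi * I * z) = E at *
  have hI := I_ne_zero
  field_simp
  linear_combination (1 + E) * I_sq

theorem hasDerivAt_cotReg {z : ℂ} (hz : 0 < z.im) : HasDerivAt cotReg
    (4 * Real.pi ^ 2 * (exp (2 * Real.pi * I * z) / (exp (2 * Real.pi * I * z) - 1) ^ 2) +
      1 / z ^ 2) z := by
  have hE := sub_ne_zero.mpr (exp_two_pi_I_mul_ne_one hz)
  have hz0 : z ≠ 0 := by
    rintro rfl
    simp at hz
  have h1 : HasDerivAt (fun z : ℂ => exp (2 * Real.pi * I * z))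
      (exp (2 * Real.pi * I * z) * (2 * Real.pi * I)) z := by
    have := (hasDerivAt_const_mul (2 * Real.pi * I : ℂ) (x := z)).cexp
    exact this
  have h2 := ((((h1.fun_div (h1.sub_const 1) hE).const_mul (2 * Real.pi * I : ℂ)).sub_const
    (Real.pi * I : ℂ)).fun_sub ((hasDerivAt_inv hz0)))
  refine (h2.congr_deriv ?_).congr_of_eventuallyEq ?_
  · generalize exp (2 * Real.pi * I * z) = E at *
    field_simp
    linear_combination (-4 * E * Real.pi ^ 2 * z ^ 2 : ℂ) * I_sq
  · have : ∀ᶠ w : ℂ in 𝓝 z, 0 < w.im := continuous_im.continuousAt.eventually (lt_mem_nhds hz)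
    filter_upwards [this] with w hw
    rw [cotReg_eq hw, one_div]

/-- An analytic function on the closed cones with quadratic decay has derivatives with quadratic
decay. -/
theorem exists_norm_iteratedDeriv_le {h : ℂ → ℂ} (h0 : AnalyticAt ℂ h 0)
    (hana : ∀ z : ℂ, 0 < z.im → AnalyticAt ℂ h z)
    (hbd : ∀ κ > 0, ∃ A, ∀ z ∈ cone κ, 1 / 2 ≤ ‖z‖ → ‖h z‖ ≤ A / ‖z‖ ^ 2) {κ : ℝ} (hκ : 0 < κ)
    (m : ℕ) : ∃ C, ∀ z ∈ cone κ, ‖iteratedDeriv m h z‖ ≤ C / (1 + ‖z‖) ^ 2 := by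
  have han : ∀ z ∈ cone κ, AnalyticAt ℂ h z := by
    intro z hz
    rcases eq_or_ne z 0 with rfl | hz0
    · exact h0
    · exact hana z (im_pos_of_mem_cone hκ hz hz0)
  have hcl : IsClosed (cone κ) := isClosed_le (by fun_prop) continuous_im
  have hcomp : IsCompact (cone κ ∩ Metric.closedBall 0 1) :=
    (isCompact_closedBall 0 1).inter_left hcl
  obtain ⟨B, hB⟩ := hcomp.exists_bound_of_continuousOn (f := iteratedDeriv m h) fun z hz =>
    (hasDerivAt_iteratedDeriv_of_analyticAt (han z hz.1) m).continuousAt.continuousWithinAt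
  -- Cauchy's estimate is applied on circles of radius κ / 4. For z in the cone with ‖z‖ > 1 the
  -- closed disc stays in the wider cone of aperture κ / 2 and satisfies ‖w‖ ≥ (3/4) ‖z‖, whence
  -- 16/9; the 4 is a bound for (1 + ‖z‖)² / ‖z‖². For ‖z‖ ≤ 1 compactness gives B.
  obtain ⟨A, hA⟩ := hbd (κ / 2) (by positivity)
  have hB0 : 0 ≤ B := (norm_nonneg _).trans (hB 0 ⟨zero_mem_cone κ, by simp⟩)
  refine ⟨max (4 * B) (m.factorial * (A * (16 / 9)) / (κ / 4) ^ m * 4), fun z hz => ?_⟩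
  rcases le_or_gt ‖z‖ 1 with hz1 | hz1
  · refine (hB z ⟨hz, by simpa using hz1⟩).trans ?_
    rw [le_div_iff₀ (by positivity)]
    refine le_trans ?_ (le_max_left _ _)
    nlinarith [norm_nonneg z, mul_nonneg hB0 (norm_nonneg z),
      mul_nonneg hB0 (mul_nonneg (norm_nonneg z) (norm_nonneg z)),
      mul_nonneg hB0 (sub_nonneg.mpr hz1), mul_le_mul_of_nonneg_left
        (show (1 + ‖z‖) ^ 2 ≤ 4 by nlinarith [norm_nonneg z]) hB0]
  · have hz0 : 0 < ‖z‖ := by linarith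
    have hκ1 : κ ≤ 1 := by
      have h1 : κ * ‖z‖ ≤ ‖z‖ := (mem_cone.mp hz).trans ((le_abs_self _).trans (abs_im_le_norm z))
      nlinarith
    have hball : ∀ w ∈ Metric.closedBall z (κ / 4), w ∈ cone (κ / 2) ∧ 3 / 4 * ‖z‖ ≤ ‖w‖ := by
      intro w hw
      rw [Metric.mem_closedBall, dist_eq_norm] at hw
      have h1 : ‖w‖ ≤ ‖z‖ + κ / 4 := by
        have := norm_add_le z (w - z)
        rw [add_sub_cancel] at this
        linarith
      have h2 : ‖z‖ - κ / 4 ≤ ‖w‖ := by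
        have := norm_sub_norm_le z w
        rw [norm_sub_rev] at this
        linarith
      have h3 : z.im - κ / 4 ≤ w.im := by
        have := (abs_le.mp ((abs_im_le_norm (w - z)).trans hw)).1
        rw [sub_im] at this
        linarith
      refine ⟨?_, by nlinarith⟩
      rw [mem_cone] at hz ⊢
      nlinarith [mul_le_mul_of_nonneg_left h1 hκ.le]
    have hbound : ∀ w ∈ Metric.sphere z (κ / 4), ‖h w‖ ≤ A * (16 / 9) / ‖z‖ ^ 2 := by
      intro w hw
      obtain ⟨hw1, hw2⟩ := hball w (Metric.sphere_subset_closedBall hw)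
      have h1 := hA w hw1 (by linarith)
      have hw0 : 0 < ‖w‖ := by linarith
      have hA0 : 0 ≤ A := by
        have := (norm_nonneg _).trans h1
        rwa [le_div_iff₀ (by positivity), zero_mul] at this
      refine h1.trans ?_
      rw [div_le_div_iff₀ (by positivity) (by positivity), mul_assoc]
      gcongr
      nlinarith
    have hdiff : DiffContOnCl ℂ h (Metric.ball z (κ / 4)) := by
      apply DifferentiableOn.diffContOnCl
      rw [closure_ball _ (by positivity)]
      intro w hw
      obtain ⟨hw1, hw2⟩ := hball w hw
      have hw0 : w ≠ 0 := norm_pos_iff.mp (by linarith)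
      exact (hana w (im_pos_of_mem_cone (by positivity) hw1 hw0)).differentiableAt.differentiableWithinAt
    have := norm_iteratedDeriv_le_of_forall_mem_sphere_norm_le m (by positivity) hdiff hbound
    refine this.trans ?_
    have hA0 : 0 ≤ A * (16 / 9) / ‖z‖ ^ 2 := by
      refine (norm_nonneg _).trans (hbound (z + (κ / 4 : ℝ)) ?_)
      rw [mem_sphere_iff_norm, add_sub_cancel_left, norm_real, Real.norm_of_nonneg (by positivity)]
    have hA1 : 0 ≤ A * (16 / 9) := by rwa [le_div_iff₀ (by positivity), zero_mul] at hA0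
    rw [le_div_iff₀ (by positivity)]
    refine le_trans ?_ (le_max_right _ _)
    calc m.factorial * (A * (16 / 9) / ‖z‖ ^ 2) / (κ / 4) ^ m * (1 + ‖z‖) ^ 2
        = m.factorial * (A * (16 / 9)) / (κ / 4) ^ m * ((1 + ‖z‖) ^ 2 / ‖z‖ ^ 2) := by ring
      _ ≤ _ := by
        gcongr
        rw [div_le_iff₀ (by positivity)]
        nlinarith

/-- The cube suffices: one power is spent on the factor x of `bernoulliGen`, and two remain for
quadratic decay. -/
theorem exp_neg_le_inv_cube {t : ℝ} (ht : 0 < t) : Real.exp (-t) ≤ 6 / t ^ 3 := by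
  have := Real.pow_div_factorial_le_exp t ht.le 3
  norm_num [Nat.factorial] at this
  rw [Real.exp_neg, ← one_div, div_le_div_iff₀ (Real.exp_pos _) (by positivity)]
  linarith

theorem norm_exp_two_pi_I_mul_le {κ : ℝ} (hκ : 0 < κ) {z : ℂ} (hz : z ∈ cone κ)
    (hz1 : 1 / 2 ≤ ‖z‖) : ‖exp (2 * Real.pi * I * z)‖ ≤ 6 / (κ * ‖z‖) ^ 3 ∧
      1 - Real.exp (-κ) ≤ ‖exp (2 * Real.pi * I * z) - 1‖ := by
  have hpi := Real.pi_gt_three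
  rw [mem_cone] at hz
  have hz0 : 0 < κ * ‖z‖ := by positivity
  rw [norm_exp_two_pi_I_mul]
  constructor
  · refine le_trans ?_ (exp_neg_le_inv_cube hz0)
    apply Real.exp_le_exp.mpr
    nlinarith
  · have h1 := norm_sub_norm_le (1 : ℂ) (exp (2 * Real.pi * I * z))
    rw [norm_one, norm_sub_rev, norm_exp_two_pi_I_mul] at h1
    refine le_trans ?_ h1
    gcongr
    nlinarith

/-- The function `-2πi x / (e^(-2πi x) - 1)`, for which `y 𝔤'(y) = ∑ χ(k) H(k y)`. -/
def bernoulliGen (x : ℂ) : ℂ := 1 + Real.pi * I * x + x * cotReg x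

theorem bernoulliGen_eq {z : ℂ} (hz : 0 < z.im) : bernoulliGen z =
    2 * Real.pi * I * z * (exp (2 * Real.pi * I * z) / (exp (2 * Real.pi * I * z) - 1)) := by
  have hz0 : z ≠ 0 := by
    rintro rfl
    simp at hz
  rw [bernoulliGen, cotReg_eq hz]
  field_simp
  ring

theorem analyticAt_bernoulliGen_zero : AnalyticAt ℂ bernoulliGen 0 ∧
    iteratedDeriv 0 bernoulliGen 0 = 1 ∧
    ∀ m, iteratedDeriv (m + 1) bernoulliGen 0 = (m + 1).factorial *
      (cotCoeff m + if m = 0 then Real.pi * I else 0) := by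
  have := analyticAt_and_iteratedDeriv_of_hasSum (F := bernoulliGen)
    (c := fun m => Nat.casesOn m 1 fun m => cotCoeff m + if m = 0 then Real.pi * I else 0) ?_
  · exact ⟨this.1, by simpa using this.2 0, fun m => this.2 (m + 1)⟩
  · filter_upwards [Metric.ball_mem_nhds (0 : ℂ) one_pos] with x hx
    rw [← hasSum_nat_add_iff' 1]
    have h1 := (hasSum_cotReg (x := x) (by simpa using hx)).mul_left x
    have h2 := (hasSum_ite_eq 0 (Real.pi * I : ℂ)).mul_left x
    convert! h1.add h2 using 1
    · ext m
      rcases m with - | m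
      · simp; ring
      · simp; ring
    · simp [bernoulliGen]
      ring

theorem analyticAt_cotReg {z : ℂ} (hz : 0 < z.im) : AnalyticAt ℂ cotReg z := by
  have ho : IsOpen {w : ℂ | 0 < w.im} := isOpen_lt continuous_const continuous_im
  have hd : DifferentiableOn ℂ cotReg {w : ℂ | 0 < w.im} := fun w hw =>
    (hasDerivAt_cotReg hw).differentiableAt.differentiableWithinAt
  exact hd.analyticAt (ho.mem_nhds hz)

theorem analyticAt_bernoulliGen {z : ℂ} (hz : 0 < z.im) : AnalyticAt ℂ bernoulliGen z := by
  have := analyticAt_cotReg hz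
  unfold bernoulliGen
  fun_prop

theorem exists_norm_iteratedDeriv_bernoulliGen_le {κ : ℝ} (hκ : 0 < κ) (m : ℕ) :
    ∃ C, ∀ z ∈ cone κ, ‖iteratedDeriv m bernoulliGen z‖ ≤ C / (1 + ‖z‖) ^ 2 := by
  refine exists_norm_iteratedDeriv_le analyticAt_bernoulliGen_zero.1
    (fun z hz => analyticAt_bernoulliGen hz) (fun κ hκ => ?_) hκ m
  refine ⟨2 * Real.pi * (6 / κ ^ 3) / (1 - Real.exp (-κ)), fun z hz hz1 => ?_⟩
  have hz0 : z ≠ 0 := norm_pos_iff.mp (by linarith)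
  have hzp : 0 < ‖z‖ := by linarith
  obtain ⟨h1, h2⟩ := norm_exp_two_pi_I_mul_le hκ hz hz1
  have h3 : 0 < 1 - Real.exp (-κ) := by
    rw [sub_pos, Real.exp_lt_one_iff]
    linarith
  rw [bernoulliGen_eq (im_pos_of_mem_cone hκ hz hz0)]
  have hpi := Real.pi_pos
  simp only [norm_mul, norm_div, norm_I, norm_real, Real.norm_of_nonneg hpi.le, norm_ofNat]
  calc 2 * Real.pi * 1 * ‖z‖ * (‖exp (2 * Real.pi * I * z)‖ / ‖exp (2 * Real.pi * I * z) - 1‖)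
      ≤ 2 * Real.pi * 1 * ‖z‖ * ((6 / (κ * ‖z‖) ^ 3) / (1 - Real.exp (-κ))) := by gcongr
    _ = _ := by
      field_simp

theorem analyticAt_deriv_cotReg_zero : AnalyticAt ℂ (deriv cotReg) 0 ∧
    ∀ m, iteratedDeriv m (deriv cotReg) 0 = (m + 1).factorial * cotCoeff (m + 1) := by
  refine ⟨analyticAt_cotReg_zero.1.deriv, fun m => ?_⟩
  rw [← iteratedDeriv_succ', analyticAt_cotReg_zero.2]

/-- `cotReg` itself tends to -πi at infinity in the cone, so only its derivative is summable against
a character. The derivative decays exactly quadratically because of its term 1 / z², which gives the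
+ 1 in the constant. -/
theorem exists_norm_iteratedDeriv_deriv_cotReg_le {κ : ℝ} (hκ : 0 < κ) (m : ℕ) :
    ∃ C, ∀ z ∈ cone κ, ‖iteratedDeriv m (deriv cotReg) z‖ ≤ C / (1 + ‖z‖) ^ 2 := by
  refine exists_norm_iteratedDeriv_le analyticAt_deriv_cotReg_zero.1
    (fun z hz => (analyticAt_cotReg hz).deriv) (fun κ hκ => ?_) hκ m
  refine ⟨4 * Real.pi ^ 2 * (6 / κ ^ 3 * 2) / (1 - Real.exp (-κ)) ^ 2 + 1, fun z hz hz1 => ?_⟩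
  have hz0 : z ≠ 0 := norm_pos_iff.mp (by linarith)
  have hzp : 0 < ‖z‖ := by linarith
  obtain ⟨h1, h2⟩ := norm_exp_two_pi_I_mul_le hκ hz hz1
  have h3 : 0 < 1 - Real.exp (-κ) := by
    rw [sub_pos, Real.exp_lt_one_iff]
    linarith
  rw [(hasDerivAt_cotReg (im_pos_of_mem_cone hκ hz hz0)).deriv, add_div]
  refine (norm_add_le _ _).trans (add_le_add ?_ (by simp))
  have hpi := Real.pi_pos
  simp only [norm_mul, norm_div, norm_pow, norm_real, Real.norm_of_nonneg hpi.le, norm_ofNat]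
  calc 4 * Real.pi ^ 2 * (‖exp (2 * Real.pi * I * z)‖ / ‖exp (2 * Real.pi * I * z) - 1‖ ^ 2)
      ≤ 4 * Real.pi ^ 2 * ((6 / (κ * ‖z‖) ^ 3) / (1 - Real.exp (-κ)) ^ 2) := by gcongr
    _ = 4 * Real.pi ^ 2 * (6 / κ ^ 3 * (1 / ‖z‖)) / (1 - Real.exp (-κ)) ^ 2 / ‖z‖ ^ 2 := by
      field_simp
    _ ≤ _ := by
      gcongr
      rw [div_le_iff₀ hzp]
      linarith

end ModularResurgence

namespace ModularResurgence

/-! ### Integration of asymptotic expansions -/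

theorem sector_subset_cone {δ : ℝ} (h0 : 0 < δ) (h1 : δ ≤ Real.pi / 2) :
    sector δ ⊆ cone (Real.sin δ) := by
  rintro z ⟨-, h2, h3⟩
  rw [mem_cone, ← norm_mul_sin_arg, mul_comm]
  gcongr
  rcases le_or_gt (arg z) (Real.pi / 2) with h | h
  · exact Real.sin_le_sin_of_le_of_le_pi_div_two (by linarith) h h2
  · rw [← Real.sin_pi_sub (arg z)]
    exact Real.sin_le_sin_of_le_of_le_pi_div_two (by linarith) (by linarith) (by linarith)

theorem sector_eq_empty {δ : ℝ} (h1 : Real.pi / 2 < δ) : sector δ = ∅ := by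
  ext z
  simp only [sector, Set.mem_ofPred_eq, Set.mem_empty_iff_false, iff_false]
  rintro ⟨-, h2, h3⟩
  linarith

theorem hasDerivAt_truncation (p ℓ c : ℂ) (a : ℕ → ℂ) (M : ℕ) {y : ℂ} (hy : 0 < y.im) :
    HasDerivAt (FormalExpansion.truncation ⟨p, ℓ, c, a⟩ M)
      (-p / y ^ 2 + ℓ / y + ∑ n ∈ Finset.range M, ((n : ℂ) + 1) * a n * y ^ n) y := by
  have hy0 : y ≠ 0 := by
    rintro rfl
    simp at hy
  have hpi : (Real.pi : ℂ) ≠ 0 := by exact_mod_cast Real.pi_ne_zero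
  have h1 : HasDerivAt (fun y : ℂ => p / y) (-p / y ^ 2) y := by
    have := (hasDerivAt_inv hy0).const_mul p
    refine this.congr_deriv ?_
    ring
  have h2 : HasDerivAt (fun y : ℂ => ℓ * log (-2 * Real.pi * I * y)) (ℓ / y) y := by
    have hs : -2 * Real.pi * I * y ∈ slitPlane := by
      left
      simp
      positivity
    have := ((hasDerivAt_const_mul (-2 * Real.pi * I : ℂ) (x := y)).clog hs).const_mul ℓ
    refine this.congr_deriv ?_
    field_simp
  have h3 : HasDerivAt (fun y : ℂ => ∑ n ∈ Finset.range M, a n * y ^ (n + 1))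
      (∑ n ∈ Finset.range M, ((n : ℂ) + 1) * a n * y ^ n) y := by
    refine HasDerivAt.fun_sum fun n _ => ?_
    refine ((hasDerivAt_pow (n + 1) y).const_mul (a n)).congr_deriv ?_
    push_cast
    ring
  exact ((h1.add h2).add_const c).add h3

/-- Mean value inequality on the convex set cut from the cone by the disc of radius ‖y‖, whose
points z satisfy ‖y - z‖ ≤ 2 ‖y‖. -/
theorem norm_sub_le_of_hasDerivAt {r r' : ℂ → ℂ} (hr : ∀ y : ℂ, 0 < y.im → HasDerivAt r (r' y) y)
    {κ C : ℝ} (hκ : 0 < κ) {M : ℕ}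
    (hC : ∀ y ∈ cone κ, y ≠ 0 → ‖y‖ ≤ 1 → ‖r' y‖ ≤ C * ‖y‖ ^ M) {y z : ℂ} (hy : y ∈ cone κ)
    (hz : z ∈ cone κ) (hz0 : z ≠ 0) (hzy : ‖z‖ ≤ ‖y‖) (hy1 : ‖y‖ ≤ 1) :
    ‖r y - r z‖ ≤ 2 * C * ‖y‖ ^ (M + 1) := by
  have hy0 : y ≠ 0 := norm_pos_iff.mp ((norm_pos_iff.mpr hz0).trans_le hzy)
  have hC0 : 0 ≤ C := by
    have h1 := (norm_nonneg _).trans (hC y hy hy0 hy1)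
    have h2 : 0 < ‖y‖ ^ M := pow_pos (norm_pos_iff.mpr hy0) _
    exact nonneg_of_mul_nonneg_left h1 h2
  set s : Set ℂ := (cone κ ∩ {w | 0 < w.im}) ∩ Metric.closedBall 0 ‖y‖
  have hs : Convex ℝ s :=
    ((convex_cone κ hκ.le).inter (convex_halfSpace_im_gt 0)).inter (convex_closedBall _ _)
  have hys : y ∈ s := ⟨⟨hy, im_pos_of_mem_cone hκ hy hy0⟩, by simp⟩
  have hzs : z ∈ s := ⟨⟨hz, im_pos_of_mem_cone hκ hz hz0⟩, by simpa using hzy⟩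
  have := hs.norm_image_sub_le_of_norm_hasDerivWithin_le (C := C * ‖y‖ ^ M)
    (fun w hw => (hr w hw.1.2).hasDerivWithinAt) (fun w hw => ?_) hzs hys
  · refine this.trans ?_
    have h3 : ‖y - z‖ ≤ 2 * ‖y‖ := (norm_sub_le _ _).trans (by linarith)
    calc C * ‖y‖ ^ M * ‖y - z‖ ≤ C * ‖y‖ ^ M * (2 * ‖y‖) := by gcongr
      _ = _ := by ring
  · have hw1 : ‖w‖ ≤ ‖y‖ := by simpa using hw.2
    have hw0 : w ≠ 0 := by
      rintro rfl
      simpa using hw.1.2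
    refine (hC w hw.1.1 hw0 (hw1.trans hy1)).trans ?_
    gcongr

/-- Once the singular terms and the first powers are removed, the derivative is O(‖y‖^M), so the
remainder has a limit at 0, which is the constant of integration, and approaches it at rate
‖y‖^(M+1). The limit is taken along the single sequence i / (n + 1), which lies in every cone with κ
≤ 1; hence one constant serves all M and all sectors. -/
theorem exists_isAsymptoticExpansion_of_hasDerivAt {φ φ' : ℂ → ℂ}
    (hφ : ∀ y : ℂ, 0 < y.im → HasDerivAt φ (φ' y) y) (p ℓ : ℂ) (a : ℕ → ℂ)
    (hexp : ∀ κ : ℝ, 0 < κ → ∀ M : ℕ, ∃ C, ∀ y ∈ cone κ, y ≠ 0 → ‖y‖ ≤ 1 →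
      ‖φ' y - (-p / y ^ 2 + ℓ / y + ∑ n ∈ Finset.range M, ((n : ℂ) + 1) * a n * y ^ n)‖ ≤
        C * ‖y‖ ^ M) :
    ∃ c, IsAsymptoticExpansion φ ⟨p, ℓ, c, a⟩ := by
  set r : ℕ → ℂ → ℂ := fun M y => φ y - FormalExpansion.truncation ⟨p, ℓ, 0, a⟩ M y
  have hr : ∀ M : ℕ, ∀ y : ℂ, 0 < y.im → HasDerivAt (r M)
      (φ' y - (-p / y ^ 2 + ℓ / y + ∑ n ∈ Finset.range M, ((n : ℂ) + 1) * a n * y ^ n)) y :=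
    fun M y hy => (hφ y hy).sub (hasDerivAt_truncation p ℓ 0 a M hy)
  set z : ℕ → ℂ := fun n => ((1 / ((n : ℝ) + 1) : ℝ) : ℂ) * I
  have hznorm : ∀ n, ‖z n‖ = 1 / ((n : ℝ) + 1) := by
    intro n
    simp only [z, norm_mul, norm_I, mul_one, norm_real]
    exact Real.norm_of_nonneg (by positivity)
  have hz0 : ∀ n, z n ≠ 0 := fun n => norm_pos_iff.mp (by rw [hznorm]; positivity)
  have hzcone : ∀ κ : ℝ, κ ≤ 1 → ∀ n, z n ∈ cone κ := by
    intro κ hκ n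
    rw [mem_cone, hznorm]
    simp only [z, im_ofReal_mul, I_im, mul_one]
    exact mul_le_of_le_one_left (by positivity) hκ
  have hzlim : Tendsto (fun n => ‖z n‖) atTop (𝓝 0) := by
    simp only [hznorm]
    exact tendsto_one_div_add_atTop_nhds_zero_nat
  have hzanti : ∀ n m, n ≤ m → ‖z m‖ ≤ ‖z n‖ := by
    intro n m hnm
    rw [hznorm, hznorm]
    gcongr
  have hz1 : ∀ n, ‖z n‖ ≤ 1 := by
    intro n
    have := hzanti 0 n n.zero_le
    rw [hznorm 0] at this
    simpa using this
  obtain ⟨c, hc⟩ : ∃ c, Tendsto (fun n => r 0 (z n)) atTop (𝓝 c) := by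
    obtain ⟨C, hC⟩ := hexp 1 one_pos 0
    apply cauchySeq_tendsto_of_complete
    refine cauchySeq_of_le_tendsto_0' (fun n => 2 * C * ‖z n‖) (fun n m hnm => ?_) ?_
    · rw [dist_eq_norm]
      have := norm_sub_le_of_hasDerivAt (hr 0) one_pos hC (hzcone 1 le_rfl n) (hzcone 1 le_rfl m)
        (hz0 m) (hzanti n m hnm) (hz1 n)
      simpa using this
    · simpa using hzlim.const_mul (2 * C)
  have hcM : ∀ M, Tendsto (fun n => r M (z n)) atTop (𝓝 c) := by
    intro M
    have hzl : Tendsto z atTop (𝓝 0) := tendsto_zero_iff_norm_tendsto_zero.mpr hzlim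
    have h1 : Tendsto (fun n => ∑ k ∈ Finset.range M, a k * z n ^ (k + 1)) atTop
        (𝓝 (∑ k ∈ Finset.range M, a k * 0 ^ (k + 1))) :=
      tendsto_finsetSum _ fun k _ => (hzl.pow (k + 1)).const_mul (a k)
    have h2 := hc.sub h1
    simp only [ne_eq, Nat.add_eq_zero_iff, one_ne_zero, and_false, not_false_eq_true, zero_pow,
      mul_zero, Finset.sum_const_zero, sub_zero] at h2
    refine h2.congr fun n => ?_
    simp only [r, FormalExpansion.truncation, Finset.range_zero, Finset.sum_empty]
    ring
  refine ⟨c, fun δ hδ M => ?_⟩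
  rcases lt_or_ge (Real.pi / 2) δ with hδ1 | hδ1
  · rw [sector_eq_empty hδ1]
    simp
  have hκ : 0 < Real.sin δ := Real.sin_pos_of_pos_of_lt_pi hδ (by linarith [Real.pi_pos])
  obtain ⟨C, hC⟩ := hexp _ hκ M
  refine IsBigO.of_bound (2 * C) ?_
  filter_upwards [self_mem_nhdsWithin, mem_nhdsWithin_of_mem_nhds
    (Metric.closedBall_mem_nhds (0 : ℂ) one_pos)] with y hy hy1
  have hyc := sector_subset_cone hδ hδ1 hy
  have hyp : 0 < ‖y‖ := norm_pos_iff.mpr hy.1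
  have hlim : Tendsto (fun n => ‖r M y - r M (z n)‖) atTop (𝓝 ‖r M y - c‖) :=
    ((hcM M).const_sub _).norm
  have hle : ‖r M y - c‖ ≤ 2 * C * ‖y‖ ^ (M + 1) := by
    refine le_of_tendsto hlim ?_
    filter_upwards [hzlim.eventually (gt_mem_nhds hyp)] with n hn
    exact norm_sub_le_of_hasDerivAt (hr M) hκ hC hyc (hzcone _ (Real.sin_le_one δ) n) (hz0 n)
      hn.le (by simpa using hy1)
  rw [norm_pow]
  convert! hle using 2
  simp only [r, FormalExpansion.truncation]
  ring

end ModularResurgence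

namespace ModularResurgence

/-! ### Lambert series -/

open scoped LSeries.notation

/-- The asymmetric growth conditions cover all the series that occur: weights 1, χ(d), 1 / e, χ̄(e)
/ e, and, after differentiation, e and e χ(e). -/
theorem summable_lambert {α β : ℕ → ℂ} (hα : ∀ d, ‖α d‖ ≤ 1) (hβ : ∀ e, e ≠ 0 → ‖β e‖ ≤ e) {q : ℂ}
    (hq : ‖q‖ < 1) :
    Summable fun p : ℕ × ℕ => α (p.1 + 1) * β (p.2 + 1) * q ^ ((p.1 + 1) * (p.2 + 1)) := by
  have h1 := summable_prod_mul_pow (𝕜 := ℝ) 1 (r := ‖q‖) (by simpa using hq)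
  have h2 := (Equiv.prodCongr Equiv.pnatEquivNat.symm Equiv.pnatEquivNat.symm).summable_iff.mpr h1
  refine Summable.of_norm_bounded h2 fun p => ?_
  simp only [Function.comp, Equiv.prodCongr_apply, Prod.map, Equiv.pnatEquivNat_symm_apply,
    Nat.succPNat_coe, pow_one, norm_mul, norm_pow, Nat.succ_eq_add_one]
  have := hβ (p.2 + 1) (Nat.succ_ne_zero _)
  gcongr
  calc ‖α (p.1 + 1)‖ * ‖β (p.2 + 1)‖ ≤ 1 * ((p.2 + 1 : ℕ) : ℝ) := by
        gcongr
        exact hα _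
    _ = _ := one_mul _

theorem hasSum_lambert {α β : ℕ → ℂ} (hα : ∀ d, ‖α d‖ ≤ 1) (hβ : ∀ e, e ≠ 0 → ‖β e‖ ≤ e) {q : ℂ}
    (hq : ‖q‖ < 1) :
    HasSum (fun m : ℕ => (α ⍟ β) (m + 1) * q ^ (m + 1))
      (∑' p : ℕ × ℕ, α (p.1 + 1) * β (p.2 + 1) * q ^ ((p.1 + 1) * (p.2 + 1))) := by
  have h1 := (summable_lambert hα hβ hq).hasSum
  have h2 : HasSum (fun p : ℕ+ × ℕ+ => α p.1 * β p.2 * q ^ ((p.1 : ℕ) * p.2))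
      (∑' p : ℕ × ℕ, α (p.1 + 1) * β (p.2 + 1) * q ^ ((p.1 + 1) * (p.2 + 1))) :=
    (Equiv.prodCongr Equiv.pnatEquivNat.symm Equiv.pnatEquivNat.symm).hasSum_iff.mp h1
  have h3 := (sigmaAntidiagonalEquivProd.hasSum_iff.mpr h2).sigma (fun n => hasSum_fintype _)
  rw [← hasSum_pnat_iff_hasSum_succ (f := fun m => (α ⍟ β) m * q ^ m)]
  convert! h3 using 1
  ext n
  simp only [Function.comp, sigmaAntidiagonalEquivProd, divisorsAntidiagonalFactors,
    Equiv.coe_fn_mk, PNat.mk_coe, Finset.univ_eq_attach]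
  rw [(n : ℕ).divisorsAntidiagonal.sum_attach
    (fun x : ℕ × ℕ => α x.1 * β x.2 * q ^ (x.1 * x.2)), LSeries.convolution_def, Finset.sum_mul]
  refine Finset.sum_congr rfl fun p hp => ?_
  rw [(Nat.mem_divisorsAntidiagonal.mp hp).1]

theorem norm_convolution_le {α β : ℕ → ℂ} (hα : ∀ d, ‖α d‖ ≤ 1) (hβ : ∀ e, e ≠ 0 → ‖β e‖ ≤ e)
    (m : ℕ) : ‖(α ⍟ β) m‖ ≤ (m : ℝ) ^ 2 := by
  rw [LSeries.convolution_def]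
  calc ‖∑ p ∈ m.divisorsAntidiagonal, α p.1 * β p.2‖ ≤ ∑ p ∈ m.divisorsAntidiagonal, (m : ℝ) := by
        refine (norm_sum_le _ _).trans (Finset.sum_le_sum fun p hp => ?_)
        obtain ⟨h1, h2⟩ := Nat.mem_divisorsAntidiagonal.mp hp
        have h4 : p.2 ≠ 0 := by
          rintro h
          rw [h, mul_zero] at h1
          exact h2 h1.symm
        have h3 : p.2 ≤ m := Nat.le_of_dvd (Nat.pos_of_ne_zero h2) (Dvd.intro_left _ h1)
        rw [norm_mul]
        calc ‖α p.1‖ * ‖β p.2‖ ≤ 1 * (p.2 : ℝ) := by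
              gcongr
              · exact hα _
              · exact hβ _ h4
          _ ≤ m := by rw [one_mul]; exact_mod_cast h3
    _ ≤ (m : ℝ) ^ 2 := by
        rw [Finset.sum_const, nsmul_eq_mul, sq]
        gcongr
        have := Nat.card_divisors_le_self m
        rwa [← Nat.map_div_right_divisors, Finset.card_map] 

theorem hasDerivAt_tsum_pow {A : ℕ → ℂ} (hA : ∀ m, ‖A m‖ ≤ (m : ℝ) ^ 2) {y : ℂ} (hy : 0 < y.im) :
    HasDerivAt (fun y => ∑' m : ℕ, A (m + 1) * exp (2 * Real.pi * I * y) ^ (m + 1))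
      (2 * Real.pi * I *
        ∑' m : ℕ, ((m + 1 : ℕ) : ℂ) * A (m + 1) * exp (2 * Real.pi * I * y) ^ (m + 1)) y := by
  -- On this smaller half-plane |q| stays below the fixed number ρ < 1, so the terms have a summable
  -- majorant and the series may be differentiated termwise.
  set U : Set ℂ := {w | y.im / 2 < w.im}
  have hU : IsOpen U := isOpen_lt continuous_const continuous_im
  have hyU : y ∈ U := by
    change y.im / 2 < y.im
    linarith
  set ρ : ℝ := Real.exp (-(2 * Real.pi * (y.im / 2)))
  have hρ : ρ < 1 := by
    rw [Real.exp_lt_one_iff]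
    have := Real.pi_pos
    simp only [Left.neg_neg_iff]
    positivity
  have hu : Summable fun m : ℕ => ((m + 1 : ℕ) : ℝ) ^ 2 * ρ ^ (m + 1) :=
    (summable_nat_add_iff (f := fun m : ℕ => (m : ℝ) ^ 2 * ρ ^ m) 1).mpr (summable_pow_mul_geometric_of_norm_lt_one 2
      (by rwa [Real.norm_of_nonneg (Real.exp_pos _).le]))
  have hd : ∀ (m : ℕ) (w : ℂ),
      HasDerivAt (fun w => A (m + 1) * exp (2 * Real.pi * I * w) ^ (m + 1))
      (2 * Real.pi * I * (((m + 1 : ℕ) : ℂ) * A (m + 1) * exp (2 * Real.pi * I * w) ^ (m + 1)))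
      w := by
    intro m w
    have := (((hasDerivAt_const_mul (2 * Real.pi * I : ℂ) (x := w)).cexp.fun_pow (m + 1)).const_mul
      (A (m + 1)))
    refine this.congr_deriv ?_
    simp only [Nat.add_sub_cancel]
    ring
  have hle : ∀ (m : ℕ) (w : ℂ), w ∈ U →
      ‖A (m + 1) * exp (2 * Real.pi * I * w) ^ (m + 1)‖ ≤ ((m + 1 : ℕ) : ℝ) ^ 2 * ρ ^ (m + 1) := by
    intro m w hw
    rw [norm_mul, norm_pow, norm_exp_two_pi_I_mul]
    have h1 : y.im / 2 < w.im := hw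
    have := hA (m + 1)
    have := Real.pi_pos
    gcongr
    apply Real.exp_le_exp.mpr
    nlinarith
  have h1 := hasSum_deriv_of_summable_norm hu
    (fun m w _ => (hd m w).differentiableAt.differentiableWithinAt) hU hle hyU
  have h2 := differentiableOn_tsum_of_summable_norm hu
    (fun m w _ => (hd m w).differentiableAt.differentiableWithinAt) hU hle
  have h3 := (h2.differentiableAt (hU.mem_nhds hyU)).hasDerivAt
  rw [← h1.tsum_eq] at h3
  refine h3.congr_deriv ?_
  rw [← tsum_mul_left]
  exact tsum_congr fun m => (hd m y).deriv

/-! ### The two functions as generating functions -/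

variable {N : ℕ} [NeZero N]

theorem sum_range_eq_sum_zmod (F : ZMod N → ℂ) :
    ∑ k ∈ Finset.range N, F (k : ZMod N) = ∑ j, F j := by
  obtain ⟨n, rfl⟩ : ∃ n, N = n + 1 := ⟨N - 1, (Nat.succ_pred (NeZero.ne N)).symm⟩
  rw [← Fin.sum_univ_eq_sum_range (fun k => F (k : ZMod (n + 1)))]
  refine Finset.sum_congr rfl fun j _ => ?_
  congr 1
  exact ZMod.natCast_zmod_val (n := n + 1) j

theorem sum_Icc_eq_sum_range_of_periodic {E : Type*} [AddCommMonoid E] {F : ℕ → E}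
    (h : F 0 = F N) : ∑ k ∈ Finset.Icc 1 N, F k = ∑ k ∈ Finset.range N, F k := by
  obtain ⟨n, hn⟩ : ∃ n, N = n + 1 := ⟨N - 1, (Nat.succ_pred (NeZero.ne N)).symm⟩
  rw [hn] at h ⊢
  rw [Finset.sum_range_succ', h, ← Finset.sum_range_succ (fun k => F (k + 1)),
    Finset.range_eq_Ico, Finset.sum_Ico_add' F 0 (n + 1) 1]
  rfl

theorem character_zero {N : ℕ} (hN : 2 ≤ N) (χ : DirichletCharacter ℂ N) : χ (0 : ZMod N) = 0 := by
  have : Fact (1 < N) := ⟨hN⟩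
  exact χ.map_zero

theorem rootOfUnity_pow_self : rootOfUnity N ^ N = 1 := by
  have hN0 : (N : ℂ) ≠ 0 := by exact_mod_cast NeZero.ne N
  rw [rootOfUnity, ← exp_nat_mul, mul_div_cancel₀ _ hN0, exp_two_pi_mul_I]

/-- Separability of the Gauss sum. Primitivity makes it valid also for e not coprime to N, where
both sides vanish unless N = 1. -/
theorem sum_character_mul_root {χ : DirichletCharacter ℂ N} (hχ : χ.IsPrimitive)
    (e : ℕ) :
    ∑ k ∈ Finset.Icc 1 N, χ (k : ZMod N) * (rootOfUnity N ^ k) ^ e = gauss χ * χ⁻¹ (e : ZMod N) := by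
  have hN0 : (N : ℂ) ≠ 0 := by exact_mod_cast NeZero.ne N
  have hroot : ∀ k : ℕ, (rootOfUnity N ^ k) ^ e =
      ZMod.stdAddChar (N := N) ((e : ZMod N) * (k : ZMod N)) := by
    intro k
    have := ZMod.stdAddChar_coe (N := N) ((e * k : ℕ) : ℤ)
    push_cast at this
    rw [this, rootOfUnity, ← exp_nat_mul, ← exp_nat_mul]
    congr 1
    ring
  rw [sum_Icc_eq_sum_range_of_periodic (by simp [rootOfUnity_pow_self])]
  simp only [hroot]
  rw [sum_range_eq_sum_zmod (fun k => χ k * ZMod.stdAddChar (N := N) ((e : ZMod N) * k)), mul_comm,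
    gauss, ← gaussSum_mulShift_of_isPrimitive _ hχ]
  rfl

/-- The convolution form is what the Lambert series, the factorization of the Dirichlet series and
the Euler product all rest on. -/
theorem stokesS_eq (χ : DirichletCharacter ℂ N) (m : ℕ) : stokesS χ m =
    -2 * gauss χ * ((1 : ℕ → ℂ) ⍟ fun d => χ⁻¹ (d : ZMod N) / (d : ℂ)) m := by
  rw [stokesS, LSeries.convolution_def, Int.natAbs_natCast]
  congr 1
  beta_reduce
  rw [Nat.sum_divisorsAntidiagonal' (fun a b => (1 : ℕ → ℂ) a * (χ⁻¹ (b : ZMod N) / (b : ℂ)))]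
  simp

theorem stokesR_eq {N : ℕ} (χ : DirichletCharacter ℂ N) (m : ℕ) : stokesR χ m =
    2 * ((fun d : ℕ => χ (d : ZMod N)) ⍟ fun e : ℕ => 1 / (e : ℂ)) m := by
  rw [stokesR, LSeries.convolution_def, Int.natAbs_natCast]
  congr 1
  beta_reduce
  rw [Nat.sum_divisorsAntidiagonal (fun a b => χ (a : ZMod N) * (1 / (b : ℂ)))]
  refine Finset.sum_congr rfl fun d hd => ?_
  obtain ⟨⟨e, rfl⟩, h0⟩ := Nat.mem_divisors.mp hd
  have hd0 : d ≠ 0 := fun h => h0 (by simp [h])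
  have he0 : e ≠ 0 := fun h => h0 (by simp [h])
  have hd1 : (d : ℂ) ≠ 0 := by exact_mod_cast hd0
  have he1 : (e : ℂ) ≠ 0 := by exact_mod_cast he0
  rw [Nat.mul_div_cancel_left _ (Nat.pos_of_ne_zero hd0)]
  push_cast
  field_simp

theorem norm_character_le_one {N : ℕ} (χ : DirichletCharacter ℂ N) (d : ℕ) : ‖χ (d : ZMod N)‖ ≤ 1 :=
  DirichletCharacter.norm_le_one χ _

theorem norm_div_natCast_le {z : ℂ} (hz : ‖z‖ ≤ 1) {e : ℕ} (he : e ≠ 0) :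
    ‖z / (e : ℂ)‖ ≤ e := by
  have : (1 : ℝ) ≤ e := by exact_mod_cast Nat.one_le_iff_ne_zero.mpr he
  rw [norm_div, Complex.norm_natCast, div_le_iff₀ (by linarith)]
  nlinarith

theorem hasSum_neg_log {z : ℂ} (hz : ‖z‖ < 1) :
    HasSum (fun e : ℕ => z ^ (e + 1) / ((e + 1 : ℕ) : ℂ)) (-log (1 - z)) := by
  have := (hasSum_nat_add_iff' 1).mpr (hasSum_taylorSeries_neg_log hz)
  simpa using this

theorem isGeneratingFunction_weightedF {χ : DirichletCharacter ℂ N} (hχ : χ.IsPrimitive) :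
    IsGeneratingFunction (weightedF χ) (stokesS χ) (constF χ) (1 / 2) := by
  refine ⟨by norm_num, fun y hy => ?_⟩
  set q := exp (2 * Real.pi * I * y) with hq
  have hq1 : ‖q‖ < 1 := norm_exp_two_pi_I_mul_lt_one hy
  have hroot : ∀ k, ‖rootOfUnity N ^ k‖ = 1 := by
    intro k
    have : rootOfUnity N = exp (((2 * Real.pi / N : ℝ) : ℂ) * I) := by
      rw [rootOfUnity]
      congr 1
      push_cast
      ring
    rw [norm_pow, this, norm_exp_ofReal_mul_I, one_pow]
  have hβ : ∀ k : ℕ, ∀ e : ℕ, e ≠ 0 → ‖(rootOfUnity N ^ k) ^ e / (e : ℂ)‖ ≤ e := fun k e he =>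
    norm_div_natCast_le (by rw [norm_pow, hroot, one_pow]) he
  have hk : ∀ k : ℕ, HasSum (fun m : ℕ =>
      ((1 : ℕ → ℂ) ⍟ fun e => (rootOfUnity N ^ k) ^ e / (e : ℂ)) (m + 1) * q ^ (m + 1))
      (log (1 - rootOfUnity N ^ k) - logQPochhammer (rootOfUnity N ^ k) (nome y)) := by
    intro k
    have h1 := hasSum_lambert (α := 1) (fun d => by simp) (hβ k) hq1
    have h2 := (summable_lambert (α := 1) (fun d => by simp) (hβ k) hq1).hasSum
    have h3 := h2.prod_fiberwise (g := fun n => -log (1 - rootOfUnity N ^ k * q ^ (n + 1)))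
      (fun n => by
        have hlt : ‖rootOfUnity N ^ k * q ^ (n + 1)‖ < 1 := by
          rw [norm_mul, hroot, one_mul, norm_pow]
          exact pow_lt_one₀ (norm_nonneg _) hq1 (Nat.succ_ne_zero _)
        convert! hasSum_neg_log hlt using 2 with e
        simp only [Pi.one_apply, one_mul, mul_pow, ← pow_mul]
        ring)
    have h4 := h3.neg
    simp only [neg_neg] at h4
    -- The factor n = 0 does not involve q and cannot be expanded in the same way; it contributes to
    -- the additive constant `constF χ`.
    rw [hasSum_nat_add_iff (f := fun n => log (1 - rootOfUnity N ^ k * q ^ n)) 1] at h4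
    rw [logQPochhammer, nome, ← hq, h4.tsum_eq]
    convert! h1 using 1
    simp
  have hsum := hasSum_sum (s := Finset.Icc 1 N) fun k _ => (hk k).mul_left (-χ (k : ZMod N))
  convert! hsum using 1
  · ext m
    have := stokesS_eq χ (m + 1)
    rw [Nat.cast_add_one] at this
    rw [this]
    simp only [← mul_assoc, ← Finset.sum_mul]
    congr 1
    simp only [LSeries.convolution_def, Finset.mul_sum]
    rw [Finset.sum_comm]
    refine Finset.sum_congr rfl fun p _ => ?_
    have h5 := sum_character_mul_root hχ p.2
    simp only [Pi.one_apply, one_mul, neg_mul, Finset.sum_neg_distrib, ← mul_div_assoc,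
      ← Finset.sum_div, h5]
    ring
  · rw [weightedF, constF, ← Finset.sum_sub_distrib]
    refine Finset.sum_congr rfl fun k _ => ?_
    ring

theorem isGeneratingFunction_weightedG (hN : 2 ≤ N) (χ : DirichletCharacter ℂ N) :
    IsGeneratingFunction (weightedG χ) (stokesR χ) 0 (-1 / 2) := by
  refine ⟨by norm_num, fun y hy => ?_⟩
  set q := exp (2 * Real.pi * I * y) with hq
  have hq1 : ‖q‖ < 1 := norm_exp_two_pi_I_mul_lt_one hy
  have hα := norm_character_le_one χ
  have hβ : ∀ e : ℕ, e ≠ 0 → ‖1 / (e : ℂ)‖ ≤ e := fun e he => norm_div_natCast_le (by simp) he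
  have h1 := hasSum_lambert hα hβ hq1
  have h3 := (summable_lambert hα hβ hq1).hasSum.prod_fiberwise
    (g := fun k => -(χ ((k + 1 : ℕ) : ZMod N) * log (1 - q ^ (k + 1)))) (fun k => by
      have hlt : ‖q ^ (k + 1)‖ < 1 := by
        rw [norm_pow]
        exact pow_lt_one₀ (norm_nonneg _) hq1 (Nat.succ_ne_zero _)
      convert! (hasSum_neg_log hlt).mul_left (χ ((k + 1 : ℕ) : ZMod N)) using 1
      · ext e
        rw [← pow_mul]
        ring
      · ring)
  have h4 := h3.neg
  simp only [neg_neg] at h4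
  rw [hasSum_nat_add_iff (f := fun k : ℕ => χ (k : ZMod N) * log (1 - q ^ k)) 1] at h4
  -- The exponents k + N n, with k running over residues, exhaust the natural numbers, and χ depends
  -- only on the residue.
  have h5 : weightedG χ y = ∑' k : ℕ, χ (k : ZMod N) * log (1 - q ^ k) := by
    rw [Nat.sumByResidueClasses h4.summable N, weightedG,
      sum_Icc_eq_sum_range_of_periodic (by simp [character_zero hN])]
    rw [← sum_range_eq_sum_zmod (fun j : ZMod N => ∑' m : ℕ,
      χ ((j.val + N * m : ℕ) : ZMod N) * log (1 - q ^ (j.val + N * m)))]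
    refine Finset.sum_congr rfl fun k hk => ?_
    rw [ZMod.val_natCast_of_lt (Finset.mem_range.mp hk), logQPochhammer, ← tsum_mul_left]
    refine tsum_congr fun m => ?_
    rw [nome, ← hq, pow_add, pow_mul]
    simp
  rw [h5, h4.tsum_eq, sub_zero]
  convert! h1.mul_left (-1) using 1
  · ext m
    have := stokesR_eq χ (m + 1)
    rw [Nat.cast_add_one] at this
    rw [this]
    ring
  · simp [character_zero hN]

end ModularResurgence

namespace ModularResurgence

open scoped LSeries.notation

variable {N : ℕ} [NeZero N]

/-! ### Asymptotic expansions of the two functions -/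

/-- Differentiation in y multiplies the m-th coefficient by m, and m = d e clears the denominator e.
-/
theorem natCast_mul_stokesR {N : ℕ} (χ : DirichletCharacter ℂ N) (m : ℕ) :
    (m : ℂ) * ((fun d : ℕ => χ (d : ZMod N)) ⍟ fun e : ℕ => 1 / (e : ℂ)) m =
      ((1 : ℕ → ℂ) ⍟ fun e : ℕ => (e : ℂ) * χ (e : ZMod N)) m := by
  rcases eq_or_ne m 0 with rfl | hm
  · simp
  have h1 := stokesR_eq χ m
  rw [stokesR, Int.natAbs_natCast] at h1
  rw [← mul_left_cancel₀ two_ne_zero h1, LSeries.convolution_def]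
  beta_reduce
  rw [Nat.sum_divisorsAntidiagonal' (fun a b => (1 : ℕ → ℂ) a * ((b : ℂ) * χ (b : ZMod N))),
    Finset.mul_sum]
  refine Finset.sum_congr rfl fun d _ => ?_
  have : (m : ℂ) ≠ 0 := by exact_mod_cast hm
  push_cast
  simp only [Pi.one_apply]
  field_simp

theorem natCast_mul_convolution_one {N : ℕ} (χ : DirichletCharacter ℂ N) (m : ℕ) :
    (m : ℂ) * ((1 : ℕ → ℂ) ⍟ fun d => χ (d : ZMod N) / (d : ℂ)) m =
      ((fun d : ℕ => χ (d : ZMod N)) ⍟ fun e : ℕ => (e : ℂ)) m := by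
  rw [LSeries.convolution_def, LSeries.convolution_def]
  beta_reduce
  rw [Nat.sum_divisorsAntidiagonal' (fun a b => (1 : ℕ → ℂ) a * (χ (b : ZMod N) / (b : ℂ))),
    Nat.sum_divisorsAntidiagonal (fun a b => χ (a : ZMod N) * (b : ℂ)), Finset.mul_sum]
  refine Finset.sum_congr rfl fun d hd => ?_
  obtain ⟨⟨e, rfl⟩, h0⟩ := Nat.mem_divisors.mp hd
  have hd0 : d ≠ 0 := fun h => h0 (by simp [h])
  have hd1 : (d : ℂ) ≠ 0 := by exact_mod_cast hd0
  rw [Nat.mul_div_cancel_left _ (Nat.pos_of_ne_zero hd0)]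
  push_cast
  simp only [Pi.one_apply]
  field_simp

theorem tsum_eq_tsum_succ_of_eq_zero {f : ℕ → ℂ} (h : f 0 = 0) :
    ∑' k, f k = ∑' k, f (k + 1) :=
  (tsum_pnat_eq_tsum_of_eq_zero h).symm.trans tsum_pnat_eq_tsum_succ

theorem hasSum_succ_mul_geometric {x : ℂ} (hx : ‖x‖ < 1) :
    HasSum (fun n : ℕ => ((n + 1 : ℕ) : ℂ) * x ^ (n + 1)) (x / (1 - x) ^ 2) := by
  rw [hasSum_nat_add_iff (f := fun n : ℕ => (n : ℂ) * x ^ n) 1]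
  simpa using hasSum_coe_mul_geometric_of_norm_lt_one hx

/-- In the differentiated Lambert series the sum over the unweighted divisor is geometric. What
remains is k χ(k) q^k / (1 - q^k), the exponential form of `bernoulliGen` at k y up to the factor 1
/ y. -/
theorem hasDerivAt_weightedG (hN : 2 ≤ N) (χ : DirichletCharacter ℂ N) {y : ℂ} (hy : 0 < y.im) :
    HasDerivAt (weightedG χ) (1 / y * ∑' k : ℕ, χ (k : ZMod N) * bernoulliGen (k * y)) y := by
  have hα := norm_character_le_one χ
  have hβ : ∀ e : ℕ, e ≠ 0 → ‖1 / (e : ℂ)‖ ≤ e := fun e he => norm_div_natCast_le (by simp) he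
  have hβ' : ∀ e : ℕ, e ≠ 0 → ‖(e : ℂ) * χ (e : ZMod N)‖ ≤ e := fun e _ => by
    rw [norm_mul, Complex.norm_natCast]
    exact mul_le_of_le_one_right e.cast_nonneg (hα e)
  have hy0 : y ≠ 0 := by
    rintro rfl
    simp at hy
  have hq1 := norm_exp_two_pi_I_mul_lt_one hy
  have h1 := (hasDerivAt_tsum_pow (norm_convolution_le hα hβ) hy).const_mul (-1)
  refine (h1.congr_deriv ?_).congr_of_eventuallyEq ?_
  · simp only [natCast_mul_stokesR]
    rw [(hasSum_lambert (α := 1) (fun d => by simp) hβ' hq1).tsum_eq]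
    have h2 := (summable_lambert (α := 1) (fun d => by simp) hβ' hq1).hasSum
    have h3 : ∀ k : ℕ, ‖exp (2 * Real.pi * I * y) ^ (k + 1)‖ < 1 := fun k => by
      rw [norm_pow]
      exact pow_lt_one₀ (norm_nonneg _) hq1 (Nat.succ_ne_zero _)
    have h4 := HasSum.prod_fiberwise ((Equiv.prodComm ℕ ℕ).hasSum_iff.mpr h2)
      (g := fun k => ((k + 1 : ℕ) : ℂ) * χ ((k + 1 : ℕ) : ZMod N) *
        (exp (2 * Real.pi * I * y) ^ (k + 1) * (1 - exp (2 * Real.pi * I * y) ^ (k + 1))⁻¹))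
      (fun k => by
        convert! ((hasSum_geometric_of_norm_lt_one (h3 k)).mul_left
          (exp (2 * Real.pi * I * y) ^ (k + 1))).mul_left
          (((k + 1 : ℕ) : ℂ) * χ ((k + 1 : ℕ) : ZMod N)) using 2 with d
        simp only [Function.comp, Equiv.prodComm_apply, Prod.swap_prod_mk, Pi.one_apply, one_mul,
          mul_comm (d + 1) (k + 1), pow_mul]
        ring)
    rw [← h4.tsum_eq, ← tsum_mul_left, ← tsum_mul_left, ← tsum_mul_left]
    symm
    refine (tsum_eq_tsum_succ_of_eq_zero ?_).trans (tsum_congr fun k => ?_)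
    · simp [character_zero hN]
    · have hky : 0 < (((k + 1 : ℕ) : ℂ) * y).im := by
        rw [← ofReal_natCast, im_ofReal_mul]
        positivity
      have hE := exp_two_pi_I_mul_ne_one hky
      have hEq : exp (2 * Real.pi * I * y) ^ (k + 1) =
          exp (2 * Real.pi * I * (((k + 1 : ℕ) : ℂ) * y)) := by
        rw [← exp_nat_mul]
        congr 1
        ring
      rw [bernoulliGen_eq hky, hEq]
      generalize exp (2 * Real.pi * I * (((k + 1 : ℕ) : ℂ) * y)) = E at *
      have hE1 : E - 1 ≠ 0 := sub_ne_zero.mpr hE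
      have hE2 : 1 - E ≠ 0 := sub_ne_zero.mpr hE.symm
      rw [← neg_sub E 1, inv_neg]
      field_simp
  · have : ∀ᶠ w : ℂ in 𝓝 y, 0 < w.im := continuous_im.continuousAt.eventually (lt_mem_nhds hy)
    filter_upwards [this] with w hw
    have h2 := ((isGeneratingFunction_weightedG hN χ).2 w hw).tsum_eq
    rw [sub_zero] at h2
    rw [← h2, ← tsum_mul_left]
    refine tsum_congr fun m => ?_
    have := stokesR_eq χ (m + 1)
    rw [Nat.cast_add_one] at this
    rw [this]
    ring

/-- The inner sum is now ∑ n x^n = x / (1 - x)², the exponential part of the derivative of `cotReg`.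
Its other part 1 / (k y)² has to be subtracted again; integrated, it is the source of the pole in
the expansion of 𝔣. -/
theorem hasDerivAt_weightedF (hN : 2 ≤ N) {χ : DirichletCharacter ℂ N} (hχ : χ.IsPrimitive)
    {y : ℂ} (hy : 0 < y.im) :
    HasDerivAt (weightedF χ) (-(I * gauss χ / (2 * Real.pi)) *
      (∑' k : ℕ, χ⁻¹ (k : ZMod N) * deriv cotReg (k * y) -
        (∑' k : ℕ, χ⁻¹ (k : ZMod N) / (k : ℂ) ^ 2) / y ^ 2)) y := by
  have hα := norm_character_le_one χ⁻¹
  have hβ : ∀ e : ℕ, e ≠ 0 → ‖χ⁻¹ (e : ZMod N) / (e : ℂ)‖ ≤ e := fun e he =>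
    norm_div_natCast_le (hα e) he
  have hβ' : ∀ e : ℕ, e ≠ 0 → ‖(e : ℂ)‖ ≤ e := fun e _ => by simp
  have hy0 : y ≠ 0 := by
    rintro rfl
    simp at hy
  have hq1 := norm_exp_two_pi_I_mul_lt_one hy
  have h1 := ((hasDerivAt_tsum_pow (norm_convolution_le (α := 1) (fun d => by simp) hβ)
    hy).const_mul (-gauss χ)).const_add (constF χ)
  refine (h1.congr_deriv ?_).congr_of_eventuallyEq ?_
  · simp only [natCast_mul_convolution_one]
    rw [(hasSum_lambert hα hβ' hq1).tsum_eq]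
    have h2 := (summable_lambert hα hβ' hq1).hasSum
    have h3 : ∀ k : ℕ, ‖exp (2 * Real.pi * I * y) ^ (k + 1)‖ < 1 := fun k => by
      rw [norm_pow]
      exact pow_lt_one₀ (norm_nonneg _) hq1 (Nat.succ_ne_zero _)
    have h4 := h2.prod_fiberwise
      (g := fun k => χ⁻¹ ((k + 1 : ℕ) : ZMod N) * (exp (2 * Real.pi * I * y) ^ (k + 1) /
        (1 - exp (2 * Real.pi * I * y) ^ (k + 1)) ^ 2))
      (fun k => by
        convert! (hasSum_succ_mul_geometric (h3 k)).mul_left (χ⁻¹ ((k + 1 : ℕ) : ZMod N)) using 2 with e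
        rw [pow_mul]
        ring)
    have hs1 : Summable fun k : ℕ => χ⁻¹ (k : ZMod N) * deriv cotReg (k * y) := by
      have hyp : 0 < ‖y‖ := norm_pos_iff.mpr hy0
      -- The widest aperture parameter for which the cone still contains the given point y.
      obtain ⟨C, hC⟩ := exists_norm_iteratedDeriv_deriv_cotReg_le (κ := y.im / ‖y‖)
        (by positivity) 0
      refine summable_mul_of_norm_le_inv_sq (NeZero.pos N) (fun k => by simp)
        (κ := y.im / ‖y‖) (C := C) (by simpa using hC) ?_ hy0
      rw [mem_cone, div_mul_cancel₀ _ hyp.ne']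
    have hs2 : Summable fun k : ℕ => χ⁻¹ (k : ZMod N) / (k : ℂ) ^ 2 := by
      have hs := Real.summable_one_div_nat_pow.mpr one_lt_two
      refine Summable.of_norm_bounded hs fun k => ?_
      rw [norm_div, norm_pow, Complex.norm_natCast]
      gcongr
      exact hα k
    rw [← h4.tsum_eq, ← tsum_div_const, ← hs1.tsum_sub (hs2.div_const _), ← tsum_mul_left,
      ← tsum_mul_left, ← tsum_mul_left]
    symm
    refine (tsum_eq_tsum_succ_of_eq_zero ?_).trans (tsum_congr fun k => ?_)
    · simp [character_zero hN]
    · have hky : 0 < (((k + 1 : ℕ) : ℂ) * y).im := by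
        rw [← ofReal_natCast, im_ofReal_mul]
        positivity
      have hE := exp_two_pi_I_mul_ne_one hky
      have hEq : exp (2 * Real.pi * I * y) ^ (k + 1) =
          exp (2 * Real.pi * I * (((k + 1 : ℕ) : ℂ) * y)) := by
        rw [← exp_nat_mul]
        congr 1
        ring
      rw [(hasDerivAt_cotReg hky).deriv, hEq]
      generalize exp (2 * Real.pi * I * (((k + 1 : ℕ) : ℂ) * y)) = E at *
      have hE1 : E - 1 ≠ 0 := sub_ne_zero.mpr hE
      have hE2 : 1 - E ≠ 0 := sub_ne_zero.mpr hE.symm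
      have hk0 : ((k + 1 : ℕ) : ℂ) ≠ 0 := by exact_mod_cast Nat.succ_ne_zero k
      have hpi : (Real.pi : ℂ) ≠ 0 := by exact_mod_cast Real.pi_ne_zero
      rw [← neg_sub E 1, neg_sq]
      field_simp
      ring
  · have : ∀ᶠ w : ℂ in 𝓝 y, 0 < w.im := continuous_im.continuousAt.eventually (lt_mem_nhds hy)
    filter_upwards [this] with w hw
    have h2 := ((isGeneratingFunction_weightedF hχ).2 w hw).tsum_eq
    rw [eq_sub_iff_add_eq'] at h2
    rw [← h2, ← tsum_mul_left]
    congr 1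
    refine tsum_congr fun m => ?_
    have := stokesS_eq χ (m + 1)
    rw [Nat.cast_add_one] at this
    rw [this]
    ring

theorem ne_one_of_isPrimitive (hN : 2 ≤ N) {χ : DirichletCharacter ℂ N} (hχ : χ.IsPrimitive) :
    χ ≠ 1 := by
  rintro rfl
  have : (1 : DirichletCharacter ℂ N).conductor = 1 := DirichletCharacter.conductor_one
  rw [DirichletCharacter.IsPrimitive] at hχ
  omega

theorem sum_range_character {χ : DirichletCharacter ℂ N} (hχ : χ ≠ 1) :
    ∑ a ∈ Finset.range N, χ (a : ZMod N) = 0 := by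
  rw [sum_range_eq_sum_zmod (fun j => χ j)]
  exact MulChar.sum_eq_zero_of_ne_one hχ

/-- The coefficients of the asymptotic expansion of `weightedF χ`. -/
def coeffF (χ : DirichletCharacter ℂ N) (m : ℕ) : ℂ :=
  -(I * gauss χ / (2 * Real.pi)) *
    (bernoulliWeight N (fun k => χ⁻¹ (k : ZMod N)) m * (m.factorial * cotCoeff (m + 1)))

/-- The coefficients of the asymptotic expansion of `weightedG χ`. -/
def coeffG (χ : DirichletCharacter ℂ N) (m : ℕ) : ℂ :=
  bernoulliWeight N (fun k => χ (k : ZMod N)) (m + 1) *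
    (m.factorial * (cotCoeff m + if m = 0 then Real.pi * I else 0))

theorem exists_isAsymptoticExpansion_weightedF (hN : 2 ≤ N) {χ : DirichletCharacter ℂ N}
    (hχ : χ.IsPrimitive) :
    ∃ p c, IsAsymptoticExpansion (weightedF χ) ⟨p, 0, c, coeffF χ⟩ := by
  have hχ1 : χ⁻¹ ≠ 1 := inv_ne_one.mpr (ne_one_of_isPrimitive hN hχ)
  set K : ℂ := -(I * gauss χ / (2 * Real.pi))
  set L2 : ℂ := ∑' k : ℕ, χ⁻¹ (k : ZMod N) / (k : ℂ) ^ 2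
  refine ⟨K * L2, exists_isAsymptoticExpansion_of_hasDerivAt
    (fun y hy => hasDerivAt_weightedF hN hχ hy) (K * L2) 0 (coeffF χ) fun κ hκ M => ?_⟩
  obtain ⟨C, hC⟩ := norm_tsum_sub_le (NeZero.pos N) (ψ := fun k : ℕ => χ⁻¹ (k : ZMod N))
    (fun k => by simp) (sum_range_character hχ1) (h := deriv cotReg) (κ := κ)
    (fun z hz => by
      rcases eq_or_ne z 0 with rfl | hz0
      · exact analyticAt_deriv_cotReg_zero.1
      · exact (analyticAt_cotReg (im_pos_of_mem_cone hκ hz hz0)).deriv)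
    (exists_norm_iteratedDeriv_deriv_cotReg_le hκ) M
  refine ⟨‖K‖ * C, fun y hy hy0 hy1 => ?_⟩
  have h1 := hC y hy hy0 hy1
  rw [mul_assoc]
  refine le_trans (le_of_eq ?_) (mul_le_mul_of_nonneg_left h1 (norm_nonneg K))
  rw [← norm_mul]
  congr 1
  rw [mul_sub, mul_sub, Finset.mul_sum]
  have h2 : ∀ m ∈ Finset.range M, ((m : ℂ) + 1) * coeffF χ m * y ^ m =
      K * (bernoulliWeight N (fun k : ℕ => χ⁻¹ (k : ZMod N)) m *
        iteratedDeriv m (deriv cotReg) 0 * y ^ m) := by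
    intro m _
    rw [analyticAt_deriv_cotReg_zero.2, coeffF, Nat.factorial_succ]
    push_cast
    ring
  rw [Finset.sum_congr rfl h2]
  ring

theorem exists_isAsymptoticExpansion_weightedG (hN : 2 ≤ N) {χ : DirichletCharacter ℂ N}
    (hχ : χ.IsPrimitive) :
    ∃ ℓ c, IsAsymptoticExpansion (weightedG χ) ⟨0, ℓ, c, coeffG χ⟩ := by
  have hχ1 : χ ≠ 1 := ne_one_of_isPrimitive hN hχ
  set w := bernoulliWeight N (fun k => χ (k : ZMod N))
  refine ⟨w 0, exists_isAsymptoticExpansion_of_hasDerivAt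
    (fun y hy => hasDerivAt_weightedG hN χ hy) 0 (w 0) (coeffG χ) fun κ hκ M => ?_⟩
  -- The order is M + 1 because 𝔤' carries an extra factor 1 / y. After this division the constant
  -- term `w 0` becomes `w 0 / y`, whose integral is the logarithm.
  obtain ⟨C, hC⟩ := norm_tsum_sub_le (NeZero.pos N) (ψ := fun k : ℕ => χ (k : ZMod N))
    (fun k => by simp) (sum_range_character hχ1) (h := bernoulliGen) (κ := κ)
    (fun z hz => by
      rcases eq_or_ne z 0 with rfl | hz0
      · exact analyticAt_bernoulliGen_zero.1
      · exact analyticAt_bernoulliGen (im_pos_of_mem_cone hκ hz hz0))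
    (exists_norm_iteratedDeriv_bernoulliGen_le hκ) (M + 1)
  refine ⟨C, fun y hy hy0 hy1 => ?_⟩
  have h1 := hC y hy hy0 hy1
  have hyp : 0 < ‖y‖ := norm_pos_iff.mpr hy0
  rw [pow_succ, ← mul_assoc, ← div_le_iff₀ hyp, ← norm_div] at h1
  refine le_trans (le_of_eq ?_) h1
  congr 1
  rw [sub_div, Finset.sum_range_succ', add_div, Finset.sum_div]
  have h2 : ∀ m ∈ Finset.range M, w (m + 1) * iteratedDeriv (m + 1) bernoulliGen 0 *
      y ^ (m + 1) / y = ((m : ℂ) + 1) * coeffG χ m * y ^ m := by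
    intro m _
    rw [analyticAt_bernoulliGen_zero.2.2, coeffG, Nat.factorial_succ]
    push_cast
    field_simp
    simp only [w]
    ring
  rw [Finset.sum_congr rfl h2, analyticAt_bernoulliGen_zero.2.1]
  ring

end ModularResurgence

namespace ModularResurgence

/-! ### Borel transforms with simple poles -/

/-- The term `-S / (2πi) (1 / (ζ - m 𝒜) + 1 / (m 𝒜))` of a Mittag-Leffler expansion. -/
def poleTerm (𝒜 : ℂ) (S : ℤ → ℂ) (m : ℤ) (ζ : ℂ) : ℂ :=
  -S m / (2 * Real.pi * I * (m * 𝒜)) * (ζ / (ζ - m * 𝒜))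

theorem poleTerm_zero (𝒜 : ℂ) (S : ℤ → ℂ) (ζ : ℂ) : poleTerm 𝒜 S 0 ζ = 0 := by
  simp [poleTerm]

theorem analyticAt_poleTerm {𝒜 : ℂ} {S : ℤ → ℂ} {m : ℤ} {ζ : ℂ} (h : m ≠ 0 → ζ ≠ m * 𝒜) :
    AnalyticAt ℂ (poleTerm 𝒜 S m) ζ := by
  rcases eq_or_ne m 0 with rfl | hm
  · have : poleTerm 𝒜 S 0 = fun _ => 0 := funext fun ζ => poleTerm_zero 𝒜 S ζ
    rw [this]
    exact analyticAt_const
  · unfold poleTerm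
    exact analyticAt_const.mul
      (analyticAt_id.div (analyticAt_id.sub analyticAt_const) (sub_ne_zero.mpr (h hm)))

theorem norm_poleTerm_le {𝒜 : ℂ} (h𝒜 : 𝒜 ≠ 0) (S : ℤ → ℂ) {R : ℝ} (hR : 0 < R) {m : ℤ}
    (hm : 2 * R ≤ |(m : ℝ)| * ‖𝒜‖) {ζ : ℂ} (hζ : ‖ζ‖ < R) :
    ‖poleTerm 𝒜 S m ζ‖ ≤ R / (Real.pi * ‖𝒜‖ ^ 2) * (‖S m‖ / |(m : ℝ)| ^ 2) := by
  have hA : 0 < ‖𝒜‖ := norm_pos_iff.mpr h𝒜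
  have hm0 : 0 < |(m : ℝ)| := by
    by_contra h
    nlinarith [abs_nonneg (m : ℝ)]
  have h1 : |(m : ℝ)| * ‖𝒜‖ / 2 ≤ ‖ζ - m * 𝒜‖ := by
    have := norm_sub_norm_le ((m : ℂ) * 𝒜) ζ
    rw [norm_sub_rev, norm_mul, norm_intCast] at this
    linarith
  have hpi := Real.pi_pos
  rw [poleTerm]
  simp only [norm_mul, norm_div, norm_neg, norm_I, norm_real, Real.norm_of_nonneg hpi.le,
    norm_ofNat, norm_intCast]
  calc ‖S m‖ / (2 * Real.pi * 1 * (|(m : ℝ)| * ‖𝒜‖)) * (‖ζ‖ / ‖ζ - m * 𝒜‖)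
      ≤ ‖S m‖ / (2 * Real.pi * 1 * (|(m : ℝ)| * ‖𝒜‖)) * (R / (|(m : ℝ)| * ‖𝒜‖ / 2)) := by
        gcongr
    _ = _ := by
        field_simp

/-- Local form of the Mittag-Leffler theorem: on a disc of radius R only the finitely many terms
with |m 𝒜| small can be singular. The others satisfy |m 𝒜| ≥ 2R, hence |ζ - m 𝒜| ≥ |m 𝒜| / 2, and
are uniformly dominated by a multiple of ‖S m‖ / m². -/
theorem exists_tsum_poleTerm_eq {𝒜 : ℂ} (h𝒜 : 𝒜 ≠ 0) {S : ℤ → ℂ}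
    (hS : Summable fun m : ℤ => ‖S m‖ / |(m : ℝ)| ^ 2) {R : ℝ} (hR : 0 < R) :
    ∃ (s : Finset ℤ) (G : ℂ → ℂ), DifferentiableOn ℂ G (Metric.ball 0 R) ∧
      (∀ m : ℤ, ‖(m : ℂ) * 𝒜‖ < R → m ∈ s) ∧
      ∀ ζ ∈ Metric.ball (0 : ℂ) R,
        ∑' m, poleTerm 𝒜 S m ζ = ∑ m ∈ s, poleTerm 𝒜 S m ζ + G ζ := by
  have hA : 0 < ‖𝒜‖ := norm_pos_iff.mpr h𝒜
  obtain ⟨K, hK⟩ := exists_nat_ge (2 * R / ‖𝒜‖)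
  rw [div_le_iff₀ hA] at hK
  set s : Finset ℤ := Finset.Icc (-(K : ℤ)) K
  have hout : ∀ m ∉ s, 2 * R ≤ |(m : ℝ)| * ‖𝒜‖ := by
    intro m hm
    refine hK.trans ?_
    gcongr
    rw [Finset.mem_Icc, ← abs_le, not_le] at hm
    exact_mod_cast hm.le
  set T : ℤ → ℂ → ℂ := fun m ζ => if m ∈ s then 0 else poleTerm 𝒜 S m ζ
  have hu : Summable fun m : ℤ => R / (Real.pi * ‖𝒜‖ ^ 2) * (‖S m‖ / |(m : ℝ)| ^ 2) :=
    hS.mul_left _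
  have hle : ∀ (m : ℤ) (ζ : ℂ), ζ ∈ Metric.ball (0 : ℂ) R →
      ‖T m ζ‖ ≤ R / (Real.pi * ‖𝒜‖ ^ 2) * (‖S m‖ / |(m : ℝ)| ^ 2) := by
    intro m ζ hζ
    by_cases hm : m ∈ s
    · simp only [T, hm, if_true, norm_zero]
      have := Real.pi_pos
      positivity
    · simp only [T, hm, if_false]
      exact norm_poleTerm_le h𝒜 S hR (hout m hm) (by simpa using hζ)
  have hdiff : ∀ m : ℤ, DifferentiableOn ℂ (T m) (Metric.ball 0 R) := by
    intro m
    by_cases hm : m ∈ s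
    · simp only [T, hm, if_true]
      exact differentiableOn_const 0
    · simp only [T, hm, if_false]
      intro ζ hζ
      refine (analyticAt_poleTerm fun _ h => ?_).differentiableAt.differentiableWithinAt
      have h1 := hout m hm
      have h2 : ‖ζ‖ < R := by simpa using hζ
      rw [h, norm_mul, norm_intCast] at h2
      linarith
  refine ⟨s, fun ζ => ∑' m, T m ζ, differentiableOn_tsum_of_summable_norm hu hdiff
    Metric.isOpen_ball hle, fun m hm => ?_, fun ζ hζ => ?_⟩
  · by_contra h
    have := hout m h
    rw [norm_mul, norm_intCast] at hm
    linarith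
  · have h1 : HasSum (fun m => T m ζ) (∑' m, T m ζ) :=
      (Summable.of_norm_bounded hu fun m => hle m ζ hζ).hasSum
    have h2 : HasSum (fun m => if m ∈ s then poleTerm 𝒜 S m ζ else 0)
        (∑ m ∈ s, poleTerm 𝒜 S m ζ) := by
      have : HasSum (fun m => if m ∈ s then poleTerm 𝒜 S m ζ else 0)
          (∑ m ∈ s, if m ∈ s then poleTerm 𝒜 S m ζ else 0) :=
        hasSum_sum_of_ne_finset_zero fun m hm => by simp [hm]
      convert! this using 1
      exact Finset.sum_congr rfl fun m hm => by simp [hm]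
    rw [← (h2.add h1).tsum_eq]
    refine tsum_congr fun m => ?_
    by_cases hm : m ∈ s <;> simp [T, hm]

theorem norm_div_pow_le {𝒜 : ℂ} (S : ℤ → ℂ) (m : ℤ) (n : ℕ) :
    ‖S m / (2 * Real.pi * I) / (m * 𝒜) ^ (n + 2)‖ ≤
      ‖S m‖ / |(m : ℝ)| ^ 2 * (1 / (2 * Real.pi) * (1 / ‖𝒜‖ ^ (n + 2))) := by
  have hpi := Real.pi_pos
  rcases eq_or_ne m 0 with rfl | hm
  · simp
  · have h1 : (1 : ℝ) ≤ |(m : ℝ)| := by exact_mod_cast Int.one_le_abs hm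
    have h2 : |(m : ℝ)| ^ 2 ≤ |(m : ℝ)| ^ (n + 2) := pow_le_pow_right₀ h1 (by omega)
    simp only [norm_mul, norm_div, norm_pow, norm_I, norm_real, Real.norm_of_nonneg hpi.le,
      norm_ofNat, norm_intCast, mul_pow]
    calc ‖S m‖ / (2 * Real.pi * 1) / (|(m : ℝ)| ^ (n + 2) * ‖𝒜‖ ^ (n + 2))
        = ‖S m‖ / |(m : ℝ)| ^ (n + 2) * (1 / (2 * Real.pi) * (1 / ‖𝒜‖ ^ (n + 2))) := by
          rw [mul_one, div_div, div_mul_div_comm, div_mul_div_comm, mul_one, mul_one]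
          congr 1
          ring
      _ ≤ _ := by gcongr

theorem hasSum_poleTerm {𝒜 : ℂ} (S : ℤ → ℂ) {ζ : ℂ} (hζ : ‖ζ‖ < ‖𝒜‖) (m : ℤ) :
    HasSum (fun n : ℕ => S m / (2 * Real.pi * I) / (m * 𝒜) ^ (n + 2) * ζ ^ (n + 1))
      (poleTerm 𝒜 S m ζ) := by
  rcases eq_or_ne m 0 with rfl | hm
  · simp [poleTerm_zero]
  have hA : 0 < ‖𝒜‖ := (norm_nonneg ζ).trans_lt hζ
  have hmA : (m : ℂ) * 𝒜 ≠ 0 := mul_ne_zero (by exact_mod_cast hm) (norm_pos_iff.mp hA)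
  have h1 : (1 : ℝ) ≤ |(m : ℝ)| := by exact_mod_cast Int.one_le_abs hm
  have hlt : ‖ζ‖ < ‖(m : ℂ) * 𝒜‖ := by
    rw [norm_mul, norm_intCast]
    nlinarith
  have hr : ‖ζ / (m * 𝒜)‖ < 1 := by
    rw [norm_div, div_lt_one (norm_pos_iff.mpr hmA)]
    exact hlt
  have hne : (m : ℂ) * 𝒜 - ζ ≠ 0 := by
    intro h0
    rw [sub_eq_zero.mp h0] at hlt
    exact lt_irrefl _ hlt
  have hpi : (Real.pi : ℂ) ≠ 0 := by exact_mod_cast Real.pi_ne_zero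
  have hI := I_ne_zero
  convert! (hasSum_geometric_of_norm_lt_one hr).mul_left
    (S m / (2 * Real.pi * I) / (m * 𝒜) ^ 2 * ζ) using 1
  · ext n
    rw [div_pow, pow_add ((m : ℂ) * 𝒜) n 2, pow_succ ζ]
    generalize (m : ℂ) * 𝒜 = w at *
    field_simp
  · rw [poleTerm, one_sub_div hmA, inv_div]
    generalize (m : ℂ) * 𝒜 = w at *
    rw [← neg_sub w ζ, div_neg]
    field_simp

/-- The last hypothesis identifies the Taylor coefficients of the Borel transform from the first
power on with those of the sum of all `poleTerm`s, which vanishes at 0. So that sum plus `a 0` is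
the continuation, and `a 0` is unconstrained. -/
theorem hasStokesTower_of_tsum {a : ℕ → ℂ} {𝒜 : ℂ} (h𝒜 : 𝒜 ≠ 0) {S : ℤ → ℂ}
    (hS0 : ∀ m, m ≠ 0 → S m ≠ 0) (hS : Summable fun m : ℤ => ‖S m‖ / |(m : ℝ)| ^ 2)
    (ha : ∀ n : ℕ, a (n + 1) / ((n + 1).factorial : ℂ) =
      ∑' m : ℤ, S m / (2 * Real.pi * I) / (m * 𝒜) ^ (n + 2)) :
    HasStokesTower a 𝒜 S := by
  have hA : 0 < ‖𝒜‖ := norm_pos_iff.mpr h𝒜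
  refine ⟨h𝒜, fun ζ => a 0 + ∑' m, poleTerm 𝒜 S m ζ, ?_, ?_, ?_⟩
  · filter_upwards [Metric.ball_mem_nhds (0 : ℂ) hA] with ζ hζ
    have hζ1 : ‖ζ‖ < ‖𝒜‖ := by simpa using hζ
    have hfib : ∀ n : ℕ, Summable fun m : ℤ => S m / (2 * Real.pi * I) / (m * 𝒜) ^ (n + 2) :=
      fun n => Summable.of_norm_bounded (hS.mul_right _) fun m => norm_div_pow_le S m n
    have hu : Summable fun p : ℕ × ℤ =>
        S p.2 / (2 * Real.pi * I) / (p.2 * 𝒜) ^ (p.1 + 2) * ζ ^ (p.1 + 1) := by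
      have hg := (summable_geometric_of_lt_one (by positivity)
        ((div_lt_one hA).mpr hζ1)).mul_of_nonneg (hS.mul_left (‖ζ‖ / (2 * Real.pi * ‖𝒜‖ ^ 2)))
        (fun n => by positivity)
        (fun m => by have := Real.pi_pos; positivity)
      refine Summable.of_norm_bounded hg fun p => ?_
      rw [norm_mul, norm_pow]
      calc _ ≤ ‖S p.2‖ / |(p.2 : ℝ)| ^ 2 * (1 / (2 * Real.pi) * (1 / ‖𝒜‖ ^ (p.1 + 2))) *
            ‖ζ‖ ^ (p.1 + 1) := by
            gcongr
            exact norm_div_pow_le S p.2 p.1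
        _ = _ := by
            rw [div_pow, pow_add, pow_succ]
            have := Real.pi_pos
            field_simp
            ring
    have h1 := hasSum_tsum_of_summable_prod
      (u := fun (n : ℕ) (m : ℤ) => S m / (2 * Real.pi * I) / (m * 𝒜) ^ (n + 2) * ζ ^ (n + 1)) hu
      (fun n => by
        have := (hfib n).hasSum.mul_right (ζ ^ (n + 1))
        rwa [← ha n] at this)
      (fun m => hasSum_poleTerm S hζ1 m)
    rw [hasSum_nat_add_iff (f := fun n : ℕ => a n / (n.factorial : ℂ) * ζ ^ n) 1] at h1
    simpa [add_comm] using h1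
  · intro ζ hζ
    obtain ⟨s, G, hG, -, heq⟩ := exists_tsum_poleTerm_eq h𝒜 hS
      (show 0 < ‖ζ‖ + 1 by positivity)
    have hmem : ζ ∈ Metric.ball (0 : ℂ) (‖ζ‖ + 1) := by simp
    have hnhds := Metric.isOpen_ball.mem_nhds hmem
    apply DifferentiableAt.differentiableWithinAt
    have h1 : DifferentiableAt ℂ (fun ζ => a 0 + (∑ m ∈ s, poleTerm 𝒜 S m ζ + G ζ)) ζ := by
      refine (differentiableAt_const _).add (DifferentiableAt.add ?_ (hG.differentiableAt hnhds))
      exact DifferentiableAt.fun_sum fun m _ => (analyticAt_poleTerm fun hm => hζ m hm).differentiableAt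
    refine h1.congr_of_eventuallyEq ?_
    filter_upwards [hnhds] with w hw
    rw [heq w hw]
  · intro m₀ hm₀
    refine ⟨hS0 m₀ hm₀, ?_⟩
    have hm₀' : (m₀ : ℂ) ≠ 0 := by exact_mod_cast hm₀
    obtain ⟨s, G, hG, hs, heq⟩ := exists_tsum_poleTerm_eq h𝒜 hS
      (show 0 < ‖(m₀ : ℂ) * 𝒜‖ + 1 by positivity)
    have hmem : (m₀ : ℂ) * 𝒜 ∈ Metric.ball (0 : ℂ) (‖(m₀ : ℂ) * 𝒜‖ + 1) := by simp
    have hnhds := Metric.isOpen_ball.mem_nhds hmem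
    -- The regular part at the pole m₀ 𝒜: all other terms, together with the constant that
    -- `poleTerm` adds to its own simple fraction to make it vanish at 0.
    refine ⟨fun ζ => a 0 - S m₀ / (2 * Real.pi * I * (m₀ * 𝒜)) +
      (∑ m ∈ s.erase m₀, poleTerm 𝒜 S m ζ + G ζ), ?_, ?_⟩
    · refine analyticAt_const.add (AnalyticAt.add ?_ (hG.analyticAt hnhds))
      refine Finset.analyticAt_fun_sum _ fun m hm => analyticAt_poleTerm fun _ h => ?_
      have := mul_right_cancel₀ h𝒜 h
      exact Finset.ne_of_mem_erase hm (by exact_mod_cast this.symm)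
    · filter_upwards [mem_nhdsWithin_of_mem_nhds hnhds, self_mem_nhdsWithin] with w hw hw0
      have hw1 : w - m₀ * 𝒜 ≠ 0 := sub_ne_zero.mpr hw0
      have hpi : (Real.pi : ℂ) ≠ 0 := by exact_mod_cast Real.pi_ne_zero
      rw [heq w hw, ← Finset.add_sum_erase s _ (hs m₀ (by linarith))]
      have : poleTerm 𝒜 S m₀ w =
          -S m₀ / (2 * Real.pi * I * (w - m₀ * 𝒜)) - S m₀ / (2 * Real.pi * I * (m₀ * 𝒜)) := by
        rw [poleTerm]
        have := I_ne_zero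
        field_simp
        ring
      rw [this]
      ring

/-- The nearest singularities lie at distance ‖𝒜‖, which is the Gevrey radius: the sum over m is
bounded by a constant times ‖𝒜‖^(-n). -/
theorem isGevreyOne_of_tsum {a : ℕ → ℂ} {𝒜 : ℂ} (h𝒜 : 𝒜 ≠ 0) {S : ℤ → ℂ}
    (hS : Summable fun m : ℤ => ‖S m‖ / |(m : ℝ)| ^ 2)
    (ha : ∀ n : ℕ, a (n + 1) / ((n + 1).factorial : ℂ) =
      ∑' m : ℤ, S m / (2 * Real.pi * I) / (m * 𝒜) ^ (n + 2)) :
    IsGevreyOne a := by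
  have hA : 0 < ‖𝒜‖ := norm_pos_iff.mpr h𝒜
  have hpi := Real.pi_pos
  set D : ℝ := (∑' m : ℤ, ‖S m‖ / |(m : ℝ)| ^ 2) * (1 / (2 * Real.pi)) / ‖𝒜‖
  have hD : 0 ≤ D := by
    have : 0 ≤ ∑' m : ℤ, ‖S m‖ / |(m : ℝ)| ^ 2 := tsum_nonneg fun m => by positivity
    positivity
  refine ⟨‖a 0‖ + D + 1, ‖𝒜‖, by positivity, hA, fun n => ?_⟩
  rcases n with - | n
  · simp only [pow_zero, mul_one, Nat.factorial_zero, Nat.cast_one]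
    linarith
  · have hfac : (0 : ℝ) < (n + 1).factorial := by exact_mod_cast (n + 1).factorial_pos
    have h1 : ‖a (n + 1)‖ / (n + 1).factorial ≤ D * ‖𝒜‖⁻¹ ^ (n + 1) := by
      have h2 := tsum_of_norm_bounded
        (hS.mul_right (1 / (2 * Real.pi) * (1 / ‖𝒜‖ ^ (n + 2)))).hasSum
        (fun m => norm_div_pow_le (𝒜 := 𝒜) S m n)
      rw [← ha n, norm_div, Complex.norm_natCast, tsum_mul_right] at h2
      refine h2.trans (le_of_eq ?_)
      simp only [D]
      rw [inv_pow]
      field_simp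
      ring
    rw [div_le_iff₀ hfac] at h1
    refine h1.trans ?_
    gcongr
    linarith [norm_nonneg (a 0)]

/-! ### Uniqueness of asymptotic expansions -/

theorem IsAsymptoticExpansion.isBigO_vertical {φ : ℂ → ℂ} {F G : FormalExpansion}
    (hF : IsAsymptoticExpansion φ F) (hG : IsAsymptoticExpansion φ G) (M : ℕ) :
    (fun t : ℝ => F.truncation M (t * I) - G.truncation M (t * I)) =O[𝓝[>] 0]
      fun t : ℝ => t ^ (M + 1) := by
  have hpi := Real.pi_pos
  have h1 := (hG (Real.pi / 4) (by positivity) M).sub (hF (Real.pi / 4) (by positivity) M)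
  have hlim : Tendsto (fun t : ℝ => (t : ℂ) * I) (𝓝[>] 0) (𝓝[sector (Real.pi / 4)] 0) := by
    rw [tendsto_nhdsWithin_iff]
    constructor
    · have : Tendsto (fun t : ℝ => (t : ℂ) * I) (𝓝 0) (𝓝 (((0 : ℝ) : ℂ) * I)) :=
        (continuous_ofReal.mul continuous_const).tendsto 0
      simp only [ofReal_zero, zero_mul] at this
      exact this.mono_left nhdsWithin_le_nhds
    · filter_upwards [self_mem_nhdsWithin] with t ht
      have ht : 0 < t := ht
      refine ⟨by simp [ht.ne'], ?_⟩
      rw [arg_real_mul I ht, arg_I]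
      constructor <;> linarith
  refine ((h1.comp_tendsto hlim).congr_left fun t => ?_).trans (IsBigO.of_bound 1 ?_)
  · simp
  · refine Eventually.of_forall fun t => ?_
    simp

/-- On the imaginary axis the difference of the expansions tends to 0, and its terms are eliminated
in order of size. Multiplication by t isolates the pole, comparison of t with t / 2 leaves ℓ log 2,
the limit is the constant, and the powers follow by strong induction. -/
theorem IsAsymptoticExpansion.coeff_unique {φ : ℂ → ℂ} {F G : FormalExpansion}
    (hF : IsAsymptoticExpansion φ F) (hG : IsAsymptoticExpansion φ G) : F.coeff = G.coeff := by
  have key := fun M => hF.isBigO_vertical hG M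
  set p := F.pole - G.pole
  set ℓ := F.logCoeff - G.logCoeff
  set c := F.const - G.const
  set b : ℕ → ℂ := fun n => F.coeff n - G.coeff n
  have htr : ∀ (M : ℕ) (t : ℝ), 0 < t → F.truncation M (t * I) - G.truncation M (t * I) =
      p / (t * I) + ℓ * (Real.log (2 * Real.pi * t) : ℂ) + c +
        ∑ n ∈ Finset.range M, b n * (t * I) ^ (n + 1) := by
    intro M t ht
    have hlog : log (-2 * Real.pi * I * (t * I)) = (Real.log (2 * Real.pi * t) : ℂ) := by
      have := Real.pi_pos
      rw [ofReal_log (by positivity)]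
      congr 1
      push_cast
      linear_combination (-2 * Real.pi * t : ℂ) * I_sq
    simp only [FormalExpansion.truncation, hlog, b, sub_mul, Finset.sum_sub_distrib, p, ℓ, c]
    ring
  have hpos : ∀ᶠ t : ℝ in 𝓝[>] 0, 0 < t := self_mem_nhdsWithin
  have hid : Tendsto (fun t : ℝ => t) (𝓝[>] 0) (𝓝 0) := nhdsWithin_le_nhds
  have hidC : Tendsto (fun t : ℝ => (t : ℂ)) (𝓝[>] 0) (𝓝 0) := by
    have := (continuous_ofReal.tendsto 0).mono_left (nhdsWithin_le_nhds (s := Set.Ioi (0 : ℝ)))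
    simpa using this
  have hlim0 : Tendsto (fun t : ℝ => p / (t * I) + ℓ * (Real.log (2 * Real.pi * t) : ℂ) + c)
      (𝓝[>] 0) (𝓝 0) := by
    have h1 := (key 0).trans_tendsto (by simpa using hid)
    refine h1.congr' ?_
    filter_upwards [hpos] with t ht
    rw [htr 0 t ht]
    simp
  have hp : p = 0 := by
    have hlogt : Tendsto (fun t : ℝ => (t : ℂ) * (Real.log (2 * Real.pi * t) : ℂ)) (𝓝[>] 0)
        (𝓝 0) := by
      have h1 : Tendsto (fun t : ℝ => t * Real.log (2 * Real.pi * t)) (𝓝[>] 0) (𝓝 0) := by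
        have h2 := (Real.continuous_mul_log.tendsto 0).mono_left
          (nhdsWithin_le_nhds (s := Set.Ioi (0 : ℝ)))
        simp only [zero_mul] at h2
        have h3 := h2.add (hid.mul_const (Real.log (2 * Real.pi)))
        simp only [zero_mul, add_zero] at h3
        refine h3.congr' ?_
        filter_upwards [hpos] with t ht
        rw [Real.log_mul (by positivity) ht.ne']
        ring
      have h4 := (continuous_ofReal.tendsto 0).comp h1
      simpa [Function.comp_def] using h4
    have h1 := hidC.mul hlim0
    have h2 := (h1.sub (hlogt.const_mul ℓ)).sub (hidC.mul_const c)
    simp only [mul_zero, zero_mul, sub_zero] at h2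
    have h3 : Tendsto (fun _ : ℝ => p / I) (𝓝[>] (0 : ℝ)) (𝓝 0) := by
      refine h2.congr' ?_
      filter_upwards [hpos] with t ht
      have : (t : ℂ) ≠ 0 := by exact_mod_cast ht.ne'
      field_simp
      ring
    have := tendsto_nhds_unique h3 tendsto_const_nhds
    simpa using this.symm
  simp only [hp, zero_div, zero_add] at hlim0 htr
  have hℓ : ℓ = 0 := by
    have hhalf : Tendsto (fun t : ℝ => t / 2) (𝓝[>] 0) (𝓝[>] 0) := by
      rw [tendsto_nhdsWithin_iff]
      refine ⟨by simpa using hid.div_const 2, ?_⟩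
      filter_upwards [hpos] with t ht
      exact half_pos ht
    have h1 := hlim0.sub (hlim0.comp hhalf)
    rw [sub_zero] at h1
    have h3 : Tendsto (fun _ : ℝ => ℓ * (Real.log 2 : ℂ)) (𝓝[>] (0 : ℝ)) (𝓝 0) := by
      refine h1.congr' ?_
      filter_upwards [hpos] with t ht
      have : 2 * Real.pi * (t / 2) = (2 * Real.pi * t) / 2 := by ring
      simp only [Function.comp, this]
      rw [Real.log_div (by positivity) two_ne_zero]
      push_cast
      ring
    have := tendsto_nhds_unique h3 tendsto_const_nhds
    have h4 : (Real.log 2 : ℂ) ≠ 0 := by exact_mod_cast (Real.log_pos one_lt_two).ne'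
    exact (mul_eq_zero.mp this.symm).resolve_right h4
  simp only [hℓ, zero_mul, zero_add] at hlim0 htr
  have hc : c = 0 := (tendsto_nhds_unique hlim0 tendsto_const_nhds).symm
  simp only [hc, zero_add] at htr
  have hb : ∀ n, b n = 0 := by
    intro n
    induction n using Nat.strong_induction_on with
    | _ n ih =>
      have h1 : (fun t : ℝ => b n * (t * I) ^ (n + 1)) =O[𝓝[>] 0] fun t : ℝ => t ^ (n + 2) := by
        refine (key (n + 1)).congr' ?_ EventuallyEq.rfl
        filter_upwards [hpos] with t ht
        rw [htr _ t ht, Finset.sum_range_succ, Finset.sum_eq_zero, zero_add]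
        intro k hk
        rw [ih k (Finset.mem_range.mp hk), zero_mul]
      have h2 : (fun _ : ℝ => ‖b n‖) =O[𝓝[>] (0 : ℝ)] fun t : ℝ => t := by
        have h3 := h1.norm_left.mul (isBigO_refl (fun t : ℝ => (t ^ (n + 1))⁻¹) (𝓝[>] 0))
        refine h3.congr' ?_ ?_
        · filter_upwards [hpos] with t ht
          rw [norm_mul, norm_pow, norm_mul, norm_I, norm_real, Real.norm_of_nonneg ht.le, mul_one]
          field_simp
        · filter_upwards [hpos] with t ht
          rw [pow_succ t (n + 1)]
          field_simp
      have h3 := h2.trans_tendsto hid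
      have := tendsto_nhds_unique h3 tendsto_const_nhds
      simpa using this.symm
  funext n
  exact sub_eq_zero.mp (hb n)

/-- The Borel transform is constant near 0, hence on the disc ‖ζ‖ < ‖𝒜‖ by the identity theorem.
Approaching 𝒜 radially from inside shows that the residue there is zero, so S 1 = 0, which is
excluded. -/
theorem not_hasStokesTower_of_eq_zero {a : ℕ → ℂ} (ha : ∀ n, n ≠ 0 → a n = 0) {𝒜 : ℂ}
    {S : ℤ → ℂ} : ¬ HasStokesTower a 𝒜 S := by
  rintro ⟨h𝒜, B, hB0, hBd, hpole⟩
  have hA : 0 < ‖𝒜‖ := norm_pos_iff.mpr h𝒜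
  obtain ⟨hS, h, hh, hBh⟩ := hpole 1 one_ne_zero
  simp only [Int.cast_one, one_mul] at hh hBh
  have hB1 : ∀ᶠ ζ in 𝓝 (0 : ℂ), B ζ = a 0 := by
    filter_upwards [hB0] with ζ hζ
    have h1 := hasSum_single (f := fun n : ℕ => a n / (n.factorial : ℂ) * ζ ^ n) 0
      (fun n hn => by simp [ha n hn])
    rw [hζ.unique h1]
    simp
  have hball : Metric.ball (0 : ℂ) ‖𝒜‖ ⊆ {ζ | ∀ m : ℤ, m ≠ 0 → ζ ≠ m * 𝒜} := by
    rintro ζ hζ m hm rfl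
    have h1 : (1 : ℝ) ≤ |(m : ℝ)| := by exact_mod_cast Int.one_le_abs hm
    rw [mem_ball_zero_iff, norm_mul, norm_intCast] at hζ
    nlinarith
  have hana : AnalyticOnNhd ℂ B (Metric.ball 0 ‖𝒜‖) :=
    (hBd.mono hball).analyticOnNhd Metric.isOpen_ball
  have hEq : Set.EqOn B (fun _ => a 0) (Metric.ball 0 ‖𝒜‖) :=
    hana.eqOn_of_preconnected_of_eventuallyEq (fun _ _ => analyticAt_const)
      (convex_ball _ _).isPreconnected (Metric.mem_ball_self hA) hB1
  have hlim : Tendsto (fun t : ℝ => (t : ℂ) * 𝒜) (𝓝[<] 1) (𝓝[≠] 𝒜) := by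
    rw [tendsto_nhdsWithin_iff]
    constructor
    · have : Tendsto (fun t : ℝ => (t : ℂ) * 𝒜) (𝓝 1) (𝓝 (((1 : ℝ) : ℂ) * 𝒜)) :=
        (continuous_ofReal.mul continuous_const).tendsto 1
      simp only [ofReal_one, one_mul] at this
      exact this.mono_left nhdsWithin_le_nhds
    · filter_upwards [self_mem_nhdsWithin] with t ht h1
      have ht : t < 1 := ht
      have h2 : (t : ℂ) = 1 := by
        have h3 : (t : ℂ) * 𝒜 = 1 * 𝒜 := by simpa using h1
        exact mul_right_cancel₀ h𝒜 h3
      have : t = 1 := by exact_mod_cast h2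
      exact ht.ne this
  have hh1 : Tendsto h (𝓝[≠] 𝒜) (𝓝 (h 𝒜)) := hh.continuousAt.tendsto.mono_left nhdsWithin_le_nhds
  have hz : Tendsto (fun ζ : ℂ => ζ - 𝒜) (𝓝[≠] 𝒜) (𝓝 0) := by
    have : Tendsto (fun ζ : ℂ => ζ - 𝒜) (𝓝 𝒜) (𝓝 (𝒜 - 𝒜)) :=
      (continuous_id.sub continuous_const).tendsto 𝒜
    rw [sub_self] at this
    exact this.mono_left nhdsWithin_le_nhds
  have h1 : Tendsto (fun ζ : ℂ => (ζ - 𝒜) * (h ζ - a 0)) (𝓝[≠] 𝒜) (𝓝 0) := by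
    simpa using hz.mul (hh1.sub_const (a 0))
  have h2 : Tendsto (fun _ : ℝ => S 1 / (2 * Real.pi * I)) (𝓝[<] (1 : ℝ)) (𝓝 0) := by
    refine (h1.comp hlim).congr' ?_
    have hpos : ∀ᶠ t : ℝ in 𝓝[<] 1, 0 < t :=
      mem_nhdsWithin_of_mem_nhds (lt_mem_nhds zero_lt_one)
    filter_upwards [hlim.eventually hBh, hlim.eventually self_mem_nhdsWithin, hpos,
      self_mem_nhdsWithin] with t ht ht0 htp ht1
    have ht1 : t < 1 := ht1
    have h3 : B (t * 𝒜) = a 0 := hEq (by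
      rw [mem_ball_zero_iff, norm_mul, norm_real, Real.norm_of_nonneg htp.le]
      nlinarith)
    have h4 : (t : ℂ) * 𝒜 - 𝒜 ≠ 0 := sub_ne_zero.mpr ht0
    rw [h3] at ht
    have hpi : (Real.pi : ℂ) ≠ 0 := by exact_mod_cast Real.pi_ne_zero
    have hI := I_ne_zero
    simp only [Function.comp]
    have h5 : h (t * 𝒜) - a 0 = S 1 / (2 * Real.pi * I * (t * 𝒜 - 𝒜)) := by
      rw [ht]
      ring
    rw [h5]
    generalize (t : ℂ) * 𝒜 - 𝒜 = w at h4 ⊢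
    field_simp
  have h3 := tendsto_nhds_unique h2 tendsto_const_nhds
  have hpi : (Real.pi : ℂ) ≠ 0 := by exact_mod_cast Real.pi_ne_zero
  have h4 : S 1 = 0 := by simpa [hpi, I_ne_zero] using h3.symm
  exact hS h4

end ModularResurgence

namespace ModularResurgence

open scoped LSeries.notation

variable {N : ℕ} [NeZero N]

/-! ### Dirichlet series and the expansion coefficients -/

theorem LSeriesHasSum_character {χ : DirichletCharacter ℂ N} {s : ℂ} (hs : 1 < s.re) :
    LSeriesHasSum (fun n : ℕ => χ (n : ZMod N)) s (χ.LFunction s) := by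
  rw [DirichletCharacter.LFunction_eq_LSeries χ hs]
  exact (DirichletCharacter.LSeriesSummable_of_one_lt_re χ hs).hasSum

theorem LSeriesHasSum_div_natCast {f : ℕ → ℂ} {s a : ℂ} (h : LSeriesHasSum f (s + 1) a) :
    LSeriesHasSum (fun n : ℕ => f n / (n : ℂ)) s a := by
  unfold LSeriesHasSum at *
  convert! h using 1
  ext n
  rcases eq_or_ne n 0 with rfl | hn
  · simp
  · have hn' : (n : ℂ) ≠ 0 := by exact_mod_cast hn
    rw [LSeries.term_of_ne_zero hn, LSeries.term_of_ne_zero hn, cpow_add _ _ hn', cpow_one,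
      div_div, mul_comm]

theorem LSeriesHasSum_stokesS (χ : DirichletCharacter ℂ N) {s : ℂ} (hs : 1 < s.re) :
    LSeriesHasSum ((1 : ℕ → ℂ) ⍟ fun d => χ⁻¹ (d : ZMod N) / (d : ℂ)) s (lfun χ s) := by
  rw [lfun, mul_comm]
  refine (LSeriesHasSum_one hs).convolution (LSeriesHasSum_div_natCast (LSeriesHasSum_character ?_))
  rw [add_re, one_re]
  linarith

theorem LSeriesHasSum_stokesR (χ : DirichletCharacter ℂ N) {s : ℂ} (hs : 1 < s.re) :
    LSeriesHasSum ((fun d : ℕ => χ (d : ZMod N)) ⍟ fun e : ℕ => 1 / (e : ℂ)) s (lfun' χ s) := by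
  refine (LSeriesHasSum_character hs).convolution
    (LSeriesHasSum_div_natCast (f := 1) (LSeriesHasSum_one ?_))
  rw [add_re, one_re]
  linarith

theorem hasSum_div_pow_of_LSeriesHasSum {f : ℕ → ℂ} {k : ℕ} (hk : k ≠ 0) {a : ℂ}
    (h : LSeriesHasSum f k a) : HasSum (fun n : ℕ => f n / (n : ℂ) ^ k) a := by
  unfold LSeriesHasSum at h
  convert! h using 1
  ext n
  rcases eq_or_ne n 0 with rfl | hn
  · simp [hk]
  · rw [LSeries.term_of_ne_zero hn, cpow_natCast]

theorem one_lt_re_natCast_add_two (n : ℕ) : 1 < ((n + 2 : ℕ) : ℂ).re := by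
  rw [natCast_re]
  push_cast
  have : (0 : ℝ) ≤ n := n.cast_nonneg
  linarith

theorem stokesS_neg (χ : DirichletCharacter ℂ N) (m : ℤ) : stokesS χ (-m) = stokesS χ m := by
  simp [stokesS]

theorem stokesR_neg {N : ℕ} (χ : DirichletCharacter ℂ N) (m : ℤ) :
    stokesR χ (-m) = -stokesR χ m := by
  simp only [stokesR, Int.natAbs_neg, Int.cast_neg, div_neg, neg_mul, Finset.sum_neg_distrib,
    mul_neg]

/-- Source of the parity factors on the Stokes side: S is even and R is odd in m, so dividing by
m^(n+2) gives ε = (-1)^n and ε = -(-1)^n respectively. -/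
theorem hasSum_int_of_nat_of_neg_eq_mul {f : ℤ → ℂ} {ε a : ℂ} (h0 : f 0 = 0)
    (hneg : ∀ m : ℕ, f (-m) = ε * f m) (h : HasSum (fun m : ℕ => f m) a) :
    HasSum f ((1 + ε) * a) := by
  have h1 : HasSum (fun m : ℕ => f (-m)) (ε * a) := by
    simp only [hneg]
    exact h.mul_left ε
  have h2 := HasSum.of_nat_of_neg h h1
  rwa [h0, sub_zero, ← one_add_mul] at h2

theorem hasSum_stokesS_div_pow (χ : DirichletCharacter ℂ N) (n : ℕ) :
    HasSum (fun m : ℤ => stokesS χ m / (m : ℂ) ^ (n + 2))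
      ((1 + (-1) ^ n) * (-2 * gauss χ * lfun χ (n + 2 : ℕ))) := by
  refine hasSum_int_of_nat_of_neg_eq_mul (by simp) (fun m => ?_) ?_
  · rw [stokesS_neg, Int.cast_neg, neg_pow, pow_add (-1 : ℂ) n 2, neg_one_sq, mul_one]
    rcases neg_one_pow_eq_or ℂ n with h | h <;> simp [h, div_neg]
  · have h1 := (hasSum_div_pow_of_LSeriesHasSum (k := n + 2) (Nat.succ_ne_zero _)
      (LSeriesHasSum_stokesS χ (one_lt_re_natCast_add_two n))).mul_left (-2 * gauss χ)
    convert! h1 using 2 with m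
    rw [stokesS_eq, Int.cast_natCast, mul_div_assoc]

theorem hasSum_stokesR_div_pow (χ : DirichletCharacter ℂ N) (n : ℕ) :
    HasSum (fun m : ℤ => stokesR χ m / (m : ℂ) ^ (n + 2))
      ((1 - (-1) ^ n) * (2 * lfun' χ (n + 2 : ℕ))) := by
  rw [sub_eq_add_neg]
  refine hasSum_int_of_nat_of_neg_eq_mul (by simp) (fun m => ?_) ?_
  · rw [stokesR_neg, Int.cast_neg, neg_pow, pow_add (-1 : ℂ) n 2, neg_one_sq, mul_one]
    rcases neg_one_pow_eq_or ℂ n with h | h <;> simp [h, neg_div, div_neg]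
  · have h1 := (hasSum_div_pow_of_LSeriesHasSum (k := n + 2) (Nat.succ_ne_zero _)
      (LSeriesHasSum_stokesR χ (one_lt_re_natCast_add_two n))).mul_left 2
    convert! h1 using 2 with m
    rw [stokesR_eq, Int.cast_natCast, mul_div_assoc]

theorem summable_norm_stokesS (χ : DirichletCharacter ℂ N) :
    Summable fun m : ℤ => ‖stokesS χ m‖ / |(m : ℝ)| ^ 2 := by
  have := (hasSum_stokesS_div_pow χ 0).summable.norm
  refine this.congr fun m => ?_
  rw [norm_div, norm_pow, norm_intCast]

theorem summable_norm_stokesR (χ : DirichletCharacter ℂ N) :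
    Summable fun m : ℤ => ‖stokesR χ m‖ / |(m : ℝ)| ^ 2 := by
  have := (hasSum_stokesR_div_pow χ 0).summable.norm
  refine this.congr fun m => ?_
  rw [norm_div, norm_pow, norm_intCast]

theorem inv_character_neg_one {N : ℕ} (χ : DirichletCharacter ℂ N) : χ⁻¹ (-1) = χ (-1) := by
  rw [MulChar.inv_apply_eq_inv']
  rcases χ.even_or_odd with h | h
  · rw [h]; simp
  · rw [h]; norm_num

theorem isPrimitive_inv {N : ℕ} {χ : DirichletCharacter ℂ N} (hχ : χ.IsPrimitive) : χ⁻¹.IsPrimitive := by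
  rwa [DirichletCharacter.IsPrimitive, DirichletCharacter.conductor_inv]

/-- Separability rewrites the product as a double sum of additive characters in e (k + 1);
orthogonality in e leaves only k = -1. The modulus need not be prime. -/
theorem gauss_mul_gauss_inv {χ : DirichletCharacter ℂ N} (hχ : χ.IsPrimitive) :
    gauss χ * gauss χ⁻¹ = χ (-1) * N := by
  have h1 : ∀ e : ZMod N, gauss χ * χ⁻¹ e =
      ∑ k, χ k * ZMod.stdAddChar (N := N) (e * k) := by
    intro e
    rw [mul_comm, gauss, ← gaussSum_mulShift_of_isPrimitive _ hχ]
    rfl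
  have h2 : gauss χ * gauss χ⁻¹ =
      ∑ e, ∑ k, χ k * ZMod.stdAddChar (N := N) (e * (k + 1)) := by
    conv_lhs => enter [2]; rw [gauss, gaussSum]
    rw [Finset.mul_sum]
    refine Finset.sum_congr rfl fun e _ => ?_
    rw [← mul_assoc, h1, Finset.sum_mul]
    refine Finset.sum_congr rfl fun k _ => ?_
    rw [mul_add, mul_one, AddChar.map_add_eq_mul, mul_assoc]
  rw [h2, Finset.sum_comm]
  simp only [← Finset.mul_sum, AddChar.sum_mulShift _ (ZMod.isPrimitive_stdAddChar N)]
  rw [Finset.sum_eq_single (-1)]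
  · simp
  · intro k _ hk
    rw [if_neg (fun h => hk (eq_neg_of_add_eq_zero_left h))]
    simp
  · simp

theorem gauss_ne_zero {χ : DirichletCharacter ℂ N} (hχ : χ.IsPrimitive) : gauss χ ≠ 0 := by
  intro h
  have h1 := gauss_mul_gauss_inv hχ
  rw [h, zero_mul] at h1
  have hN : (N : ℂ) ≠ 0 := by exact_mod_cast NeZero.ne N
  rcases χ.even_or_odd with h2 | h2 <;> rw [h2] at h1
  · exact hN (by simpa using h1.symm)
  · exact hN (by simpa using h1.symm)

/-- The functional equation at negative integers in disguise: B_{m+2}(a/N) is replaced by its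
Fourier series. Averaged against χ, the frequency n yields a Gauss sum times χ̄(n), and -n yields
the same up to χ(-1), whence the parity factor. -/
theorem bernoulliWeight_eq {χ : DirichletCharacter ℂ N} (hχ : χ.IsPrimitive) (m : ℕ) :
    (2 * Real.pi * I) ^ (m + 2) * bernoulliWeight N (fun k => χ (k : ZMod N)) (m + 1) =
      N ^ (m + 1) * (gauss χ * (1 + (-1) ^ m * χ (-1)) * χ⁻¹.LFunction (m + 2 : ℕ)) := by
  have hN : (0 : ℝ) < N := by exact_mod_cast NeZero.pos N
  have hfour : ∀ (n : ℤ) (a : ℕ), (fourier n (((a / N : ℝ) : ℝ) : UnitAddCircle) : ℂ) =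
      ZMod.stdAddChar (N := N) ((n : ZMod N) * (a : ZMod N)) := by
    intro n a
    have := ZMod.stdAddChar_coe (N := N) (n * a)
    push_cast at this
    rw [this, fourier_coe_apply]
    congr 1
    push_cast
    ring
  have h1 := hasSum_sum (s := Finset.range N) fun a ha =>
    (hasSum_one_div_nat_pow_mul_fourier (k := m + 2) (by omega) (x := (a / N : ℝ))
      ⟨by positivity, by
        rw [div_le_one hN]
        exact_mod_cast (Finset.mem_range.mp ha).le⟩).mul_left (χ (a : ZMod N))
  have hg : ∀ n : ℤ, ∑ a ∈ Finset.range N, χ (a : ZMod N) *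
      ZMod.stdAddChar (N := N) ((n : ZMod N) * (a : ZMod N)) = gauss χ * χ⁻¹ (n : ZMod N) := by
    intro n
    rw [sum_range_eq_sum_zmod (fun k => χ k * ZMod.stdAddChar (N := N) ((n : ZMod N) * k)),
      mul_comm, gauss, ← gaussSum_mulShift_of_isPrimitive _ hχ]
    rfl
  have h2 := (hasSum_div_pow_of_LSeriesHasSum (k := m + 2) (Nat.succ_ne_zero _)
    (LSeriesHasSum_character (χ := χ⁻¹) (one_lt_re_natCast_add_two m))).mul_left
      (gauss χ * (1 + (-1) ^ m * χ (-1)))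
  have h3 : ∀ n : ℕ, gauss χ * (1 + (-1) ^ m * χ (-1)) * (χ⁻¹ (n : ZMod N) / (n : ℂ) ^ (m + 2)) =
      ∑ a ∈ Finset.range N, χ (a : ZMod N) * (1 / (n : ℂ) ^ (m + 2) *
        (fourier n (((a / N : ℝ) : ℝ) : UnitAddCircle) +
          (-1) ^ (m + 2) * fourier (-n) (((a / N : ℝ) : ℝ) : UnitAddCircle))) := by
    intro n
    have hg1 := hg n
    have hg2 := hg (-n)
    have h4 : χ⁻¹ ((-(n : ℤ) : ℤ) : ZMod N) = χ (-1) * χ⁻¹ (n : ZMod N) := by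
      rw [Int.cast_neg, Int.cast_natCast, ← neg_one_mul, map_mul, inv_character_neg_one]
    rw [h4] at hg2
    rw [Int.cast_natCast] at hg1
    calc _ = 1 / (n : ℂ) ^ (m + 2) * (gauss χ * χ⁻¹ (n : ZMod N)) +
        1 / (n : ℂ) ^ (m + 2) * (-1) ^ m * (gauss χ * (χ (-1) * χ⁻¹ (n : ZMod N))) := by ring
      _ = _ := by
        rw [← hg1, ← hg2, Finset.mul_sum, Finset.mul_sum, ← Finset.sum_add_distrib]
        refine Finset.sum_congr rfl fun a _ => ?_
        rw [hfour, hfour, Int.cast_natCast, pow_add (-1 : ℂ) m 2, neg_one_sq]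
        ring
  simp only [h3] at h2
  have h5 := h1.unique h2
  rw [← h5, bernoulliWeight, Finset.mul_sum, Finset.mul_sum, Finset.mul_sum]
  refine Finset.sum_congr rfl fun a _ => ?_
  push_cast
  ring

/-- For odd n the cotangent coefficient of index n + 1 vanishes; for even n > 0 the Bernoulli weight
does, because χ is even. -/
theorem coeffF_eq_zero {χ : DirichletCharacter ℂ N} (hχ : χ.IsPrimitive) (h : χ.Even) {n : ℕ}
    (hn : n ≠ 0) : coeffF χ n = 0 := by
  obtain ⟨m, rfl⟩ := Nat.exists_eq_succ_of_ne_zero hn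
  rcases Nat.even_or_odd m with hm | hm
  · rw [coeffF, cotCoeff_of_even (by simpa [Nat.even_add_one] using hm)]
    simp
  · have h1 := bernoulliWeight_eq (isPrimitive_inv hχ) m
    rw [hm.neg_one_pow, inv_character_neg_one, h] at h1
    have h2 : (2 * Real.pi * I) ^ (m + 2) ≠ 0 := pow_ne_zero _ two_pi_I_ne_zero
    have h3 : bernoulliWeight N (fun k => χ⁻¹ (k : ZMod N)) (m + 1) = 0 := by
      simpa [h2, two_pi_I_ne_zero] using h1
    rw [coeffF, Nat.succ_eq_add_one, h3]
    simp

/-- For odd χ the two parity factors agree up to sign, and (1 - (-1)^n)² = 2 (1 - (-1)^n) reproduces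
the single factor on the Stokes side. The Gauss sums cancel through G(χ) G(χ̄) = -N, which is why R
contains none. -/
theorem coeffF_div_factorial {χ : DirichletCharacter ℂ N} (hχ : χ.IsPrimitive) (h : χ.Odd)
    (n : ℕ) : coeffF χ (n + 1) / ((n + 1).factorial : ℂ) =
      ∑' m : ℤ, stokesR χ m / (2 * Real.pi * I) / (m * (2 * Real.pi * I / N)) ^ (n + 2) := by
  have hN : (N : ℂ) ≠ 0 := by exact_mod_cast NeZero.ne N
  have hpi : (Real.pi : ℂ) ≠ 0 := by exact_mod_cast Real.pi_ne_zero
  have hI := I_ne_zero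
  have hP := two_pi_I_ne_zero
  have h1 := (hasSum_stokesR_div_pow χ n).mul_left
    (1 / (2 * Real.pi * I) / (2 * Real.pi * I / N) ^ (n + 2))
  have h2 : ∀ m : ℤ, 1 / (2 * Real.pi * I) / (2 * Real.pi * I / N) ^ (n + 2) *
      (stokesR χ m / (m : ℂ) ^ (n + 2)) =
      stokesR χ m / (2 * Real.pi * I) / (m * (2 * Real.pi * I / N)) ^ (n + 2) := by
    intro m
    rw [mul_pow]
    ring
  simp only [h2] at h1
  rw [h1.tsum_eq]
  have hw := bernoulliWeight_eq (isPrimitive_inv hχ) n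
  have hw' : bernoulliWeight N (fun k => χ⁻¹ (k : ZMod N)) (n + 1) =
      N ^ (n + 1) * (gauss χ⁻¹ * (1 - (-1) ^ n) * χ.LFunction (n + 2 : ℕ)) /
        (2 * Real.pi * I) ^ (n + 2) := by
    rw [eq_div_iff (pow_ne_zero _ hP), mul_comm, hw, inv_character_neg_one, h, inv_inv]
    ring
  have hG := gauss_mul_gauss_inv hχ
  rw [h] at hG
  have hfac : ((n + 1).factorial : ℂ) ≠ 0 := by exact_mod_cast (n + 1).factorial_ne_zero
  have hsq : ((-1 : ℂ) ^ n) ^ 2 = 1 := by rw [← pow_mul, mul_comm, pow_mul]; simp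
  have hz : ((n + 1 + 1 : ℕ) : ℂ) + 1 = ((n + 2 : ℕ) : ℂ) + 1 := by push_cast; ring
  rw [coeffF, hw', cotCoeff, lfun', hz, pow_add (-1 : ℂ) (n + 1) 1, pow_add (-1 : ℂ) n 1, div_pow]
  generalize riemannZeta (((n + 2 : ℕ) : ℂ) + 1) = Z
  generalize χ.LFunction ((n + 2 : ℕ) : ℂ) = w
  generalize (-1 : ℂ) ^ n = ε at *
  have e1 : -(I * gauss χ / (2 * Real.pi)) *
      (N ^ (n + 1) * (gauss χ⁻¹ * (1 - ε) * w) / (2 * Real.pi * I) ^ (n + 2) *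
        (((n + 1).factorial : ℂ) * ((ε * (-1) ^ 1 * (-1) ^ 1 - 1) * Z))) / ((n + 1).factorial : ℂ) =
      (gauss χ * gauss χ⁻¹) * (I / (2 * Real.pi)) * N ^ (n + 1) * (1 - ε) ^ 2 * w * Z /
        (2 * Real.pi * I) ^ (n + 2) := by
    field_simp
    ring
  have e2 : (1 - ε) ^ 2 = 2 * (1 - ε) := by linear_combination hsq
  have e3 : I / (2 * Real.pi) = -(1 / (2 * Real.pi * I)) := by
    field_simp
    exact I_sq
  rw [e1, hG, e2, e3]
  generalize (2 * Real.pi * I : ℂ) = P at *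
  field_simp
  ring

/-- As for 𝔣, with parity factor 1 + (-1)^n. Only one Gauss sum occurs here, and it survives in S.
-/
theorem coeffG_div_factorial {χ : DirichletCharacter ℂ N} (hχ : χ.IsPrimitive) (h : χ.Odd)
    (n : ℕ) : coeffG χ (n + 1) / ((n + 1).factorial : ℂ) =
      ∑' m : ℤ, stokesS χ m / (2 * Real.pi * I) / (m * (2 * Real.pi * I / N)) ^ (n + 2) := by
  have hN : (N : ℂ) ≠ 0 := by exact_mod_cast NeZero.ne N
  have hP := two_pi_I_ne_zero
  have h1 := (hasSum_stokesS_div_pow χ n).mul_left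
    (1 / (2 * Real.pi * I) / (2 * Real.pi * I / N) ^ (n + 2))
  have h2 : ∀ m : ℤ, 1 / (2 * Real.pi * I) / (2 * Real.pi * I / N) ^ (n + 2) *
      (stokesS χ m / (m : ℂ) ^ (n + 2)) =
      stokesS χ m / (2 * Real.pi * I) / (m * (2 * Real.pi * I / N)) ^ (n + 2) := by
    intro m
    rw [mul_pow]
    ring
  simp only [h2] at h1
  rw [h1.tsum_eq]
  have hw := bernoulliWeight_eq hχ (n + 1)
  have hw' : bernoulliWeight N (fun k => χ (k : ZMod N)) (n + 1 + 1) =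
      N ^ (n + 2) * (gauss χ * (1 + (-1) ^ n) * χ⁻¹.LFunction (n + 3 : ℕ)) /
        (2 * Real.pi * I) ^ (n + 3) := by
    rw [eq_div_iff (pow_ne_zero _ hP), mul_comm, hw, h, pow_succ (-1 : ℂ) n]
    ring
  have hfac : ((n + 1).factorial : ℂ) ≠ 0 := by exact_mod_cast (n + 1).factorial_ne_zero
  have hsq : ((-1 : ℂ) ^ n) ^ 2 = 1 := by rw [← pow_mul, mul_comm, pow_mul]; simp
  have hz : ((n + 1 : ℕ) : ℂ) + 1 = ((n + 2 : ℕ) : ℂ) := by push_cast; ring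
  have hz' : ((n + 2 : ℕ) : ℂ) + 1 = ((n + 3 : ℕ) : ℂ) := by push_cast; ring
  rw [coeffG, hw', cotCoeff, lfun, hz, hz', pow_succ (-1 : ℂ) n, div_pow,
    if_neg (Nat.succ_ne_zero n), add_zero]
  generalize riemannZeta ((n + 2 : ℕ) : ℂ) = Z
  generalize χ⁻¹.LFunction ((n + 3 : ℕ) : ℂ) = w
  generalize (-1 : ℂ) ^ n = ε at *
  have e2 : (1 + ε) ^ 2 = 2 * (1 + ε) := by linear_combination hsq
  have e1 : N ^ (n + 2) * (gauss χ * (1 + ε) * w) / (2 * Real.pi * I) ^ (n + 3) *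
        (((n + 1).factorial : ℂ) * ((ε * -1 - 1) * Z)) / ((n + 1).factorial : ℂ) =
      -(N ^ (n + 2) * gauss χ * (1 + ε) ^ 2 * w * Z / (2 * Real.pi * I) ^ (n + 3)) := by
    generalize (2 * Real.pi * I : ℂ) = P at *
    field_simp
    ring
  rw [e1, e2]
  generalize (2 * Real.pi * I : ℂ) = P at *
  field_simp
  ring

end ModularResurgence

namespace ModularResurgence

open scoped LSeries.notation

variable {N : ℕ} [NeZero N]

/-! ### Non-vanishing of the Stokes constants -/

/-- A zero of the geometric sum is a root of unity. By multiplicativity the Stokes constants are, up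
to non-zero factors, products of such sums over the prime powers dividing m. -/
theorem geom_sum_ne_zero_of_norm_ne_one {x : ℂ} (hx : ‖x‖ ≠ 1) (k : ℕ) :
    ∑ i ∈ Finset.range (k + 1), x ^ i ≠ 0 := by
  intro h
  have h1 := geom_sum_mul x (k + 1)
  rw [h, zero_mul] at h1
  have h2 : ‖x‖ ^ (k + 1) = 1 := by
    rw [← norm_pow, sub_eq_zero.mp h1.symm, norm_one]
  exact hx ((pow_eq_one_iff_of_nonneg (norm_nonneg x) k.succ_ne_zero).mp h2)

theorem isMultiplicative_toArithmeticFunction {f : ℕ → ℂ} (h1 : f 1 = 1)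
    (hmul : ∀ m n : ℕ, f (m * n) = f m * f n) : (toArithmeticFunction f).IsMultiplicative := by
  refine ArithmeticFunction.IsMultiplicative.iff_ne_zero.mpr ⟨?_, fun {m} {n} hm hn _ => ?_⟩
  · simp [toArithmeticFunction, h1]
  · simp [toArithmeticFunction, hm, hn, hmul]

theorem convolution_ne_zero {f g : ℕ → ℂ} (hf : (toArithmeticFunction f).IsMultiplicative)
    (hg : (toArithmeticFunction g).IsMultiplicative)
    (h : ∀ p k : ℕ, p.Prime → (f ⍟ g) (p ^ k) ≠ 0) {n : ℕ} (hn : n ≠ 0) : (f ⍟ g) n ≠ 0 := by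
  rw [show (f ⍟ g) n = (toArithmeticFunction f * toArithmeticFunction g) n from rfl,
    (hf.mul hg).multiplicative_factorization _ hn]
  exact Finset.prod_ne_zero_iff.mpr fun p hp => h p _ (Nat.prime_of_mem_primeFactors hp)

theorem isMultiplicative_character_div {N : ℕ} (χ : DirichletCharacter ℂ N) :
    (toArithmeticFunction fun d : ℕ => χ (d : ZMod N) / (d : ℂ)).IsMultiplicative :=
  isMultiplicative_toArithmeticFunction (by simp) fun m n => by
    push_cast
    rw [map_mul, mul_div_mul_comm]

theorem isMultiplicative_one_div_natCast :
    (toArithmeticFunction fun e : ℕ => 1 / (e : ℂ)).IsMultiplicative :=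
  isMultiplicative_toArithmeticFunction (by simp) fun m n => by
    push_cast
    rw [one_div_mul_one_div]

theorem isMultiplicative_const_one : (toArithmeticFunction (1 : ℕ → ℂ)).IsMultiplicative :=
  isMultiplicative_toArithmeticFunction (by simp) (by simp)

theorem one_convolution_character_div_ne_zero {N : ℕ} (χ : DirichletCharacter ℂ N) {n : ℕ}
    (hn : n ≠ 0) : ((1 : ℕ → ℂ) ⍟ fun d => χ (d : ZMod N) / (d : ℂ)) n ≠ 0 := by
  refine convolution_ne_zero isMultiplicative_const_one (isMultiplicative_character_div χ)
    (fun p k hp => ?_) hn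
  have h1 : ((1 : ℕ → ℂ) ⍟ fun d => χ (d : ZMod N) / (d : ℂ)) (p ^ k) =
      ∑ i ∈ Finset.range (k + 1), (χ (p : ZMod N) / (p : ℂ)) ^ i := by
    rw [LSeries.convolution_def]
    simp only [Pi.one_apply, one_mul]
    rw [Nat.sum_divisorsAntidiagonal' fun _ d : ℕ => χ (d : ZMod N) / (d : ℂ),
      Nat.sum_divisors_prime_pow hp]
    refine Finset.sum_congr rfl fun i _ => ?_
    push_cast
    rw [map_pow, div_pow]
  rw [h1]
  refine geom_sum_ne_zero_of_norm_ne_one (ne_of_lt ?_) k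
  have hp2 : (1 : ℝ) < p := by exact_mod_cast hp.one_lt
  rw [norm_div, norm_natCast, div_lt_one (by linarith)]
  exact (χ.norm_le_one _).trans_lt hp2

/-- At a prime power the ratio of the geometric sum is p χ(p), of absolute value p or 0 and so never
1. -/
theorem character_convolution_one_div_ne_zero {N : ℕ} (χ : DirichletCharacter ℂ N) {n : ℕ}
    (hn : n ≠ 0) : ((fun d : ℕ => χ (d : ZMod N)) ⍟ fun e : ℕ => 1 / (e : ℂ)) n ≠ 0 := by
  refine convolution_ne_zero χ.isMultiplicative_toArithmeticFunction
    isMultiplicative_one_div_natCast (fun p k hp => ?_) hn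
  have hp0 : (p : ℂ) ≠ 0 := by exact_mod_cast hp.ne_zero
  have h1 : ((fun d : ℕ => χ (d : ZMod N)) ⍟ fun e : ℕ => 1 / (e : ℂ)) (p ^ k) =
      1 / (p : ℂ) ^ k * ∑ i ∈ Finset.range (k + 1), (p * χ (p : ZMod N)) ^ i := by
    rw [LSeries.convolution_def]
    simp only
    rw [Nat.sum_divisorsAntidiagonal fun d e : ℕ => χ (d : ZMod N) * (1 / (e : ℂ)),
      Nat.sum_divisors_prime_pow hp, Finset.mul_sum]
    refine Finset.sum_congr rfl fun i hi => ?_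
    have hik : i ≤ k := Nat.lt_succ_iff.mp (Finset.mem_range.mp hi)
    rw [Nat.pow_div hik hp.pos]
    obtain ⟨j, rfl⟩ := Nat.exists_eq_add_of_le hik
    rw [Nat.add_sub_cancel_left]
    push_cast
    rw [map_pow, pow_add, mul_pow]
    field_simp
  rw [h1]
  refine mul_ne_zero (one_div_ne_zero (pow_ne_zero _ hp0))
    (geom_sum_ne_zero_of_norm_ne_one ?_ k)
  rw [norm_mul, norm_natCast]
  by_cases hu : IsUnit (p : ZMod N)
  · obtain ⟨u, hu⟩ := hu
    rw [← hu, χ.unit_norm_eq_one, mul_one]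
    exact_mod_cast hp.one_lt.ne'
  · rw [χ.map_nonunit hu, norm_zero, mul_zero]
    exact zero_ne_one

theorem stokesS_ne_zero {χ : DirichletCharacter ℂ N} (hχ : χ.IsPrimitive) {m : ℤ} (hm : m ≠ 0) :
    stokesS χ m ≠ 0 := by
  have key : ∀ n : ℕ, n ≠ 0 → stokesS χ n ≠ 0 := fun n hn => by
    rw [stokesS_eq]
    exact mul_ne_zero (mul_ne_zero (by norm_num) (gauss_ne_zero hχ))
      (one_convolution_character_div_ne_zero _ hn)
  obtain ⟨n, rfl | rfl⟩ := m.eq_nat_or_neg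
  · exact key n (by exact_mod_cast hm)
  · rw [stokesS_neg]
    exact key n (by simpa using hm)

theorem stokesR_ne_zero {N : ℕ} (χ : DirichletCharacter ℂ N) {m : ℤ} (hm : m ≠ 0) :
    stokesR χ m ≠ 0 := by
  have key : ∀ n : ℕ, n ≠ 0 → stokesR χ n ≠ 0 := fun n hn => by
    rw [stokesR_eq]
    exact mul_ne_zero two_ne_zero (character_convolution_one_div_ne_zero _ hn)
  obtain ⟨n, rfl | rfl⟩ := m.eq_nat_or_neg
  · exact key n (by exact_mod_cast hm)
  · rw [stokesR_neg, neg_ne_zero]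
    exact key n (by simpa using hm)

/-! ### The L-functions -/

theorem meromorphicAt_riemannZeta (s : ℂ) : MeromorphicAt riemannZeta s := by
  rcases eq_or_ne s 1 with rfl | hs
  -- The exponent 2, for a simple pole, makes the product continuous at 1 as it stands: its value
  -- there is 0, as is its limit. With exponent 1 the value would be 0 but the limit 1.
  · refine ⟨2, ?_⟩
    have h : ∀ s : ℂ, (s - 1) ^ 2 • riemannZeta s = (s - 1) * ((s - 1) * riemannZeta s) := by
      intro s
      rw [smul_eq_mul]
      ring
    simp only [h]
    refine Complex.analyticAt_of_differentiable_on_punctured_nhds_of_continuousAt ?_ ?_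
    · filter_upwards [self_mem_nhdsWithin] with s hs
      have := differentiableAt_riemannZeta hs
      fun_prop
    · rw [continuousAt_iff_punctured_nhds]
      have h1 : Tendsto (fun s : ℂ => s - 1) (𝓝[≠] 1) (𝓝 (1 - 1)) :=
        (by fun_prop : Continuous fun s : ℂ => s - 1).continuousWithinAt.tendsto
      simpa using h1.mul riemannZeta_residue_one
  · exact (analyticOn_riemannZeta s hs).meromorphicAt

theorem meromorphicAt_riemannZeta_add_one (s : ℂ) :
    MeromorphicAt (fun s => riemannZeta (s + 1)) s :=
  (meromorphicAt_riemannZeta (s + 1)).comp_analyticAt (g := fun s => s + 1) (by fun_prop)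

theorem meromorphicOn_lfun {χ : DirichletCharacter ℂ N} (hχ : χ ≠ 1) :
    MeromorphicOn (lfun χ) Set.univ := fun s _ => by
  have h : Differentiable ℂ fun s => χ⁻¹.LFunction (s + 1) :=
    (DirichletCharacter.differentiable_LFunction (inv_ne_one.mpr hχ)).comp
      (differentiable_id.add_const 1)
  exact (h.analyticAt s).meromorphicAt.mul (meromorphicAt_riemannZeta s)

theorem meromorphicOn_lfun' {χ : DirichletCharacter ℂ N} (hχ : χ ≠ 1) :
    MeromorphicOn (lfun' χ) Set.univ := fun s _ =>
  ((DirichletCharacter.differentiable_LFunction hχ).analyticAt s).meromorphicAt.mul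
    (meromorphicAt_riemannZeta_add_one s)

theorem isLFunction_convolution {f g : ℕ → ℂ} {Lf : ℂ → ℂ} (hL : MeromorphicOn Lf Set.univ)
    (hf : (toArithmeticFunction f).IsMultiplicative)
    (hg : (toArithmeticFunction g).IsMultiplicative)
    (h : ∀ s : ℂ, 1 < s.re → LSeriesHasSum (f ⍟ g) s (Lf s)) : IsLFunction (f ⍟ g) Lf := by
  refine ⟨hL, 1, zero_le_one, fun s hs => ?_⟩
  have hsum := h s hs
  refine ⟨hsum.LSeriesSummable, hsum.LSeries_eq.symm, ?_⟩
  have hfg : (toArithmeticFunction f * toArithmeticFunction g).IsMultiplicative := hf.mul hg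
  have h1 : (f ⍟ g) 1 = 1 := hfg.map_one
  have hmul : ∀ {m n : ℕ}, m.Coprime n →
      LSeries.term (f ⍟ g) s (m * n) = LSeries.term (f ⍟ g) s m * LSeries.term (f ⍟ g) s n := by
    intro m n hmn
    rcases eq_or_ne m 0 with rfl | hm
    · simp
    rcases eq_or_ne n 0 with rfl | hn
    · simp
    have h2 : (f ⍟ g) (m * n) = (f ⍟ g) m * (f ⍟ g) n := hfg.map_mul_of_coprime hmn
    rw [LSeries.term_of_ne_zero (mul_ne_zero hm hn), LSeries.term_of_ne_zero hm,
      LSeries.term_of_ne_zero hn, h2, Nat.cast_mul, natCast_mul_natCast_cpow, mul_div_mul_comm]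
  have key := EulerProduct.eulerProduct_hasProd (f := LSeries.term (f ⍟ g) s)
    (by rw [LSeries.term_of_ne_zero one_ne_zero, h1]; simp) hmul
    hsum.LSeriesSummable.norm (LSeries.term_zero _ _)
  rw [hsum.tsum_eq] at key
  convert! key using 4 with p k
  rw [LSeries.term_of_ne_zero (pow_ne_zero _ p.prop.ne_zero), natCast_cpow_natCast_mul,
    Nat.cast_pow]

theorem areLFunctionCoefficients_stokesS (hN : 2 ≤ N) {χ : DirichletCharacter ℂ N}
    (hχ : χ.IsPrimitive) :
    AreLFunctionCoefficients (fun m => stokesS χ m) (fun s => -2 * gauss χ * lfun χ s) := by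
  have hc : -2 * gauss χ ≠ 0 := mul_ne_zero (by norm_num) (gauss_ne_zero hχ)
  refine ⟨-2 * gauss χ, hc, ?_⟩
  simp only [stokesS_eq, mul_div_cancel_left₀ _ hc]
  exact isLFunction_convolution (meromorphicOn_lfun (ne_one_of_isPrimitive hN hχ))
    isMultiplicative_const_one (isMultiplicative_character_div χ⁻¹)
    fun s hs => LSeriesHasSum_stokesS χ hs

theorem AreLFunctionCoefficients.neg {S : ℕ → ℂ} {Lf : ℂ → ℂ} (h : AreLFunctionCoefficients S Lf) :
    AreLFunctionCoefficients (fun m => -S m) (fun s => -Lf s) := by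
  obtain ⟨c, hc, h⟩ := h
  exact ⟨-c, neg_ne_zero.mpr hc, by simpa only [neg_div_neg_eq] using h⟩

theorem areLFunctionCoefficients_neg_stokesS (hN : 2 ≤ N) {χ : DirichletCharacter ℂ N}
    (hχ : χ.IsPrimitive) :
    AreLFunctionCoefficients (fun m => -stokesS χ (-(m : ℤ)))
      (fun s => 2 * gauss χ * lfun χ s) := by
  simpa only [stokesS_neg, neg_mul, neg_neg] using (areLFunctionCoefficients_stokesS hN hχ).neg

theorem areLFunctionCoefficients_stokesR (hN : 2 ≤ N) {χ : DirichletCharacter ℂ N}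
    (hχ : χ.IsPrimitive) :
    AreLFunctionCoefficients (fun m => stokesR χ m) (fun s => 2 * lfun' χ s) := by
  refine ⟨2, two_ne_zero, ?_⟩
  simp only [stokesR_eq, mul_div_cancel_left₀ _ (two_ne_zero' ℂ)]
  exact isLFunction_convolution (meromorphicOn_lfun' (ne_one_of_isPrimitive hN hχ))
    χ.isMultiplicative_toArithmeticFunction isMultiplicative_one_div_natCast
    fun s hs => LSeriesHasSum_stokesR χ hs

/-- Non-vanishing serves to establish the convergence of the Mellin transform below. -/
theorem lfun_ne_zero (χ : DirichletCharacter ℂ N) {s : ℂ} (hs : 1 < s.re) : lfun χ s ≠ 0 := by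
  have h : 1 < (s + 1).re := by
    rw [add_re, one_re]
    linarith
  rw [lfun, DirichletCharacter.LFunction_eq_LSeries _ h]
  exact mul_ne_zero (DirichletCharacter.LSeries_ne_zero_of_one_lt_re _ h)
    (riemannZeta_ne_zero_of_one_lt_re hs)

theorem lfun'_ne_zero (χ : DirichletCharacter ℂ N) {s : ℂ} (hs : 1 < s.re) : lfun' χ s ≠ 0 := by
  have h : 1 < (s + 1).re := by
    rw [add_re, one_re]
    linarith
  rw [lfun', DirichletCharacter.LFunction_eq_LSeries _ hs]
  exact mul_ne_zero (DirichletCharacter.LSeries_ne_zero_of_one_lt_re _ hs)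
    (riemannZeta_ne_zero_of_one_lt_re h)

/-! ### Modular resurgence of the two expansions -/

theorem stokes_spacing_ne_zero : (2 * Real.pi * I / N : ℂ) ≠ 0 :=
  div_ne_zero two_pi_I_ne_zero (by exact_mod_cast NeZero.ne N)

theorem hasModularResurgentExpansion_weightedG (hN : 2 ≤ N) {χ : DirichletCharacter ℂ N}
    (hχ : χ.IsPrimitive) (h : χ.Odd) :
    HasModularResurgentExpansion (weightedG χ) (2 * Real.pi * I / N) (stokesS χ)
      (fun s => -2 * gauss χ * lfun χ s) (fun s => 2 * gauss χ * lfun χ s) := by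
  obtain ⟨ℓ, c, hasymp⟩ := exists_isAsymptoticExpansion_weightedG hN hχ
  exact ⟨_, hasymp,
    isGevreyOne_of_tsum stokes_spacing_ne_zero (summable_norm_stokesS χ)
      (coeffG_div_factorial hχ h),
    hasStokesTower_of_tsum stokes_spacing_ne_zero (fun _ => stokesS_ne_zero hχ)
      (summable_norm_stokesS χ) (coeffG_div_factorial hχ h),
    areLFunctionCoefficients_stokesS hN hχ, areLFunctionCoefficients_neg_stokesS hN hχ⟩

theorem hasModularResurgentExpansion_weightedF (hN : 2 ≤ N) {χ : DirichletCharacter ℂ N}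
    (hχ : χ.IsPrimitive) (h : χ.Odd) :
    HasModularResurgentExpansion (weightedF χ) (2 * Real.pi * I / N) (stokesR χ)
      (fun s => 2 * lfun' χ s) (fun s => 2 * lfun' χ s) := by
  obtain ⟨p, c, hasymp⟩ := exists_isAsymptoticExpansion_weightedF hN hχ
  refine ⟨_, hasymp,
    isGevreyOne_of_tsum stokes_spacing_ne_zero (summable_norm_stokesR χ)
      (coeffF_div_factorial hχ h),
    hasStokesTower_of_tsum stokes_spacing_ne_zero (fun _ => stokesR_ne_zero χ)
      (summable_norm_stokesR χ) (coeffF_div_factorial hχ h),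
    areLFunctionCoefficients_stokesR hN hχ, ?_⟩
  simpa only [stokesR_neg, neg_neg] using areLFunctionCoefficients_stokesR hN hχ

theorem not_hasModularResurgentExpansion_weightedF (hN : 2 ≤ N) {χ : DirichletCharacter ℂ N}
    (hχ : χ.IsPrimitive) (h : χ.Even) (𝒜 : ℂ) (S : ℤ → ℂ) (L₁ L₂ : ℂ → ℂ) :
    ¬ HasModularResurgentExpansion (weightedF χ) 𝒜 S L₁ L₂ := by
  rintro ⟨F, hF, hres⟩
  obtain ⟨p, c, hasymp⟩ := exists_isAsymptoticExpansion_weightedF hN hχ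
  have h1 : F.coeff = coeffF χ := hF.coeff_unique hasymp
  exact not_hasStokesTower_of_eq_zero (fun n hn => h1 ▸ coeffF_eq_zero hχ h hn) hres.tower

/-! ### Mellin transforms -/

/-- At y = it the generating function is a series of exponentials e^(-2πmt), whose Mellin transforms
(2πm)^(-s) Γ(s) add up to the Dirichlet series. -/
theorem IsGeneratingFunction.isInverseMellin {φ : ℂ → ℂ} {S : ℤ → ℂ} {c₀ c : ℂ} {Lf : ℂ → ℂ}
    (h : IsGeneratingFunction φ S c₀ c)
    (hL : ∀ s : ℂ, 1 < s.re → LSeriesHasSum (fun m : ℕ => S m) s (Lf s))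
    (hL0 : ∀ s : ℂ, 1 < s.re → Lf s ≠ 0) : IsInverseMellin φ Lf c₀ c := by
  obtain ⟨hc, hgen⟩ := h
  have hpi := Real.pi_pos
  refine ⟨1, fun s hs => ?_⟩
  have hs0 : 0 < s.re := zero_lt_one.trans hs
  have hp : ∀ m : ℕ, (0 : ℝ) < m + 1 := fun m => by positivity
  have hF : ∀ t ∈ Set.Ioi (0 : ℝ),
      HasSum (fun m : ℕ => c * S (m + 1) * (Real.exp (-(2 * Real.pi * (m + 1)) * t) : ℂ))
        (φ (I * t) - c₀) := by
    intro t ht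
    have h1 := hgen (I * t) (by simpa using ht)
    convert! h1 using 2 with m
    rw [← exp_nat_mul, mul_assoc c, ofReal_exp]
    congr 3
    push_cast
    linear_combination (-2 * Real.pi * (m + 1) * t : ℂ) * I_sq
  have hcpow : ∀ m : ℕ, ((2 * Real.pi * (m + 1) : ℝ) : ℂ) ^ s =
      (2 * Real.pi : ℂ) ^ s * ((m + 1 : ℕ) : ℂ) ^ s := by
    intro m
    rw [ofReal_mul, mul_cpow_ofReal_nonneg (by positivity) (hp m).le]
    push_cast
    rfl
  have hterm : HasSum (fun m : ℕ => S (m + 1) / ((m + 1 : ℕ) : ℂ) ^ s) (Lf s) := by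
    have h1 := (hasSum_nat_add_iff' 1).mpr (hL s hs)
    rw [Finset.sum_range_one, LSeries.term_zero, sub_zero] at h1
    convert! h1 using 2 with m
  have h2pi : (2 * Real.pi : ℂ) ^ s ≠ 0 := by
    rw [Ne, cpow_eq_zero_iff]
    simp [hpi.ne']
  have hsum : Summable fun m : ℕ => ‖c * S (m + 1)‖ / (2 * Real.pi * (m + 1) : ℝ) ^ s.re := by
    have h1 := (hterm.summable.norm.mul_left ‖c‖).mul_right ‖(2 * Real.pi : ℂ) ^ s‖⁻¹
    refine h1.congr fun m => ?_
    have h2 : (0 : ℝ) < 2 * Real.pi * (m + 1) := by positivity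
    rw [← norm_cpow_eq_rpow_re_of_pos h2, hcpow, norm_mul, norm_mul, norm_div]
    ring
  have h3 := hasSum_mellin (fun m => Or.inr (by positivity)) hs0 hF hsum
  have h4 := hterm.mul_left (c * (2 * Real.pi : ℂ) ^ (-s) * Gamma s)
  have h5 : mellin (fun t : ℝ => φ (I * t) - c₀) s =
      c * (2 * Real.pi : ℂ) ^ (-s) * Gamma s * Lf s := by
    refine h3.unique ?_
    convert! h4 using 2 with m
    rw [hcpow, cpow_neg]
    ring
  refine ⟨?_, h5⟩
  -- A divergent integral has the default value 0, whereas the computed transform is non-zero. So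
  -- the value alone forces convergence.
  by_contra hconv
  have h6 : mellin (fun t : ℝ => φ (I * t) - c₀) s = 0 := MeasureTheory.integral_undef hconv
  rw [h6] at h5
  refine mul_ne_zero (mul_ne_zero (mul_ne_zero hc ?_) (Gamma_ne_zero_of_re_pos hs0))
    (hL0 s hs) h5.symm
  rw [cpow_neg]
  exact inv_ne_zero h2pi

theorem LSeriesHasSum.const_mul {f : ℕ → ℂ} {s a : ℂ} (h : LSeriesHasSum f s a) (c : ℂ) :
    LSeriesHasSum (fun n => c * f n) s (c * a) :=
  h.smul c

theorem isInverseMellin_weightedF {χ : DirichletCharacter ℂ N} (hχ : χ.IsPrimitive) :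
    IsInverseMellin (weightedF χ) (fun s => -2 * gauss χ * lfun χ s) (constF χ) (1 / 2) :=
  (isGeneratingFunction_weightedF hχ).isInverseMellin
    (fun s hs => by
      simp only [stokesS_eq]
      exact LSeriesHasSum.const_mul (LSeriesHasSum_stokesS χ hs) _)
    fun s hs => mul_ne_zero (mul_ne_zero (by norm_num) (gauss_ne_zero hχ)) (lfun_ne_zero χ hs)

theorem isInverseMellin_weightedG (hN : 2 ≤ N) (χ : DirichletCharacter ℂ N) :
    IsInverseMellin (weightedG χ) (fun s => 2 * lfun' χ s) 0 (-1 / 2) :=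
  (isGeneratingFunction_weightedG hN χ).isInverseMellin
    (fun s hs => by
      simp only [stokesR_eq]
      exact LSeriesHasSum.const_mul (LSeriesHasSum_stokesR χ hs) _)
    fun s hs => mul_ne_zero two_ne_zero (lfun'_ne_zero χ hs)

/-! ### The functional equation -/

/-- The functional equations of L(·, χ̄) between s + 1 and -s and of ζ between s and 1 - s are
multiplied; the root number of an odd character is G(χ) / (i √N). Both factors satisfy their
equations for every s, with the values assigned at poles. -/
theorem lam_eq {χ : DirichletCharacter ℂ N} (hχ : χ.IsPrimitive) (h : χ.Odd) (s : ℂ) :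
    lam χ s = I * (Real.sqrt N : ℂ) / gauss χ * lam' χ (-s) := by
  have hN : (N : ℂ) ≠ 0 := by exact_mod_cast NeZero.ne N
  have hG := gauss_ne_zero hχ
  have hsqrt : (Real.sqrt N : ℂ) = (N : ℂ) ^ (1 / 2 : ℂ) := by
    rw [Real.sqrt_eq_rpow, ofReal_cpow (Nat.cast_nonneg N)]
    push_cast
    rfl
  have h1 := hχ.completedLFunction_one_sub (s + 1)
  rw [show (1 : ℂ) - (s + 1) = -s by ring, DirichletCharacter.rootNumber, if_neg h.not_even,
    pow_one] at h1
  have h2 := completedRiemannZeta_one_sub s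
  rw [lam, lam', completedL, completedL, h1, show -s + 1 = 1 - s by ring, h2, hsqrt,
    ← gauss]
  have h3 : (N : ℂ) ^ ((s + 1) / 2) = (N : ℂ) ^ (-s / 2) * (N : ℂ) ^ (s + 1 - 1 / 2) := by
    rw [← cpow_add _ _ hN]
    congr 1
    ring
  have h4 : (N : ℂ) ^ (1 / 2 : ℂ) ≠ 0 := by simp [cpow_eq_zero_iff, hN]
  rw [h3]
  generalize (N : ℂ) ^ (1 / 2 : ℂ) = w at *
  have hI := I_ne_zero
  field_simp

theorem compl_range_intCast_mem_codiscrete :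
    (Set.range ((↑) : ℤ → ℂ))ᶜ ∈ codiscrete ℂ :=
  compl_mem_codiscrete_iff.mpr ⟨Complex.isClosed_range_intCast,
    Complex.isClosedEmbedding_intCast.isEmbedding.isDiscrete_range⟩

/-- `Gammaℝ` takes the value 0 only at its poles, which are integers. The sign ε allows for both
sides, s and -s, of the functional equation. -/
theorem Gammaℝ_ne_zero_of_notMem_range {s : ℂ} (hs : s ∉ Set.range ((↑) : ℤ → ℂ)) (n : ℤ)
    (ε : ℤˣ) : Gammaℝ ((ε : ℤ) * s + n) ≠ 0 := by
  rw [Ne, Gammaℝ_eq_zero_iff]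
  rintro ⟨k, hk⟩
  refine hs ⟨ε * (-(2 * k) - n), ?_⟩
  have hε : ((ε : ℤ) : ℂ) * ((ε : ℤ) : ℂ) = 1 := by
    exact_mod_cast Int.units_coe_mul_self ε
  push_cast
  linear_combination (-((ε : ℤ) : ℂ)) * hk + s * hε

theorem satisfyFunctionalEquation_lfun (hN : 2 ≤ N) {χ : DirichletCharacter ℂ N}
    (hχ : χ.IsPrimitive) (h : χ.Odd) {a b : ℂ} (ha : a ≠ 0) (hb : b ≠ 0) :
    SatisfyFunctionalEquation (fun s => a * lfun χ s) (fun s => b * lfun' χ s) := by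
  have hN0 : (N : ℂ) ≠ 0 := by exact_mod_cast NeZero.ne N
  have hN1 : N ≠ 1 := by omega
  have hG := gauss_ne_zero hχ
  have hpos : 0 < Real.sqrt N := Real.sqrt_pos.mpr (by exact_mod_cast NeZero.pos N)
  have hw : (Real.sqrt N : ℂ) ≠ 0 := by exact_mod_cast hpos.ne'
  have hinv : χ⁻¹.Odd := by
    rw [DirichletCharacter.Odd, inv_character_neg_one, h]
  have hpow : ∀ s : ℂ, (Real.sqrt N : ℂ) ^ s = (N : ℂ) ^ (s / 2) := by
    intro s
    rw [cpow_def_of_ne_zero hw, cpow_def_of_ne_zero hN0, ← ofReal_log hpos.le,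
      Real.log_sqrt (Nat.cast_nonneg N), ← natCast_log]
    push_cast
    ring_nf
  -- Shifts on the left: 2 from the odd character χ̄ at s + 1, and 0 from ζ(s). On the right, at -s:
  -- 1 from the odd character χ, and 1 from ζ(1 - s). The √N in the constant of `lam_eq` cancels
  -- against N^((s+1)/2) = √N^s √N.
  refine ⟨Real.sqrt N, Real.sqrt N, {2, 0}, {1, 1}, a / b * (I / gauss χ), hpos, hpos,
    mul_ne_zero (div_ne_zero ha hb) (div_ne_zero I_ne_zero hG), ?_⟩
  filter_upwards [compl_range_intCast_mem_codiscrete] with s hs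
  have g0 : Gammaℝ s ≠ 0 := by simpa using Gammaℝ_ne_zero_of_notMem_range hs 0 1
  have g2 : Gammaℝ (s + 2) ≠ 0 := by simpa using Gammaℝ_ne_zero_of_notMem_range hs 2 1
  have g1 : Gammaℝ (-s + 1) ≠ 0 := by simpa using Gammaℝ_ne_zero_of_notMem_range hs 1 (-1)
  have hs0 : s ≠ 0 := fun h0 => hs ⟨0, by simp [h0]⟩
  have hs1 : -s + 1 ≠ 0 := fun h0 => hs ⟨1, by
    push_cast
    linear_combination h0⟩
  have e1 : completionFactor (Real.sqrt N) {2, 0} s * lfun χ s * Real.sqrt N = lam χ s := by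
    rw [completionFactor, lfun, lam, completedL,
      DirichletCharacter.LFunction_eq_completed_div_gammaFactor _ _ (Or.inr hN1),
      hinv.gammaFactor_def, riemannZeta_def_of_ne_zero hs0, add_assoc s 1 1, one_add_one_eq_two,
      add_div, cpow_add _ _ hN0, ← hpow s, ← hpow 1, cpow_one]
    simp only [Multiset.insert_eq_cons, Multiset.map_cons, Multiset.map_singleton,
      Multiset.prod_cons, Multiset.prod_singleton, add_zero]
    field_simp
  have e2 : completionFactor (Real.sqrt N) {1, 1} (-s) * lfun' χ (-s) = lam' χ (-s) := by
    rw [completionFactor, lfun', lam', completedL,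
      DirichletCharacter.LFunction_eq_completed_div_gammaFactor _ _ (Or.inr hN1),
      h.gammaFactor_def, riemannZeta_def_of_ne_zero hs1, ← hpow (-s)]
    simp only [Multiset.insert_eq_cons, Multiset.map_cons, Multiset.map_singleton,
      Multiset.prod_cons, Multiset.prod_singleton]
    field_simp
  have e3 := lam_eq hχ h s
  rw [← e1, ← e2] at e3
  refine mul_right_cancel₀ hw ?_
  calc _ = a * (completionFactor (Real.sqrt N) {2, 0} s * lfun χ s * Real.sqrt N) := by ring
    _ = _ := by
      rw [e3]
      field_simp

end ModularResurgence

end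

/-! ### The main theorem. -/

theorem theorem1p5 (N : ℕ) [NeZero N] (hN : 2 ≤ N) (χ : DirichletCharacter ℂ N)
    (hχ : χ.IsPrimitive) :
    (SatisfyParadigm (weightedF χ) (weightedG χ) ↔ χ.Odd) ∧
    (χ.Odd →
      HasModularResurgentExpansion (weightedG χ) (2 * Real.pi * Complex.I / N) (stokesS χ)
        (fun s => -2 * gauss χ * lfun χ s) (fun s => 2 * gauss χ * lfun χ s) ∧
      IsGeneratingFunction (weightedF χ) (stokesS χ) (constF χ) (1 / 2) ∧
      HasModularResurgentExpansion (weightedF χ) (2 * Real.pi * Complex.I / N) (stokesR χ)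
        (fun s => 2 * lfun' χ s) (fun s => 2 * lfun' χ s) ∧
      IsGeneratingFunction (weightedG χ) (stokesR χ) 0 (-1 / 2) ∧
      ∀ s : ℂ, s ≠ 0 → s ≠ 1 →
        lam χ s = Complex.I * (Real.sqrt N : ℂ) / gauss χ * lam' χ (-s)) := by
  have hG := gauss_ne_zero hχ
  refine ⟨⟨?_, fun h => ?_⟩, fun h => ⟨hasModularResurgentExpansion_weightedG hN hχ h,
    isGeneratingFunction_weightedF hχ, hasModularResurgentExpansion_weightedF hN hχ h,
    isGeneratingFunction_weightedG hN χ, fun s _ _ => lam_eq hχ h s⟩⟩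
  -- The resurgence of 𝔣 alone already excludes even characters.
  · rintro ⟨𝒜, ℬ, S, R, L₁, L₂, L₁', L₂', f₀, g₀, cf, cg, -, -, -, hf, -⟩
    exact χ.even_or_odd.resolve_left fun he =>
      not_hasModularResurgentExpansion_weightedF hN hχ he _ _ _ _ hf
  · exact ⟨_, _, _, _, _, _, _, _, _, _, _, _, hasModularResurgentExpansion_weightedG hN hχ h,
      isGeneratingFunction_weightedF hχ, isInverseMellin_weightedF hχ,
      hasModularResurgentExpansion_weightedF hN hχ h, isGeneratingFunction_weightedG hN χ,
      isInverseMellin_weightedG hN χ,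
      satisfyFunctionalEquation_lfun hN hχ h (mul_ne_zero (by norm_num) hG) two_ne_zero,
      satisfyFunctionalEquation_lfun hN hχ h (mul_ne_zero two_ne_zero hG) two_ne_zero⟩
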